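/- For $M_1,\dots,M_4\in \mathrm{SL}_2(\mathbb C)$ put $M_\infty=(M_4M_3M_2M_1)^{-1}$. Fix $p_1,\dots,p_4,p_\infty\in\mathbb C$ and let $\mathcal U$ be the set of quadruples $(M_1,\dots,M_4)\in \mathrm{SL}_2(\mathbb C)^4$, modulo simultaneous conjugation by $\mathrm{SL}_2(\mathbb C)$, such that $\operatorname{Tr} M_i=p_i$ for $i=1,\dots,4$, $\operatorname{Tr} M_4M_3M_2M_1=p_\infty$, the group $\langle M_1,\dots,M_4\rangle$ acts irreducibly on $\mathbb C^2$, and $M_i\neq\pm\mathbb I$ for $i=1,2,3,4,\infty$. Give $\mathcal U$ its structure of a quotient variety: a subset is open, and a function on an open subset is regular, if its pullback to quadruples is Zariski open, respectively is locally a quotient of polynomials in the matrix entries. Consider on $\mathcal U$ the ten functions $$p_{ij}=\operatorname{Tr} M_iM_j\ (4\ge i>j\ge 1),\qquad p_{ijk}=\operatorname{Tr}M_iM_jM_k\ (4\ge i>j>k\ge 1),$$ let $I=\langle f_1,\dots,f_{15}\rangle\subset \mathbb C[p_{21},p_{31},p_{32},p_{41},p_{42},p_{43},p_{321},p_{432},p_{431},p_{421}]$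 with the polynomials $f_1,\dots,f_{15}$ listed below, and let $\mathcal A\subset\mathbb C^{10}$ be the affine variety of common zeros of $I$. For every choice of $p_1,\dots,p_4,p_\infty$: 1. The polynomials $f_1,\dots,f_{15}$ are algebraically dependent over $\mathbb C$, and the ideal $I$ is radical, so that $\mathcal A$ has coordinate ring $\mathbb C[p_{21},\dots,p_{421}]/I$. This ring has Krull dimension four. 2. The functions $p_{ij},p_{ijk}$ define an isomorphism of $\mathcal U$ onto a Zariski open subvariety of the four-dimensional affine variety $\mathcal A$. 3. This map is an isomorphism of varieties $\mathcal U\cong\mathcal A$ if and only if $p_1,\dots,p_4,p_\infty$ are generic in the following sense: none of them is $\pm2$, and for all $a_1,\dots,a_4\in\mathbb C^*$ with $a_i+a_i^{-1}=p_i$ $(i=1,\dots,4)$ one has $a_1a_2a_3a_4+(a_1a_2a_3a_4)^{-1}\ne p_\infty$. The polynomials are $$f_{1} = p_{32}p_{31}p_{21} + p_{32}^2 + p_{31}^2 + p_{21}^2 - (p_{1}p_{321} + p_{2}p_{3})p_{32} - (p_{2}p_{321} + p_{1}p_{3})p_{31} - (p_{3}p_{321} + p_{1}p_{2})p_{21}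 + p_{3}^2 + p_{2}^2 + p_{1}^2 + p_{321}^2 + p_{3}p_{2}p_{1}p_{321} - 4,$$ $$f_{2} = p_{42}p_{41}p_{21} + p_{42}^2 + p_{41}^2 + p_{21}^2 - (p_{1}p_{421} + p_{2}p_{4})p_{42} - (p_{2}p_{421} + p_{1}p_{4})p_{41} - (p_{4}p_{421} + p_{1}p_{2})p_{21} + p_{4}^2 + p_{2}^2 + p_{1}^2 + p_{421}^2 + p_{4}p_{2}p_{1}p_{421} - 4,$$ $$f_{3} = p_{43}p_{41}p_{31} + p_{43}^2 + p_{41}^2 + p_{31}^2 - (p_{1}p_{431} + p_{3}p_{4})p_{43} - (p_{3}p_{431} + p_{1}p_{4})p_{41} - (p_{4}p_{431} + p_{1}p_{3})p_{31} + p_{4}^2 + p_{3}^2 + p_{1}^2 + p_{431}^2 + p_{4}p_{3}p_{1}p_{431} - 4,$$ $$f_{4} = p_{43}p_{42}p_{32} + p_{43}^2 + p_{42}^2 + p_{32}^2 - (p_{2}p_{432} + p_{3}p_{4})p_{43} - (p_{3}p_{432} + p_{2}p_{4})p_{42} - (p_{4}p_{432} + p_{2}p_{3})p_{32} + p_{4}^2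 + p_{3}^2 + p_{2}^2 + p_{432}^2 + p_{4}p_{3}p_{2}p_{432} - 4,$$ $$f_{5} = - 2p_\infty + p_{1}p_{2}p_{3}p_{4} + p_{1}p_{432} + p_{2}p_{431} + p_{3}p_{421} + p_{321}p_{4} + p_{21}p_{43} + p_{32}p_{41} - p_{1}p_{2}p_{43} - p_{1}p_{4}p_{32} - p_{2}p_{3}p_{41} - p_{3}p_{4}p_{21} - p_{42}p_{31},$$ $$f_{6} = p_{2}p_{3}p_{4} - p_{32}p_{4} - p_{21}p_{3}p_{41} + p_{321}p_{41} - p_{3}p_{42} + p_{1}p_{3}p_{421} - p_{31}p_{421} - p_{2}p_{43} + p_{21}p_{431} + 2p_{432} - p_{1}p_\infty,$$ $$f_{7} = - p_{1}p_{4} + 2p_{41} + p_{21}p_{42} - p_{2}p_{421} + p_{31}p_{43} + p_{21}p_{32}p_{43} - p_{2}p_{321}p_{43} - p_{3}p_{431} - p_{21}p_{3}p_{432} + p_{321}p_{432} + p_{2}p_{3}p_\infty - p_{32}p_\infty,$$ $$f_{8} = - p_{1}p_{2}p_{3} + p_{21}p_{3} + p_{2}p_{31} + p_{1}p_{32} -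 2p_{321} + p_{2}p_{41}p_{43} - p_{421}p_{43} - p_{2}p_{4}p_{431} + p_{42}p_{431} - p_{41}p_{432} + p_{4}p_\infty,$$ $$f_{9} = - p_{1}p_{2} + 2p_{21} + p_{31}p_{32} - p_{3}p_{321} + p_{41}p_{42} - p_{4}p_{421} + p_{32}p_{41}p_{43} - p_{32}p_{4}p_{431} - p_{3}p_{41}p_{432} + p_{431}p_{432} + p_{3}p_{4}p_\infty - p_{43}p_\infty,$$ $$f_{10} = - p_{1}p_{2}p_{4} + p_{21}p_{4} + p_{2}p_{41} + p_{1}p_{42} - 2p_{421} + p_{1}p_{32}p_{43} - p_{321}p_{43} - p_{32}p_{431} - p_{1}p_{3}p_{432} + p_{31}p_{432} + p_{3}p_\infty,$$ $$f_{11} = p_{1}p_{3}p_{4} - p_{31}p_{4} - p_{21}p_{32}p_{4} + p_{2}p_{321}p_{4} - p_{3}p_{41} - p_{321}p_{42} + p_{32}p_{421} - p_{1}p_{43} + 2p_{431} + p_{21}p_{432} - p_{2}p_\infty,$$ $$f_{12} = - p_{2}p_{4} + p_{21}p_{41} + 2p_{42} - p_{1}p_{421} + p_{32}p_{43} - p_{321}p_{431}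 - p_{3}p_{432} + p_{31}p_\infty,$$ $$f_{13} = p_{1}p_{3} - 2p_{31} - p_{21}p_{32} + p_{2}p_{321} - p_{41}p_{43} + p_{4}p_{431} + p_{421}p_{432} - p_{42}p_\infty,$$ $$f_{14} = p_{2}p_{3} - p_{21}p_{31} - 2p_{32} + p_{1}p_{321} - p_{21}p_{41}p_{43} - p_{42}p_{43} + p_{1}p_{421}p_{43} + p_{21}p_{4}p_{431} - p_{421}p_{431} + p_{4}p_{432} - p_{1}p_{4}p_\infty + p_{41}p_\infty,$$ $$f_{15} = - p_{3}p_{4} + p_{31}p_{41} + p_{21}p_{32}p_{41} - p_{2}p_{321}p_{41} + p_{32}p_{42} - p_{1}p_{32}p_{421} + p_{321}p_{421} + 2p_{43} - p_{1}p_{431} - p_{2}p_{432} + p_{1}p_{2}p_\infty - p_{21}p_\infty.$$ -/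

import Mathlib

open MvPolynomial Matrix

namespace Garnier

/-! ### The affine variety -/

/-- Names of the ten coordinates `p_ij` (`i > j`) and `p_ijk` (`i > j > k`). -/
inductive Coord : Type
  | p21 | p31 | p32 | p41 | p42 | p43 | p321 | p432 | p431 | p421

/-- The fifteen expressions `f_1, …, f_15`, listed in this order, over an arbitrary commutative
ring. -/
def rel {R : Type} [CommRing R] (p1 p2 p3 p4 pinf p21 p31 p32 p41 p42 p43 p321 p432 p431 p421 : R) :
    Fin 15 → R :=
  ![
    p32 * p31 * p21 + p32^2 + p31^2 + p21^2 - (p1 * p321 + p2 * p3) * p32 - (p2 * p321 + p1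
      * p3) * p31 - (p3 * p321 + p1 * p2) * p21 + p3^2 + p2^2 + p1^2 + p321^2 + p3 * p2 * p1
      * p321 - 4,
    p42 * p41 * p21 + p42^2 + p41^2 + p21^2 - (p1 * p421 + p2 * p4) * p42 - (p2 * p421 + p1
      * p4) * p41 - (p4 * p421 + p1 * p2) * p21 + p4^2 + p2^2 + p1^2 + p421^2 + p4 * p2 * p1
      * p421 - 4,
    p43 * p41 * p31 + p43^2 + p41^2 + p31^2 - (p1 * p431 + p3 * p4) * p43 - (p3 * p431 + p1
      * p4) * p41 - (p4 * p431 + p1 * p3) * p31 + p4^2 + p3^2 + p1^2 + p431^2 + p4 * p3 * p1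
      * p431 - 4,
    p43 * p42 * p32 + p43^2 + p42^2 + p32^2 - (p2 * p432 + p3 * p4) * p43 - (p3 * p432 + p2
      * p4) * p42 - (p4 * p432 + p2 * p3) * p32 + p4^2 + p3^2 + p2^2 + p432^2 + p4 * p3 * p2
      * p432 - 4,
    -2 * pinf + p1 * p2 * p3 * p4 + p1 * p432 + p2 * p431 + p3 * p421 + p321 * p4 + p21 *
      p43 + p32 * p41 - p1 * p2 * p43 - p1 * p4 * p32 - p2 * p3 * p41 - p3 * p4 * p21 - p42
      * p31,
    p2 * p3 * p4 - p32 * p4 - p21 * p3 * p41 + p321 * p41 - p3 * p42 + p1 * p3 * p421 - p31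
      * p421 - p2 * p43 + p21 * p431 + 2 * p432 - p1 * pinf,
    -p1 * p4 + 2 * p41 + p21 * p42 - p2 * p421 + p31 * p43 + p21 * p32 * p43 - p2 * p321 *
      p43 - p3 * p431 - p21 * p3 * p432 + p321 * p432 + p2 * p3 * pinf - p32 * pinf,
    -p1 * p2 * p3 + p21 * p3 + p2 * p31 + p1 * p32 - 2 * p321 + p2 * p41 * p43 - p421 * p43
      - p2 * p4 * p431 + p42 * p431 - p41 * p432 + p4 * pinf,
    -p1 * p2 + 2 * p21 + p31 * p32 - p3 * p321 + p41 * p42 - p4 * p421 + p32 * p41 * p43 -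
      p32 * p4 * p431 - p3 * p41 * p432 + p431 * p432 + p3 * p4 * pinf - p43 * pinf,
    -p1 * p2 * p4 + p21 * p4 + p2 * p41 + p1 * p42 - 2 * p421 + p1 * p32 * p43 - p321 * p43
      - p32 * p431 - p1 * p3 * p432 + p31 * p432 + p3 * pinf,
    p1 * p3 * p4 - p31 * p4 - p21 * p32 * p4 + p2 * p321 * p4 - p3 * p41 - p321 * p42 + p32
      * p421 - p1 * p43 + 2 * p431 + p21 * p432 - p2 * pinf,
    -p2 * p4 + p21 * p41 + 2 * p42 - p1 * p421 + p32 * p43 - p321 * p431 - p3 * p432 + p31 *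
      pinf,
    p1 * p3 - 2 * p31 - p21 * p32 + p2 * p321 - p41 * p43 + p4 * p431 + p421 * p432 - p42 *
      pinf,
    p2 * p3 - p21 * p31 - 2 * p32 + p1 * p321 - p21 * p41 * p43 - p42 * p43 + p1 * p421 *
      p43 + p21 * p4 * p431 - p421 * p431 + p4 * p432 - p1 * p4 * pinf + p41 * pinf,
    -p3 * p4 + p31 * p41 + p21 * p32 * p41 - p2 * p321 * p41 + p32 * p42 - p1 * p32 * p421 +
      p321 * p421 + 2 * p43 - p1 * p431 - p2 * p432 + p1 * p2 * pinf - p21 * pinf]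

/-- For fixed `p_1, …, p_4, p_∞` (`p i` is `p_{i+1}`), the polynomials `f_1, …, f_15` in the ten
variables `p_ij`, `p_ijk`. -/
noncomputable def f (p : Fin 4 → ℂ) (pinf : ℂ) : Fin 15 → MvPolynomial Coord ℂ :=
  rel (C (p 0)) (C (p 1)) (C (p 2)) (C (p 3)) (C pinf)
    (X .p21) (X .p31) (X .p32) (X .p41) (X .p42) (X .p43) (X .p321) (X .p432) (X .p431) (X .p421)

/-- The ideal generated by `f_1, …, f_15`. -/
noncomputable def relIdeal (p : Fin 4 → ℂ) (pinf : ℂ) : Ideal (MvPolynomial Coord ℂ) :=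
  Ideal.span (Set.range (f p pinf))

/-- The coordinate ring `ℂ[p_21, …, p_421] / ⟨f_1, …, f_15⟩`. -/
abbrev CoordRing (p : Fin 4 → ℂ) (pinf : ℂ) : Type :=
  MvPolynomial Coord ℂ ⧸ relIdeal p pinf

/-- The points of the affine variety `𝒜`: the common zeros of `f_1, …, f_15` in `ℂ¹⁰`. -/
abbrev Points (p : Fin 4 → ℂ) (pinf : ℂ) : Type :=
  zeroLocus ℂ (relIdeal p pinf)

/-! ### The moduli space of monodromy data -/

/-- Quadruples `(M_1, M_2, M_3, M_4)` in `SL₂(ℂ)`; `M i` is `M_{i+1}`. -/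
abbrev Quad : Type := Fin 4 → SpecialLinearGroup (Fin 2) ℂ

/-- `M_∞`, determined by `M_∞ M_4 M_3 M_2 M_1 = 1`. -/
noncomputable def Minf (M : Quad) : SpecialLinearGroup (Fin 2) ℂ := (M 3 * M 2 * M 1 * M 0)⁻¹

/-- The trace of an element of `SL₂(ℂ)`. -/
noncomputable def tr (g : SpecialLinearGroup (Fin 2) ℂ) : ℂ := (g : Matrix (Fin 2) (Fin 2) ℂ).trace

/-- The monodromy group `⟨M_1, …, M_4⟩` acts irreducibly on `ℂ²`. -/
def IsIrred (M : Quad) : Prop :=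
  ∀ W : Submodule ℂ (Fin 2 → ℂ),
    (∀ g ∈ Subgroup.closure (Set.range M), ∀ w ∈ W, (g : Matrix (Fin 2) (Fin 2) ℂ) *ᵥ w ∈ W) →
      W = ⊥ ∨ W = ⊤

/-- Irreducible quadruples with `Tr M_i = p_i`, `Tr M_4 M_3 M_2 M_1 = p_∞` and none of
`M_1, …, M_4, M_∞` equal to `±1`. -/
def Data (p : Fin 4 → ℂ) (pinf : ℂ) : Type :=
  {M : Quad // (∀ i, tr (M i) = p i) ∧ tr (M 3 * M 2 * M 1 * M 0) = pinf ∧ IsIrred M ∧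
    (∀ i, M i ≠ 1 ∧ M i ≠ -1) ∧ Minf M ≠ 1 ∧ Minf M ≠ -1}

/-- Simultaneous conjugation by an element of `SL₂(ℂ)`. -/
def conj (p : Fin 4 → ℂ) (pinf : ℂ) : Setoid (Data p pinf) where
  r M N := ∃ P : SpecialLinearGroup (Fin 2) ℂ, ∀ i, N.1 i = P * M.1 i * P⁻¹
  iseqv :=
    { refl := fun M => ⟨1, fun i => by simp⟩
      symm := by
        rintro M N ⟨P, h⟩
        exact ⟨P⁻¹, fun i => by rw [h i]; group⟩
      trans := by
        rintro M N K ⟨P, h⟩ ⟨Q, k⟩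
        exact ⟨Q * P, fun i => by rw [k i, h i]; group⟩ }

/-- The set `𝒰` for the given values of `p_1, …, p_4, p_∞`. -/
def U (p : Fin 4 → ℂ) (pinf : ℂ) : Type := Quotient (conj p pinf)

/-- The numbers `p_ij = Tr M_i M_j` and `p_ijk = Tr M_i M_j M_k` of a quadruple. -/
noncomputable def traces (M : Quad) : Coord → ℂ
  | .p21 => tr (M 1 * M 0)
  | .p31 => tr (M 2 * M 0)
  | .p32 => tr (M 2 * M 1)
  | .p41 => tr (M 3 * M 0)
  | .p42 => tr (M 3 * M 1)
  | .p43 => tr (M 3 * M 2)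
  | .p321 => tr (M 2 * M 1 * M 0)
  | .p432 => tr (M 3 * M 2 * M 1)
  | .p431 => tr (M 3 * M 2 * M 0)
  | .p421 => tr (M 3 * M 1 * M 0)

/-! ### Classical complex varieties as spaces with functions -/

/-- A topology together with the relation "`φ` is a regular function on the open set `V`"
(only the values of `φ` on `V` matter in the instances below). -/
structure VarStr (Y : Type) where
  /-- The Zariski topology. -/
  top : TopologicalSpace Y
  /-- Being regular on an open set. -/
  regular : Set Y → (Y → ℂ) → Prop

/-- The structure on a set `Y` embedded by `e` in the affine space `ℂ^σ`: the topology is induced by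
the Zariski topology, and regular functions are locally quotients of polynomials. -/
def VarStr.embedded {Y σ : Type} (e : Y → σ → ℂ) : VarStr Y where
  top := TopologicalSpace.generateFrom
    {V | ∃ h : MvPolynomial σ ℂ, V = {y | eval (e y) h ≠ 0}}
  regular V φ := ∀ x ∈ V, ∃ g h : MvPolynomial σ ℂ, eval (e x) h ≠ 0 ∧
    ∀ y ∈ V, eval (e y) h ≠ 0 → φ y = eval (e y) g / eval (e y) h

/-- The quotient structure: open sets and regular functions are those that pull back to open sets
and regular functions. -/
def VarStr.quotient {Y : Type} (S : VarStr Y) (r : Setoid Y) : VarStr (Quotient r) where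
  top := S.top.coinduced (Quotient.mk r)
  regular V φ := S.regular (Quotient.mk r ⁻¹' V) (φ ∘ Quotient.mk r)

/-- `F` is an isomorphism onto an open subvariety. -/
def VarStr.IsOpenImmersion {Y Z : Type} (S : VarStr Y) (T : VarStr Z) (F : Y → Z) : Prop :=
  @Topology.IsOpenEmbedding Y Z S.top T.top F ∧
    ∀ V : Set Z, T.top.IsOpen V → V ⊆ Set.range F →
      ∀ φ : Z → ℂ, T.regular V φ ↔ S.regular (F ⁻¹' V) (φ ∘ F)

/-- `F` is an isomorphism of varieties. -/
def VarStr.IsIso {Y Z : Type} (S : VarStr Y) (T : VarStr Z) (F : Y → Z) : Prop :=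
  @IsHomeomorph Y Z S.top T.top F ∧
    ∀ V : Set Z, T.top.IsOpen V →
      ∀ φ : Z → ℂ, T.regular V φ ↔ S.regular (F ⁻¹' V) (φ ∘ F)

/-- The variety structure on quadruples, through the sixteen matrix entries. -/
noncomputable def dataStr (p : Fin 4 → ℂ) (pinf : ℂ) : VarStr (Data p pinf) :=
  VarStr.embedded (σ := Fin 4 × Fin 2 × Fin 2) fun M s => (M.1 s.1 : Matrix (Fin 2) (Fin 2) ℂ) s.2.1 s.2.2

/-- The variety structure of `𝒰` as the quotient by simultaneous conjugation. -/
noncomputable def uStr (p : Fin 4 → ℂ) (pinf : ℂ) : VarStr (U p pinf) :=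
  (dataStr p pinf).quotient (conj p pinf)

/-- The variety structure of `𝒜` as a closed subset of `ℂ¹⁰`. -/
noncomputable def aStr (p : Fin 4 → ℂ) (pinf : ℂ) : VarStr (Points p pinf) :=
  VarStr.embedded Subtype.val

/-! ### Generic parameters -/

/-- None of the five parameters is `±2`, and `a_1 a_2 a_3 a_4` is never an eigenvalue for trace `p_∞`
when `a_i` is an eigenvalue for trace `p_i`. -/
def Generic (p : Fin 4 → ℂ) (pinf : ℂ) : Prop :=
  (∀ i, p i ≠ 2 ∧ p i ≠ -2) ∧ pinf ≠ 2 ∧ pinf ≠ -2 ∧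
    ∀ a : Fin 4 → ℂ, (∀ i, a i ≠ 0 ∧ a i + (a i)⁻¹ = p i) →
      (∏ i, a i) + (∏ i, a i)⁻¹ ≠ pinf

end Garnier

/-! Write `M_i = h_i + X_i` with `h_i = p_i / 2` and `X_i` traceless. Traceless 2×2 matrices form a
three-dimensional quadratic space under `½ tr XY`, and `det M_i = 1` says that `X_i` has squared
length `q_i = h_i² - 1`. After the invertible affine substitution `uncenter`, the ten functions are
the inner products and signed triple products of four vectors. Their relations are classical:
products of triple products are, up to sign, minors of the Gram matrix, and the triple products are
the coefficients of a linear dependence between the vectors. The trace of `M_4 M_3 M_2 M_1` adds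
that `l = eg - ac - bd` equals an affine function of the coordinates. By
`relAt_uncenter_eq_zero_iff` these relations are equivalent to the given fifteen.

Algebra: fifteen polynomials in ten variables are dependent. The twenty relations `gb` are a Gröbner
basis for a weight under which every leading form is a squarefree monomial, uniformly in the
parameters (`goodPair`). An ideal with squarefree initial ideal is radical (`IsInitial.isRadical`).
Every five variables contain a leading monomial, while some four contain none; the first fact makes
the ring integral over an image of a polynomial ring in four variables, the second yields four
algebraically independent elements, so the dimension is four.

Geometry: every point of `𝒜` comes from a quadruple (`exists_traces_eq`), since the Gram matrix is
singular, hence realised by vectors in three-space, and it determines the triple products up to a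
common sign, which negating all vectors absorbs. If `M` is irreducible and `M_1 ≠ ±1`, some `M_j +
M_k` has no eigenvector in common with `M_1` (`exists_pairDet_ne_zero`). This is the nonvanishing of
a polynomial in the traces, and where it holds, `M` is conjugate to a normal form with entries
rational in the traces (`exists_rational_normal_form`). So the trace map is injective on `𝒰` and has
rational sections over open sets covering its image, which makes it an open immersion
(`isOpenImmersion_of_sections`).

An open immersion is an isomorphism iff it is surjective. Generic parameters rule out matrices `±1`
and common eigenvectors, so every lift of a point of `𝒜` lies in `𝒰`. For other parameters there is
a quadruple with the right traces that is diagonal or has some `M_i` or `M_∞` equal to `±1`; its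
trace point is missed, because all quadruples over an image point are conjugate to an element of
`𝒰`. -/

/-! ### Weighted Gröbner bases with monomial leading forms -/

namespace WeightedGroebner

variable {σ ι K : Type*} [Field K] (w : σ → ℕ)

/-- The polynomials all of whose monomials have weight less than `n`. -/
noncomputable def below (K : Type*) [Field K] (n : ℕ) : Submodule K (MvPolynomial σ K) where
  carrier := {p | ∀ ν, coeff ν p ≠ 0 → Finsupp.weight w ν < n}
  add_mem' := by
    intro p q hp hq ν h
    by_cases h0 : coeff ν p = 0
    · exact hq ν (by simpa [h0] using h)
    · exact hp ν h0
  zero_mem' := by simp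
  smul_mem' := by
    intro c p hp ν h
    exact hp ν (by rw [coeff_smul] at h; exact right_ne_zero_of_smul h)

variable {w}

lemma mem_below {n : ℕ} {p : MvPolynomial σ K} :
    p ∈ below w K n ↔ ∀ ν, coeff ν p ≠ 0 → Finsupp.weight w ν < n := Iff.rfl

lemma below_mono {m n : ℕ} (h : m ≤ n) : below w K m ≤ below w K n :=
  fun _ hp ν hν => (hp ν hν).trans_le h

lemma monomial_mem_below {n : ℕ} {μ : σ →₀ ℕ} (c : K) (h : Finsupp.weight w μ < n) :
    monomial μ c ∈ below w K n := by
  classical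
  intro ν hν
  rw [coeff_monomial] at hν
  obtain rfl : μ = ν := by by_contra h'; simp [h'] at hν
  exact h

lemma X_mem_below {n : ℕ} {i : σ} (h : w i < n) : (X i : MvPolynomial σ K) ∈ below w K n :=
  monomial_mem_below _ (by simpa [Finsupp.weight_single] using h)

lemma C_mem_below {n : ℕ} (c : K) (h : 0 < n) : (C c : MvPolynomial σ K) ∈ below w K n :=
  monomial_mem_below _ (by simpa using h)

/-- Since `below` is strict, `m + 1` encodes weight at most `m`; the shift in one factor alone keeps
the bound for the product sharp. -/
lemma mul_mem_below {m n : ℕ} {p q : MvPolynomial σ K} (hp : p ∈ below w K (m + 1))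
    (hq : q ∈ below w K n) : p * q ∈ below w K (m + n) := by
  classical
  intro ν hν
  rw [coeff_mul] at hν
  obtain ⟨⟨x, y⟩, hxy, h⟩ := Finset.exists_ne_zero_of_sum_ne_zero hν
  rw [Finset.HasAntidiagonal.mem_antidiagonal] at hxy
  have h1 := hp x (left_ne_zero_of_mul h)
  have h2 := hq y (right_ne_zero_of_mul h)
  simp only at hxy
  rw [← hxy, map_add]
  omega

lemma exists_mem_below (p : MvPolynomial σ K) : ∃ n, p ∈ below w K n := by
  refine ⟨p.support.sup (Finsupp.weight w) + 1, fun ν hν => ?_⟩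
  exact Nat.lt_succ_of_le (Finset.le_sup (f := Finsupp.weight w) (mem_support_iff.2 hν))

lemma eq_zero_of_mem_below_zero {p : MvPolynomial σ K} (h : p ∈ below w K 0) : p = 0 := by
  ext ν
  by_contra h'
  exact absurd (h ν h') (by simp)

variable (w) (m : ι → σ →₀ ℕ) (f : ι → MvPolynomial σ K)

/-- Combinations of the `f k` in which every summand has weight less than `W`, the weight of `f k`
being that of `m k`. -/
noncomputable def fil (W : ℕ) : Submodule K (MvPolynomial σ K) :=
  Submodule.span K {h | ∃ μ k, Finsupp.weight w (μ + m k) < W ∧ h = monomial μ 1 * f k}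

/-- Each `f k` is `lc k` times the monomial `m k` plus terms of smaller weight. -/
def HasLead (lc : ι → K) : Prop :=
  ∀ k, lc k ≠ 0 ∧ f k - monomial (m k) (lc k) ∈ below w K (Finsupp.weight w (m k))

/-- All multiples of the S-polynomial of `f i` and `f j` reduce to smaller weight. -/
def GoodPair (lc : ι → K) (i j : ι) : Prop :=
  ∀ μ μ', μ + m i = μ' + m j →
    C (lc j) * (monomial μ 1 * f i) - C (lc i) * (monomial μ' 1 * f j) ∈
      fil w m f (Finsupp.weight w (μ + m i))

variable {w m f}

lemma fil_mono {V W : ℕ} (h : V ≤ W) : fil w m f V ≤ fil w m f W :=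
  Submodule.span_mono fun _ ⟨μ, k, hk, e⟩ => ⟨μ, k, hk.trans_le h, e⟩

lemma mul_mem_fil {n W : ℕ} {r : MvPolynomial σ K} {k : ι} (hr : r ∈ below w K n)
    (h : n + Finsupp.weight w (m k) ≤ W) : r * f k ∈ fil w m f W := by
  rw [r.as_sum, Finset.sum_mul]
  refine Submodule.sum_mem _ fun μ hμ => ?_
  have h1 := hr μ (mem_support_iff.1 hμ)
  have h2 : monomial μ (coeff μ r) * f k = coeff μ r • (monomial μ 1 * f k) := by
    rw [← smul_mul_assoc, smul_monomial, smul_eq_mul, mul_one]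
  rw [h2]
  exact Submodule.smul_mem _ _ (Submodule.subset_span ⟨μ, k, by rw [map_add]; omega, rfl⟩)

lemma monomial_mul_mem_fil {W : ℕ} {h : MvPolynomial σ K} (hh : h ∈ fil w m f W) (μ : σ →₀ ℕ) :
    monomial μ 1 * h ∈ fil w m f (Finsupp.weight w μ + W) := by
  induction hh using Submodule.span_induction with
  | mem x hx =>
    obtain ⟨ν, k, hk, rfl⟩ := hx
    refine Submodule.subset_span ⟨μ + ν, k, ?_, ?_⟩
    · rw [add_assoc, map_add]; omega
    · rw [← mul_assoc, monomial_mul, one_mul]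
  | zero => simp
  | add x y _ _ hx hy => rw [mul_add]; exact add_mem hx hy
  | smul c x _ hx => rw [mul_smul_comm]; exact Submodule.smul_mem _ _ hx

lemma C_mul_mem {M : Submodule K (MvPolynomial σ K)} (c : K) {h : MvPolynomial σ K} (hh : h ∈ M) :
    C c * h ∈ M := by
  rw [← smul_eq_C_mul]; exact M.smul_mem _ hh

lemma mem_of_C_mul_mem {M : Submodule K (MvPolynomial σ K)} {c : K} (hc : c ≠ 0)
    {h : MvPolynomial σ K} (hh : C c * h ∈ M) : h ∈ M := by
  rw [← smul_eq_C_mul] at hh; exact (M.smul_mem_iff hc).1 hh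

variable {lc : ι → K}

lemma HasLead.mem_below (H : HasLead w m f lc) (k : ι) :
    f k ∈ below w K (Finsupp.weight w (m k) + 1) := by
  have h := add_mem (below_mono (Nat.le_succ _) (H k).2)
    (monomial_mem_below (lc k) (Nat.lt_succ_self (Finsupp.weight w (m k))))
  rwa [sub_add_cancel] at h

lemma HasLead.fil_le_below (H : HasLead w m f lc) (W : ℕ) : fil w m f W ≤ below w K W := by
  refine Submodule.span_le.2 ?_
  rintro _ ⟨μ, k, hk, rfl⟩
  rw [map_add] at hk
  exact below_mono (by omega)
    (mul_mem_below (monomial_mem_below (n := Finsupp.weight w μ + 1) 1 (by omega)) (H.mem_below k))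

lemma HasLead.coeff_monomial_mul (H : HasLead w m f lc) {μ ν : σ →₀ ℕ} {k : ι}
    (h : Finsupp.weight w ν = Finsupp.weight w (μ + m k)) :
    coeff ν (monomial μ 1 * f k) = coeff ν (monomial (μ + m k) (lc k)) := by
  have h1 : monomial μ 1 * f k - monomial (μ + m k) (lc k) ∈
      below w K (Finsupp.weight w (μ + m k)) := by
    have := mul_mem_below (monomial_mem_below (w := w) (μ := μ) (1 : K) (Nat.lt_succ_self _))
      (H k).2
    rwa [mul_sub, monomial_mul, one_mul, ← map_add] at this
  by_contra h2
  have := h1 ν (by rwa [coeff_sub, sub_ne_zero])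
  omega

namespace GoodPair

lemma refl (i : ι) : GoodPair w m f lc i i := by
  intro μ μ' h
  rw [add_left_injective _ h, sub_self]
  exact zero_mem _

lemma symm {i j : ι} (h : GoodPair w m f lc i j) : GoodPair w m f lc j i := by
  intro μ μ' e
  have := h μ' μ e.symm
  rw [← e] at this
  rw [← neg_sub]
  exact neg_mem this

/-- It is enough to reduce a multiple of the S-polynomial. -/
lemma of_lcm {i j : ι} {μ μ' : σ →₀ ℕ} (h : μ + m i = m i ⊔ m j) (h' : μ' + m j = m i ⊔ m j)
    {c : K} (hc : c ≠ 0)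
    (hf : C c * (C (lc j) * (monomial μ 1 * f i) - C (lc i) * (monomial μ' 1 * f j)) ∈
      fil w m f (Finsupp.weight w (m i ⊔ m j))) : GoodPair w m f lc i j := by
  intro ρ ρ' e
  have hle : m i ⊔ m j ≤ ρ + m i :=
    sup_le (le_add_of_nonneg_left zero_le) (e ▸ le_add_of_nonneg_left zero_le)
  obtain ⟨τ, hτ⟩ := exists_add_of_le hle
  have h1 : ρ = τ + μ := by
    apply add_right_cancel (b := m i); rw [hτ, ← h]; abel
  have h2 : ρ' = τ + μ' := by
    apply add_right_cancel (b := m j); rw [← e, hτ, ← h']; abel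
  have := monomial_mul_mem_fil (mem_of_C_mul_mem hc hf) τ
  rw [← map_add, add_comm τ, ← hτ] at this
  convert! this using 1
  have h3 (a b : σ →₀ ℕ) : (monomial (a + b) 1 : MvPolynomial σ K) = monomial a 1 * monomial b 1 := by
    rw [monomial_mul, one_mul]
  rw [h1, h2, h3, h3]
  ring

/-- Buchberger's first criterion. -/
lemma of_disjoint (H : HasLead w m f lc) {i j : ι} (h : m i ⊔ m j = m i + m j) :
    GoodPair w m f lc i j := by
  refine of_lcm (μ := m j) (μ' := m i) (by rw [h, add_comm]) h.symm (c := 1) one_ne_zero ?_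
  -- For coprime leading monomials the products of the leading terms cancel, and the S-polynomial is
  -- a combination of `f i` and `f j` with the tails as coefficients.
  have e : C 1 * (C (lc j) * (monomial (m j) 1 * f i) - C (lc i) * (monomial (m i) 1 * f j)) =
      (f i - monomial (m i) (lc i)) * f j - (f j - monomial (m j) (lc j)) * f i := by
    have h3 (a : σ →₀ ℕ) (c : K) : (monomial a c : MvPolynomial σ K) = C c * monomial a 1 := by
      rw [C_mul_monomial, mul_one]
    rw [h3 _ (lc i), h3 _ (lc j), C_1]; ring
  rw [e, h, map_add]
  refine sub_mem (mul_mem_fil (H i).2 le_rfl) (mul_mem_fil (H j).2 ?_)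
  rw [add_comm]

/-- Buchberger's second criterion. -/
lemma chain (H : HasLead w m f lc) {i j k : ι} (hk : m k ≤ m i ⊔ m j)
    (h1 : GoodPair w m f lc i k) (h2 : GoodPair w m f lc k j) : GoodPair w m f lc i j := by
  intro μ μ' e
  have hle : m k ≤ μ + m i := hk.trans
    (sup_le (le_add_of_nonneg_left zero_le) (e ▸ le_add_of_nonneg_left zero_le))
  obtain ⟨τ, hτ⟩ := exists_add_of_le hle
  rw [add_comm (m k)] at hτ
  have g1 := C_mul_mem (lc j) (h1 μ τ hτ)
  have g2 := C_mul_mem (lc i) (h2 τ μ' (hτ.symm.trans e))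
  rw [← hτ] at g2
  refine mem_of_C_mul_mem (H k).1 ?_
  convert! add_mem g1 g2 using 1
  ring

end GoodPair

/-- The inductive step of Buchberger's theorem. Fix one generator for each leading monomial of
weight `W`. Good pairs replace any other generator of weight `W` by the fixed one modulo smaller
weight. The fixed generators have distinct leading monomials, so if the total has weight below `W`,
all their coefficients vanish. -/
lemma HasLead.fil_succ_inf_below (H : HasLead w m f lc) (G : ∀ i j, GoodPair w m f lc i j) (W : ℕ)
    {h : MvPolynomial σ K} (hh : h ∈ fil w m f (W + 1)) (hb : h ∈ below w K W) :
    h ∈ fil w m f W := by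
  classical
  let N : Set (σ →₀ ℕ) := {ν | Finsupp.weight w ν = W ∧ ∃ k, m k ≤ ν}
  have hN (ν : N) : ∃ k μ, μ + m k = ν.1 := by
    obtain ⟨ν, -, k, hk⟩ := ν
    obtain ⟨μ, hμ⟩ := exists_add_of_le hk
    exact ⟨k, μ, (add_comm _ _).trans hμ.symm⟩
  choose k μ hkμ using hN
  have hle : fil w m f (W + 1) ≤
      fil w m f W ⊔ Submodule.span K (Set.range fun ν : N => monomial (μ ν) 1 * f (k ν)) := by
    refine Submodule.span_le.2 ?_
    rintro _ ⟨ρ, i, hi, rfl⟩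
    rcases Nat.lt_succ_iff_lt_or_eq.1 hi with hi | hi
    · exact Submodule.mem_sup_left (Submodule.subset_span ⟨ρ, i, hi, rfl⟩)
    · let ν : N := ⟨ρ + m i, hi, i, le_add_of_nonneg_left zero_le⟩
      have h1 := G i (k ν) ρ (μ ν) (hkμ ν).symm
      rw [hi] at h1
      have h2 : monomial (μ ν) 1 * f (k ν) ∈
          Submodule.span K (Set.range fun ν : N => monomial (μ ν) 1 * f (k ν)) :=
        Submodule.subset_span ⟨ν, rfl⟩
      refine mem_of_C_mul_mem (H (k ν)).1 ?_
      have h3 := Submodule.add_mem_sup h1 (C_mul_mem (lc i) h2)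
      rwa [sub_add_cancel] at h3
  obtain ⟨x, hx, y, hy, rfl⟩ := Submodule.mem_sup.1 (hle hh)
  suffices y = 0 by rwa [this, add_zero]
  have hyb : y ∈ below w K W := by
    have := sub_mem hb (H.fil_le_below W hx)
    rwa [add_sub_cancel_left] at this
  obtain ⟨c, rfl⟩ := (Finsupp.mem_span_range_iff_exists_finsupp).1 hy
  suffices c = 0 by simp [this]
  ext ν
  have h0 : coeff ν.1 (c.sum fun i a => a • (monomial (μ i) 1 * f (k i))) = 0 := by
    by_contra h'
    have := hyb _ h'
    rw [ν.2.1] at this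
    omega
  rw [Finsupp.sum, coeff_sum, Finset.sum_eq_single ν] at h0
  · rw [coeff_smul, H.coeff_monomial_mul (by rw [hkμ]), hkμ, coeff_monomial, if_pos rfl,
      smul_eq_mul] at h0
    simpa [(H (k ν)).1] using h0
  · intro ν' _ hne
    rw [coeff_smul, H.coeff_monomial_mul (by rw [hkμ, ν.2.1, ν'.2.1]), hkμ, coeff_monomial,
      if_neg (fun h => hne (Subtype.ext h)), smul_zero]
  · intro hν
    rw [Finsupp.notMem_support_iff.1 hν, zero_smul, coeff_zero]

/-- Any representation of `h` lies in some `fil W`; `fil_succ_inf_below` lowers `W` one step at a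
time until it meets the true weight of `h`. -/
lemma HasLead.mem_fil_of_mem_span (H : HasLead w m f lc) (G : ∀ i j, GoodPair w m f lc i j)
    {h : MvPolynomial σ K} (hh : h ∈ Ideal.span (Set.range f)) {n : ℕ} (hn : h ∈ below w K n) :
    h ∈ fil w m f n := by
  have h1 : ∃ W, h ∈ fil w m f W := by
    clear hn
    induction hh using Submodule.span_induction with
    | mem x hx =>
      obtain ⟨k, rfl⟩ := hx
      refine ⟨1 + Finsupp.weight w (m k), ?_⟩
      have := mul_mem_fil (m := m) (f := f) (k := k) (C_mem_below (w := w) (1 : K) one_pos) le_rfl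
      rwa [C_1, one_mul] at this
    | zero => exact ⟨0, zero_mem _⟩
    | add x y _ _ hx hy =>
      obtain ⟨a, ha⟩ := hx
      obtain ⟨b, hb⟩ := hy
      obtain ⟨na, hna⟩ := exists_mem_below (w := w) x
      exact ⟨max a b, add_mem (fil_mono (le_max_left _ _) ha) (fil_mono (le_max_right _ _) hb)⟩
    | smul r x _ hx =>
      obtain ⟨a, ha⟩ := hx
      obtain ⟨n, hn⟩ := exists_mem_below (w := w) r
      refine ⟨n + a, ?_⟩
      rw [smul_eq_mul, r.as_sum, Finset.sum_mul]
      refine Submodule.sum_mem _ fun μ hμ => ?_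
      have h2 : monomial μ (coeff μ r) * x = C (coeff μ r) * (monomial μ 1 * x) := by
        rw [← mul_assoc, C_mul_monomial, mul_one]
      rw [h2]
      exact fil_mono (by have := hn μ (mem_support_iff.1 hμ); omega)
        (C_mul_mem _ (monomial_mul_mem_fil ha μ))
  obtain ⟨W, hW⟩ := h1
  induction W with
  | zero => exact fil_mono (Nat.zero_le _) hW
  | succ W ih =>
    rcases Nat.lt_or_ge W n with h2 | h2
    · exact fil_mono h2 hW
    · exact ih (H.fil_succ_inf_below G W hW (below_mono h2 hn))

/-- The monomials of maximal weight of an element of the ideal are divisible by a leading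
monomial. -/
theorem HasLead.exists_le_of_mem_span (H : HasLead w m f lc) (G : ∀ i j, GoodPair w m f lc i j)
    {h : MvPolynomial σ K} (hh : h ∈ Ideal.span (Set.range f)) {ν : σ →₀ ℕ} (hν : coeff ν h ≠ 0)
    (hmax : h ∈ below w K (Finsupp.weight w ν + 1)) : ∃ k, m k ≤ ν := by
  classical
  by_contra! hk
  -- A summand of smaller weight cannot involve `ν`, and one of the same weight involves only its
  -- leading monomial there, which would make `ν` divisible by some `m k`.
  have h1 : fil w m f (Finsupp.weight w ν + 1) ≤ LinearMap.ker (lcoeff K ν) := by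
    refine Submodule.span_le.2 ?_
    rintro _ ⟨μ, k, hk', rfl⟩
    rw [SetLike.mem_coe, LinearMap.mem_ker, lcoeff_apply]
    by_contra h2
    rcases Nat.lt_succ_iff_lt_or_eq.1 hk' with h3 | h3
    · have := mul_mem_below (monomial_mem_below (w := w) (μ := μ) (1 : K) (Nat.lt_succ_self _))
        (H.mem_below k) ν h2
      rw [map_add] at h3
      omega
    · rw [H.coeff_monomial_mul h3.symm, coeff_monomial] at h2
      refine hk k ?_
      have h4 : μ + m k = ν := by by_contra h'; simp [h'] at h2
      exact h4 ▸ le_add_of_nonneg_left zero_le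
  exact hν (h1 (H.mem_fil_of_mem_span G hh hmax))

end WeightedGroebner

namespace Garnier

/-! ### A Gröbner basis in centred coordinates -/

/-- An enumeration of the coordinates. -/
def Coord.toFin : Coord → Fin 10
  | p21 => 0 | p31 => 1 | p32 => 2 | p41 => 3 | p42 => 4 | p43 => 5
  | p321 => 6 | p432 => 7 | p431 => 8 | p421 => 9

lemma Coord.toFin_injective : Function.Injective Coord.toFin := by
  intro x y h
  cases x <;> cases y <;> first | rfl | exact absurd h (by decide)

instance : DecidableEq Coord := fun _ _ => decidable_of_iff _ Coord.toFin_injective.eq_iff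

instance : Fintype Coord :=
  ⟨{.p21, .p31, .p32, .p41, .p42, .p43, .p321, .p432, .p431, .p421}, by
    intro x; cases x <;> decide⟩

/-- For vectors `v_1, …, v_4` in a three-dimensional quadratic space with squared lengths `q_i`,
inner products `a = v_1 v_2`, `b = v_2 v_3`, `c = v_3 v_4`, `d = v_1 v_4`, `e = v_1 v_3`,
`g = v_2 v_4`, signed triple products `s_i` of the triples omitting `v_i`, and `l = eg - ac - bd`,
these are a Gröbner basis of the relations between them. -/
def gb {R : Type*} [CommRing R] (q1 q2 q3 q4 l a b c d e g s1 s2 s3 s4 : R) : Fin 20 → R :=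
  ![2 * b * c * g + s1^2 - g^2 * q3 - c^2 * q2 - b^2 * q4 + q2 * q3 * q4,
    2 * c * d * e + s2^2 - e^2 * q4 - d^2 * q3 - c^2 * q1 + q1 * q3 * q4,
    2 * a * d * g + s3^2 - g^2 * q1 - d^2 * q2 - a^2 * q4 + q1 * q2 * q4,
    2 * a * b * e + s4^2 - e^2 * q2 - b^2 * q1 - a^2 * q3 + q1 * q2 * q3,
    e * g - b * d - a * c - l,
    e * s3 + d * s4 + a * s2 + s1 * q1,
    g * s4 + b * s3 + a * s1 + s2 * q2,
    e * s1 + c * s4 + b * s2 + s3 * q3,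
    g * s2 + d * s1 + c * s3 + s4 * q4,
    s1 * s2 - 2 * b * c * d - c * l + d * g * q3 + b * e * q4 - a * q3 * q4,
    s2 * s3 - 2 * a * c * d - d * l + c * g * q1 + a * e * q4 - b * q1 * q4,
    s3 * s4 - 2 * a * b * d - a * l + d * e * q2 + b * g * q1 - c * q1 * q2,
    s1 * s4 - 2 * a * b * c - b * l + c * e * q2 + a * g * q3 - d * q2 * q3,
    s1 * s3 + g * l + c * d * q2 + a * b * q4 - e * q2 * q4,
    s2 * s4 + e * l + b * c * q1 + a * d * q3 - g * q1 * q3,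
    2 * c * d * s4 - s2 * l - e * s4 * q4 + d * s3 * q3 + c * s1 * q1,
    2 * b * c * s3 - s1 * l - g * s3 * q3 + c * s2 * q2 + b * s4 * q4,
    2 * a * b * s2 - s4 * l - e * s2 * q2 + b * s1 * q1 + a * s3 * q3,
    2 * a * d * s1 - s3 * l - g * s1 * q1 + d * s2 * q2 + a * s4 * q4,
    4 * a * b * c * d - l^2 + s4^2 * q4 + s3^2 * q3 + s2^2 * q2 + s1^2 * q1 - g^2 * q1 * q3 -
      e^2 * q2 * q4 - d^2 * q2 * q3 - c^2 * q1 * q2 - b^2 * q1 * q4 - a^2 * q3 * q4 +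
      3 * q1 * q2 * q3 * q4]

/-- The relations `gb` in terms of a family of coordinates, where `p21, …, p42` stand for
`a, b, c, d, e, g` and `p432, p431, p421, p321` for `s1, s2, s3, s4`. -/
def gbAt {R : Type*} [CommRing R] (q : Fin 4 → R) (l : R) (x : Coord → R) : Fin 20 → R :=
  gb (q 0) (q 1) (q 2) (q 3) l (x .p21) (x .p32) (x .p43) (x .p41) (x .p31) (x .p42)
    (x .p432) (x .p431) (x .p421) (x .p321)

/-- The weights for which the elements of `gb` have the monomials `lead` as leading forms. -/
def wt : Coord → ℕ
  | .p21 | .p32 | .p43 | .p41 => 8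
  | .p31 | .p42 => 11
  | .p432 | .p431 | .p421 | .p321 => 13

/-- The squarefree leading monomials of `gb`. -/
def lead : Fin 20 → Finset Coord :=
  ![
    {.p32, .p43, .p42}, {.p43, .p41, .p31}, {.p21, .p41, .p42}, {.p21, .p32, .p31}, {.p31, .p42},
      {.p31, .p421}, {.p42, .p321}, {.p31, .p432}, {.p42, .p431}, {.p432, .p431}, {.p431, .p421},
      {.p421, .p321}, {.p432, .p321}, {.p432, .p421}, {.p431, .p321}, {.p43, .p41, .p321}, {.p32,
      .p43, .p421}, {.p21, .p32, .p431}, {.p21, .p41, .p432}, {.p21, .p32, .p43, .p41}]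

/-- The leading coefficients of `gb`. -/
def leadCoeff : Fin 20 → ℤ := ![2, 2, 2, 2, 1, 1, 1, 1, 1, 1, 1, 1, 1, 1, 1, 2, 2, 2, 2, 4]

/-- A term `n ∏ x_i ∏ q_j l ^ k`. -/
abbrev Term : Type := ℤ × List Coord × List (Fin 4) × ℕ

/-- The lower terms of `gb`. -/
def tail : Fin 20 → List Term :=
  ![
    [(1, [.p432, .p432], [], 0), (-1, [.p42, .p42], [2], 0), (-1, [.p32, .p32], [3], 0), (-1,
      [.p43, .p43], [1], 0), (1, [], [1, 2, 3], 0)],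
    [(1, [.p431, .p431], [], 0), (-1, [.p31, .p31], [3], 0), (-1, [.p43, .p43], [0], 0), (-1,
      [.p41, .p41], [2], 0), (1, [], [0, 2, 3], 0)],
    [(1, [.p421, .p421], [], 0), (-1, [.p42, .p42], [0], 0), (-1, [.p21, .p21], [3], 0), (-1,
      [.p41, .p41], [1], 0), (1, [], [0, 1, 3], 0)],
    [(1, [.p321, .p321], [], 0), (-1, [.p31, .p31], [1], 0), (-1, [.p21, .p21], [2], 0), (-1,
      [.p32, .p32], [0], 0), (1, [], [0, 1, 2], 0)],
    [(-1, [.p21, .p43], [], 0), (-1, [.p32, .p41], [], 0), (-1, [], [], 1)],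
    [(1, [.p21, .p431], [], 0), (1, [.p41, .p321], [], 0), (1, [.p432], [0], 0)],
    [(1, [.p21, .p432], [], 0), (1, [.p32, .p421], [], 0), (1, [.p431], [1], 0)],
    [(1, [.p32, .p431], [], 0), (1, [.p43, .p321], [], 0), (1, [.p421], [2], 0)],
    [(1, [.p43, .p421], [], 0), (1, [.p41, .p432], [], 0), (1, [.p321], [3], 0)],
    [(-2, [.p32, .p43, .p41], [], 0), (-1, [.p43], [], 1), (1, [.p32, .p31], [3], 0), (1, [.p41,
      .p42], [2], 0), (-1, [.p21], [2, 3], 0)],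
    [(-2, [.p21, .p43, .p41], [], 0), (-1, [.p41], [], 1), (1, [.p21, .p31], [3], 0), (1, [.p43,
      .p42], [0], 0), (-1, [.p32], [0, 3], 0)],
    [(-2, [.p21, .p32, .p41], [], 0), (-1, [.p21], [], 1), (1, [.p32, .p42], [0], 0), (1, [.p41,
      .p31], [1], 0), (-1, [.p43], [0, 1], 0)],
    [(-2, [.p21, .p32, .p43], [], 0), (-1, [.p32], [], 1), (1, [.p21, .p42], [2], 0), (1, [.p43,
      .p31], [1], 0), (-1, [.p41], [1, 2], 0)],
    [(1, [.p42], [], 1), (1, [.p21, .p32], [3], 0), (1, [.p43, .p41], [1], 0), (-1, [.p31], [1,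
      3], 0)],
    [(1, [.p31], [], 1), (1, [.p21, .p41], [2], 0), (1, [.p32, .p43], [0], 0), (-1, [.p42], [0,
      2], 0)],
    [(-1, [.p431], [], 1), (-1, [.p31, .p321], [3], 0), (1, [.p43, .p432], [0], 0), (1, [.p41,
      .p421], [2], 0)],
    [(-1, [.p432], [], 1), (-1, [.p42, .p421], [2], 0), (1, [.p32, .p321], [3], 0), (1, [.p43,
      .p431], [1], 0)],
    [(-1, [.p321], [], 1), (-1, [.p31, .p431], [1], 0), (1, [.p21, .p421], [2], 0), (1, [.p32,
      .p432], [0], 0)],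
    [(-1, [.p421], [], 1), (-1, [.p42, .p432], [0], 0), (1, [.p21, .p321], [3], 0), (1, [.p41,
      .p431], [1], 0)],
    [(1, [.p432, .p432], [0], 0), (1, [.p431, .p431], [1], 0), (1, [.p421, .p421], [2], 0), (1,
      [.p321, .p321], [3], 0), (-1, [], [], 2), (-1, [.p31, .p31], [1, 3], 0), (-1, [.p42, .p42],
      [0, 2], 0), (-1, [.p21, .p21], [2, 3], 0), (-1, [.p32, .p32], [0, 3], 0), (-1, [.p43, .p43],
      [0, 1], 0), (-1, [.p41, .p41], [1, 2], 0), (3, [], [0, 1, 2, 3], 0)]]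

end Garnier

/-! ### Leading terms of the centred relations -/

namespace Garnier

open WeightedGroebner

/-- The exponent vector of a squarefree monomial. -/
noncomputable def expo (A : Finset Coord) : Coord →₀ ℕ := ∑ i ∈ A, Finsupp.single i 1

lemma expo_apply (A : Finset Coord) (i : Coord) : expo A i = if i ∈ A then 1 else 0 := by
  simp [expo, Finsupp.finsetSum_apply, Finsupp.single_apply]

lemma expo_le_iff (A : Finset Coord) (ν : Coord →₀ ℕ) : expo A ≤ ν ↔ A ⊆ ν.support := by
  simp only [Finsupp.le_def, expo_apply, Finset.subset_iff, Finsupp.mem_support_iff]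
  refine forall_congr' fun i => ?_
  split_ifs with h <;> simp [h, Nat.one_le_iff_ne_zero]

lemma expo_sup (A B : Finset Coord) : expo A ⊔ expo B = expo (A ∪ B) := by
  ext i
  simp only [Finsupp.sup_apply, expo_apply, Finset.mem_union]
  split_ifs <;> simp_all

lemma expo_sdiff_add (A B : Finset Coord) : expo (B \ A) + expo A = expo (A ∪ B) := by
  ext i
  simp only [Finsupp.add_apply, expo_apply, Finset.mem_union, Finset.mem_sdiff]
  split_ifs <;> simp_all

lemma weight_expo (A : Finset Coord) : Finsupp.weight wt (expo A) = ∑ i ∈ A, wt i := by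
  simp [expo, map_sum, Finsupp.weight_single]

lemma monomial_expo (A : Finset Coord) :
    (monomial (expo A) 1 : MvPolynomial Coord ℂ) = ∏ i ∈ A, X i := by
  rw [expo, monomial_sum_one]; rfl

/-- The value of a term in the polynomial ring. -/
noncomputable def termVal (q : Fin 4 → ℂ) (l : MvPolynomial Coord ℂ) (t : Term) :
    MvPolynomial Coord ℂ :=
  (t.1 : MvPolynomial Coord ℂ) * (t.2.1.map X).prod * (t.2.2.1.map fun i => C (q i)).prod *
    l ^ t.2.2.2

/-- The weight of a term, where `l` has weight `13`. -/
def termWt (t : Term) : ℕ := (t.2.1.map wt).sum + 13 * t.2.2.2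

variable {q : Fin 4 → ℂ} {l : MvPolynomial Coord ℂ}

/-- The hypothesis `hl` lets the polynomial `l` be treated as a symbol of weight 13, so that
comparing weights of terms becomes arithmetic on lists, decidable whatever `q` and `l` are. -/
lemma termVal_mem_below (hl : l ∈ below wt ℂ 14) (t : Term) :
    termVal q l t ∈ below wt ℂ (termWt t + 1) := by
  obtain ⟨n, xs, qs, k⟩ := t
  have h1 : (n : MvPolynomial Coord ℂ) ∈ below wt ℂ (0 + 1) := by
    rw [← map_intCast (C : ℂ →+* MvPolynomial Coord ℂ)]; exact C_mem_below _ one_pos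
  have h2 : ((xs.map X).prod : MvPolynomial Coord ℂ) ∈ below wt ℂ ((xs.map wt).sum + 1) := by
    induction xs with
    | nil => simpa using C_mem_below (w := wt) (1 : ℂ) one_pos
    | cons x xs ih =>
      simp only [List.map_cons, List.prod_cons, List.sum_cons, add_assoc]
      exact mul_mem_below (X_mem_below (Nat.lt_succ_self _)) ih
  have h3 : (qs.map fun i => C (q i)).prod ∈ below wt ℂ (0 + 1) := by
    induction qs with
    | nil => simpa using C_mem_below (w := wt) (1 : ℂ) one_pos
    | cons x xs ih =>
      simp only [List.map_cons, List.prod_cons]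
      exact mul_mem_below (m := 0) (C_mem_below _ one_pos) ih
  have h4 : l ^ k ∈ below wt ℂ (13 * k + 1) := by
    induction k with
    | zero => simpa using C_mem_below (w := wt) (1 : ℂ) one_pos
    | succ k ih =>
      rw [pow_succ', show 13 * (k + 1) + 1 = 13 + (13 * k + 1) by ring]
      exact mul_mem_below hl ih
  have h5 := mul_mem_below h1 h2
  have h6 := mul_mem_below (m := 0 + (xs.map wt).sum) h5 h3
  have h := mul_mem_below (m := 0 + (xs.map wt).sum + 0) h6 h4
  exact below_mono (by simp only [termWt]; omega) h

lemma gbAt_eq (k : Fin 20) : gbAt (fun i => C (q i)) l X k =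
    (leadCoeff k : MvPolynomial Coord ℂ) * ∏ i ∈ lead k, X i + ((tail k).map (termVal q l)).sum := by
  fin_cases k
  all_goals
    simp [gbAt, gb, leadCoeff, lead, tail, termVal, Finset.prod_insert]
    try ring

lemma termWt_lt_of_mem_tail (k : Fin 20) : ∀ t ∈ tail k, termWt t < ∑ i ∈ lead k, wt i := by
  revert k; decide

lemma hasLead_gbAt (hl : l ∈ below wt ℂ 14) :
    HasLead wt (fun k => expo (lead k)) (gbAt (fun i => C (q i)) l X)
      (fun k => (leadCoeff k : ℂ)) := by
  intro k
  refine ⟨Int.cast_ne_zero.2 (by revert k; decide), ?_⟩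
  have h : (monomial (expo (lead k)) (leadCoeff k : ℂ) : MvPolynomial Coord ℂ) =
      (leadCoeff k : MvPolynomial Coord ℂ) * ∏ i ∈ lead k, X i := by
    rw [← monomial_expo, ← map_intCast (C : ℂ →+* MvPolynomial Coord ℂ), C_mul_monomial, mul_one]
  rw [h, gbAt_eq, add_sub_cancel_left, weight_expo]
  refine list_sum_mem fun t ht => ?_
  obtain ⟨t, ht', rfl⟩ := List.mem_map.1 ht
  exact below_mono (termWt_lt_of_mem_tail k t ht') (termVal_mem_below hl t)

/-- S-polynomials of `gb` reduce to zero. -/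
abbrev Good (q : Fin 4 → ℂ) (l : MvPolynomial Coord ℂ) (i j : Fin 20) : Prop :=
  GoodPair wt (fun k => expo (lead k)) (gbAt (fun i => C (q i)) l X)
    (fun k => (leadCoeff k : ℂ)) i j

/-- A combination of the elements of `gb` with terms as coefficients. -/
noncomputable def reductionSum (q : Fin 4 → ℂ) (l : MvPolynomial Coord ℂ)
    (L : List (Fin 20 × Term)) : MvPolynomial Coord ℂ :=
  (L.map fun t => termVal q l t.2 * gbAt (fun i => C (q i)) l X t.1).sum

/-- Splits the reduction of an S-polynomial into a weight comparison, left to `decide`, and an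
identity polynomial in `q` and `l`, left to `ring`. The lists `u` and `v` are the cofactors of the
two leading monomials in their least common multiple. -/
lemma goodPair_of_reduction (hl : l ∈ below wt ℂ 14) {i j : Fin 20} (u v : List Coord)
    (L : List (Fin 20 × Term)) (hu : (lead j \ lead i).val = u) (hv : (lead i \ lead j).val = v)
    (hL : ∀ t ∈ L, termWt t.2 + ∑ k ∈ lead t.1, wt k < ∑ k ∈ lead i ∪ lead j, wt k)
    (h : (leadCoeff j : MvPolynomial Coord ℂ) * ((u.map X).prod * gbAt (fun i => C (q i)) l X i) -
      (leadCoeff i : MvPolynomial Coord ℂ) * ((v.map X).prod * gbAt (fun i => C (q i)) l X j) =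
        reductionSum q l L) : Good q l i j := by
  have hprod {A : Finset Coord} {u : List Coord} (h : A.val = u) :
      (∏ i ∈ A, X i : MvPolynomial Coord ℂ) = (u.map X).prod := by
    rw [Finset.prod, h, Multiset.map_coe, Multiset.prod_coe]
  refine GoodPair.of_lcm (μ := expo (lead j \ lead i)) (μ' := expo (lead i \ lead j))
    (c := 1) ?_ ?_ one_ne_zero ?_
  · rw [expo_sup, expo_sdiff_add]
  · rw [expo_sup, expo_sdiff_add, Finset.union_comm]
  · rw [C_1, one_mul, map_intCast, map_intCast, monomial_expo, monomial_expo, hprod hu, hprod hv, h,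
      expo_sup, weight_expo]
    refine list_sum_mem fun t ht => ?_
    obtain ⟨t, ht', rfl⟩ := List.mem_map.1 ht
    refine mul_mem_fil (termVal_mem_below hl t.2) ?_
    rw [weight_expo]
    have := hL t ht'
    omega

/-! ### Explicit reductions of S-polynomials -/

section Pairs

variable (hl : l ∈ below wt ℂ 14)
include hl

/-- In this certificate and the following ones, an entry `(k, n, xs, qs, e)` stands for `n ∏ xs ∏
q_j l ^ e` times the `k`-th element of `gb`. -/
lemma goodPair_4_5 : Good q l 4 5 :=
  goodPair_of_reduction hl [.p421] [.p42] [(8, -1, [.p21], [], 0), (6, -1, [.p41], [], 0), (18, 1,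
    [], [], 0)]
    (by decide) (by decide) (by decide) (by simp [reductionSum, termVal, leadCoeff, gbAt, gb]; ring)

lemma goodPair_4_6 : Good q l 4 6 :=
  goodPair_of_reduction hl [.p321] [.p31] [(7, -1, [.p21], [], 0), (5, -1, [.p32], [], 0), (17, 1,
    [], [], 0)]
    (by decide) (by decide) (by decide) (by simp [reductionSum, termVal, leadCoeff, gbAt, gb]; ring)

lemma goodPair_4_7 : Good q l 4 7 :=
  goodPair_of_reduction hl [.p432] [.p42] [(8, -1, [.p32], [], 0), (6, -1, [.p43], [], 0), (16, 1,
    [], [], 0)]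
    (by decide) (by decide) (by decide) (by simp [reductionSum, termVal, leadCoeff, gbAt, gb]; ring)

lemma goodPair_4_8 : Good q l 4 8 :=
  goodPair_of_reduction hl [.p431] [.p31] [(5, -1, [.p43], [], 0), (7, -1, [.p41], [], 0), (15, 1,
    [], [], 0)]
    (by decide) (by decide) (by decide) (by simp [reductionSum, termVal, leadCoeff, gbAt, gb]; ring)

lemma goodPair_5_10 : Good q l 5 10 :=
  goodPair_of_reduction hl [.p431] [.p31] [(1, 1, [.p21], [], 0), (14, 1, [.p41], [], 0), (4, -1,
    [.p43], [0], 0), (9, 1, [], [0], 0)]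
    (by decide) (by decide) (by decide) (by simp [reductionSum, termVal, leadCoeff, gbAt, gb]; ring)

lemma goodPair_5_11 : Good q l 5 11 :=
  goodPair_of_reduction hl [.p321] [.p31] [(3, 1, [.p41], [], 0), (14, 1, [.p21], [], 0), (4, -1,
    [.p32], [0], 0), (12, 1, [], [0], 0)]
    (by decide) (by decide) (by decide) (by simp [reductionSum, termVal, leadCoeff, gbAt, gb]; ring)

lemma goodPair_6_11 : Good q l 6 11 :=
  goodPair_of_reduction hl [.p421] [.p42] [(2, 1, [.p32], [], 0), (13, 1, [.p21], [], 0), (4, -1,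
    [.p41], [1], 0), (10, 1, [], [1], 0)]
    (by decide) (by decide) (by decide) (by simp [reductionSum, termVal, leadCoeff, gbAt, gb]; ring)

lemma goodPair_6_12 : Good q l 6 12 :=
  goodPair_of_reduction hl [.p432] [.p42] [(0, 1, [.p21], [], 0), (13, 1, [.p32], [], 0), (4, -1,
    [.p43], [1], 0), (9, 1, [], [1], 0)]
    (by decide) (by decide) (by decide) (by simp [reductionSum, termVal, leadCoeff, gbAt, gb]; ring)

lemma goodPair_7_9 : Good q l 7 9 :=
  goodPair_of_reduction hl [.p431] [.p31] [(1, 1, [.p32], [], 0), (14, 1, [.p43], [], 0), (4, -1,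
    [.p41], [2], 0), (10, 1, [], [2], 0)]
    (by decide) (by decide) (by decide) (by simp [reductionSum, termVal, leadCoeff, gbAt, gb]; ring)

lemma goodPair_7_12 : Good q l 7 12 :=
  goodPair_of_reduction hl [.p321] [.p31] [(3, 1, [.p43], [], 0), (14, 1, [.p32], [], 0), (4, -1,
    [.p21], [2], 0), (11, 1, [], [2], 0)]
    (by decide) (by decide) (by decide) (by simp [reductionSum, termVal, leadCoeff, gbAt, gb]; ring)

lemma goodPair_8_9 : Good q l 8 9 :=
  goodPair_of_reduction hl [.p432] [.p42] [(0, 1, [.p41], [], 0), (13, 1, [.p43], [], 0), (4, -1,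
    [.p32], [3], 0), (12, 1, [], [3], 0)]
    (by decide) (by decide) (by decide) (by simp [reductionSum, termVal, leadCoeff, gbAt, gb]; ring)

lemma goodPair_8_10 : Good q l 8 10 :=
  goodPair_of_reduction hl [.p421] [.p42] [(2, 1, [.p43], [], 0), (13, 1, [.p41], [], 0), (4, -1,
    [.p21], [3], 0), (11, 1, [], [3], 0)]
    (by decide) (by decide) (by decide) (by simp [reductionSum, termVal, leadCoeff, gbAt, gb]; ring)

lemma goodPair_5_7 : Good q l 5 7 :=
  goodPair_of_reduction hl [.p432] [.p421] [(9, 1, [.p21], [], 0), (10, -1, [.p32], [], 0), (11,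
    -1, [.p43], [], 0), (12, 1, [.p41], [], 0), (2, -1, [], [2], 0), (0, 1, [], [0], 0)]
    (by decide) (by decide) (by decide) (by simp [reductionSum, termVal, leadCoeff, gbAt, gb]; ring)

lemma goodPair_6_8 : Good q l 6 8 :=
  goodPair_of_reduction hl [.p431] [.p321] [(9, 1, [.p21], [], 0), (10, 1, [.p32], [], 0), (11,
    -1, [.p43], [], 0), (12, -1, [.p41], [], 0), (3, -1, [], [3], 0), (1, 1, [], [1], 0)]
    (by decide) (by decide) (by decide) (by simp [reductionSum, termVal, leadCoeff, gbAt, gb]; ring)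

lemma goodPair_5_13 : Good q l 5 13 :=
  goodPair_of_reduction hl [.p432] [.p31] [(4, -1, [], [], 1), (9, 1, [.p21], [], 0), (12, 1,
    [.p41], [], 0), (19, 1, [], [], 0), (3, -1, [], [3], 0), (2, -1, [], [2], 0), (1, -1, [], [1],
    0)]
    (by decide) (by decide) (by decide) (by simp [reductionSum, termVal, leadCoeff, gbAt, gb]; ring)

lemma goodPair_6_14 : Good q l 6 14 :=
  goodPair_of_reduction hl [.p431] [.p42] [(4, -1, [], [], 1), (9, 1, [.p21], [], 0), (10, 1,
    [.p32], [], 0), (19, 1, [], [], 0), (3, -1, [], [3], 0), (2, -1, [], [2], 0), (0, -1, [], [0],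
    0)]
    (by decide) (by decide) (by decide) (by simp [reductionSum, termVal, leadCoeff, gbAt, gb]; ring)

lemma goodPair_0_4 : Good q l 0 4 :=
  goodPair_of_reduction hl [.p31] [.p32, .p43] [(7, 1, [.p432], [], 0), (9, -1, [.p32], [], 0),
    (12, -1, [.p43], [], 0), (4, -1, [.p42], [2], 0), (13, -1, [], [2], 0)]
    (by decide) (by decide) (by decide) (by simp [reductionSum, termVal, leadCoeff, gbAt, gb]; ring)

lemma goodPair_1_4 : Good q l 1 4 :=
  goodPair_of_reduction hl [.p42] [.p43, .p41] [(8, 1, [.p431], [], 0), (10, -1, [.p43], [], 0),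
    (9, -1, [.p41], [], 0), (4, -1, [.p31], [3], 0), (14, -1, [], [3], 0)]
    (by decide) (by decide) (by decide) (by simp [reductionSum, termVal, leadCoeff, gbAt, gb]; ring)

lemma goodPair_2_4 : Good q l 2 4 :=
  goodPair_of_reduction hl [.p31] [.p21, .p41] [(5, 1, [.p421], [], 0), (10, -1, [.p21], [], 0),
    (11, -1, [.p41], [], 0), (4, -1, [.p42], [0], 0), (13, -1, [], [0], 0)]
    (by decide) (by decide) (by decide) (by simp [reductionSum, termVal, leadCoeff, gbAt, gb]; ring)

lemma goodPair_3_4 : Good q l 3 4 :=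
  goodPair_of_reduction hl [.p42] [.p21, .p32] [(6, 1, [.p321], [], 0), (12, -1, [.p21], [], 0),
    (11, -1, [.p32], [], 0), (4, -1, [.p31], [1], 0), (14, -1, [], [1], 0)]
    (by decide) (by decide) (by decide) (by simp [reductionSum, termVal, leadCoeff, gbAt, gb]; ring)

lemma goodPair_9_10 : Good q l 9 10 :=
  goodPair_of_reduction hl [.p421] [.p432] [(18, 1, [.p43], [], 0), (16, -1, [.p41], [], 0), (7,
    -1, [.p21], [3], 0), (5, 1, [.p32], [3], 0)]
    (by decide) (by decide) (by decide) (by simp [reductionSum, termVal, leadCoeff, gbAt, gb]; ring)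

lemma goodPair_9_12 : Good q l 9 12 :=
  goodPair_of_reduction hl [.p321] [.p431] [(17, 1, [.p43], [], 0), (15, -1, [.p32], [], 0), (8,
    -1, [.p21], [2], 0), (6, 1, [.p41], [2], 0)]
    (by decide) (by decide) (by decide) (by simp [reductionSum, termVal, leadCoeff, gbAt, gb]; ring)

lemma goodPair_9_13 : Good q l 9 13 :=
  goodPair_of_reduction hl [.p421] [.p431] [(16, -1, [.p41], [], 0), (8, -1, [], [], 1), (5, 1,
    [.p32], [3], 0), (17, -1, [], [3], 0)]
    (by decide) (by decide) (by decide) (by simp [reductionSum, termVal, leadCoeff, gbAt, gb]; ring)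

lemma goodPair_9_14 : Good q l 9 14 :=
  goodPair_of_reduction hl [.p321] [.p432] [(15, -1, [.p32], [], 0), (7, -1, [], [], 1), (6, 1,
    [.p41], [2], 0), (18, -1, [], [2], 0)]
    (by decide) (by decide) (by decide) (by simp [reductionSum, termVal, leadCoeff, gbAt, gb]; ring)

lemma goodPair_10_11 : Good q l 10 11 :=
  goodPair_of_reduction hl [.p321] [.p431] [(17, 1, [.p41], [], 0), (15, -1, [.p21], [], 0), (8,
    -1, [.p32], [0], 0), (6, 1, [.p43], [0], 0)]
    (by decide) (by decide) (by decide) (by simp [reductionSum, termVal, leadCoeff, gbAt, gb]; ring)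

lemma goodPair_10_14 : Good q l 10 14 :=
  goodPair_of_reduction hl [.p321] [.p421] [(15, -1, [.p21], [], 0), (5, -1, [], [], 1), (6, 1,
    [.p43], [0], 0), (16, -1, [], [0], 0)]
    (by decide) (by decide) (by decide) (by simp [reductionSum, termVal, leadCoeff, gbAt, gb]; ring)

lemma goodPair_11_12 : Good q l 11 12 :=
  goodPair_of_reduction hl [.p432] [.p421] [(16, 1, [.p21], [], 0), (18, -1, [.p32], [], 0), (5,
    -1, [.p43], [1], 0), (7, 1, [.p41], [1], 0)]
    (by decide) (by decide) (by decide) (by simp [reductionSum, termVal, leadCoeff, gbAt, gb]; ring)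

lemma goodPair_11_13 : Good q l 11 13 :=
  goodPair_of_reduction hl [.p432] [.p321] [(18, -1, [.p32], [], 0), (6, -1, [], [], 1), (7, 1,
    [.p41], [1], 0), (15, -1, [], [1], 0)]
    (by decide) (by decide) (by decide) (by simp [reductionSum, termVal, leadCoeff, gbAt, gb]; ring)

lemma goodPair_0_16 : Good q l 0 16 :=
  goodPair_of_reduction hl [.p421] [.p42] [(13, 2, [.p432], [], 0), (6, -2, [.p32], [3], 0), (8,
    -2, [.p43], [1], 0), (7, 2, [], [1, 3], 0)]
    (by decide) (by decide) (by decide) (by simp [reductionSum, termVal, leadCoeff, gbAt, gb]; ring)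

lemma goodPair_1_15 : Good q l 1 15 :=
  goodPair_of_reduction hl [.p321] [.p31] [(14, 2, [.p431], [], 0), (7, -2, [.p43], [0], 0), (5,
    -2, [.p41], [2], 0), (8, 2, [], [0, 2], 0)]
    (by decide) (by decide) (by decide) (by simp [reductionSum, termVal, leadCoeff, gbAt, gb]; ring)

lemma goodPair_2_18 : Good q l 2 18 :=
  goodPair_of_reduction hl [.p432] [.p42] [(13, 2, [.p421], [], 0), (6, -2, [.p21], [3], 0), (8,
    -2, [.p41], [1], 0), (5, 2, [], [1, 3], 0)]
    (by decide) (by decide) (by decide) (by simp [reductionSum, termVal, leadCoeff, gbAt, gb]; ring)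

lemma goodPair_3_17 : Good q l 3 17 :=
  goodPair_of_reduction hl [.p431] [.p31] [(14, 2, [.p321], [], 0), (5, -2, [.p21], [2], 0), (7,
    -2, [.p32], [0], 0), (6, 2, [], [0, 2], 0)]
    (by decide) (by decide) (by decide) (by simp [reductionSum, termVal, leadCoeff, gbAt, gb]; ring)

lemma goodPair_5_16 : Good q l 5 16 :=
  goodPair_of_reduction hl [.p32, .p43] [.p31] [(17, 1, [.p43], [], 0), (15, 1, [.p32], [], 0),
    (7, 1, [], [], 1), (4, 1, [.p421], [2], 0)]
    (by decide) (by decide) (by decide) (by simp [reductionSum, termVal, leadCoeff, gbAt, gb]; ring)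

lemma goodPair_6_15 : Good q l 6 15 :=
  goodPair_of_reduction hl [.p43, .p41] [.p42] [(18, 1, [.p43], [], 0), (16, 1, [.p41], [], 0),
    (8, 1, [], [], 1), (4, 1, [.p321], [3], 0)]
    (by decide) (by decide) (by decide) (by simp [reductionSum, termVal, leadCoeff, gbAt, gb]; ring)

lemma goodPair_7_18 : Good q l 7 18 :=
  goodPair_of_reduction hl [.p21, .p41] [.p31] [(17, 1, [.p41], [], 0), (15, 1, [.p21], [], 0),
    (5, 1, [], [], 1), (4, 1, [.p432], [0], 0)]
    (by decide) (by decide) (by decide) (by simp [reductionSum, termVal, leadCoeff, gbAt, gb]; ring)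

lemma goodPair_8_17 : Good q l 8 17 :=
  goodPair_of_reduction hl [.p21, .p32] [.p42] [(16, 1, [.p21], [], 0), (18, 1, [.p32], [], 0),
    (6, 1, [], [], 1), (4, 1, [.p431], [1], 0)]
    (by decide) (by decide) (by decide) (by simp [reductionSum, termVal, leadCoeff, gbAt, gb]; ring)

lemma goodPair_0_6 : Good q l 0 6 :=
  goodPair_of_reduction hl [.p321] [.p32, .p43] [(12, 1, [.p432], [], 0), (16, -1, [.p32], [], 0),
    (6, -1, [.p42], [2], 0), (7, -1, [.p43], [1], 0), (8, 1, [], [1, 2], 0)]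
    (by decide) (by decide) (by decide) (by simp [reductionSum, termVal, leadCoeff, gbAt, gb]; ring)

lemma goodPair_0_8 : Good q l 0 8 :=
  goodPair_of_reduction hl [.p431] [.p32, .p43] [(9, 1, [.p432], [], 0), (16, -1, [.p43], [], 0),
    (8, -1, [.p42], [2], 0), (7, -1, [.p32], [3], 0), (6, 1, [], [2, 3], 0)]
    (by decide) (by decide) (by decide) (by simp [reductionSum, termVal, leadCoeff, gbAt, gb]; ring)

lemma goodPair_1_5 : Good q l 1 5 :=
  goodPair_of_reduction hl [.p421] [.p43, .p41] [(10, 1, [.p431], [], 0), (15, -1, [.p41], [], 0),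
    (5, -1, [.p31], [3], 0), (8, -1, [.p43], [0], 0), (7, 1, [], [0, 3], 0)]
    (by decide) (by decide) (by decide) (by simp [reductionSum, termVal, leadCoeff, gbAt, gb]; ring)

lemma goodPair_1_7 : Good q l 1 7 :=
  goodPair_of_reduction hl [.p432] [.p43, .p41] [(9, 1, [.p431], [], 0), (15, -1, [.p43], [], 0),
    (7, -1, [.p31], [3], 0), (8, -1, [.p41], [2], 0), (5, 1, [], [2, 3], 0)]
    (by decide) (by decide) (by decide) (by simp [reductionSum, termVal, leadCoeff, gbAt, gb]; ring)

lemma goodPair_2_6 : Good q l 2 6 :=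
  goodPair_of_reduction hl [.p321] [.p21, .p41] [(11, 1, [.p421], [], 0), (18, -1, [.p21], [], 0),
    (6, -1, [.p42], [0], 0), (5, -1, [.p41], [1], 0), (8, 1, [], [0, 1], 0)]
    (by decide) (by decide) (by decide) (by simp [reductionSum, termVal, leadCoeff, gbAt, gb]; ring)

lemma goodPair_2_8 : Good q l 2 8 :=
  goodPair_of_reduction hl [.p431] [.p21, .p41] [(10, 1, [.p421], [], 0), (18, -1, [.p41], [], 0),
    (8, -1, [.p42], [0], 0), (5, -1, [.p21], [3], 0), (6, 1, [], [0, 3], 0)]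
    (by decide) (by decide) (by decide) (by simp [reductionSum, termVal, leadCoeff, gbAt, gb]; ring)

lemma goodPair_3_5 : Good q l 3 5 :=
  goodPair_of_reduction hl [.p421] [.p21, .p32] [(11, 1, [.p321], [], 0), (17, -1, [.p21], [], 0),
    (5, -1, [.p31], [1], 0), (6, -1, [.p32], [0], 0), (7, 1, [], [0, 1], 0)]
    (by decide) (by decide) (by decide) (by simp [reductionSum, termVal, leadCoeff, gbAt, gb]; ring)

lemma goodPair_3_7 : Good q l 3 7 :=
  goodPair_of_reduction hl [.p432] [.p21, .p32] [(12, 1, [.p321], [], 0), (17, -1, [.p32], [], 0),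
    (7, -1, [.p31], [1], 0), (6, -1, [.p21], [2], 0), (5, 1, [], [1, 2], 0)]
    (by decide) (by decide) (by decide) (by simp [reductionSum, termVal, leadCoeff, gbAt, gb]; ring)

lemma goodPair_13_16 : Good q l 13 16 :=
  goodPair_of_reduction hl [.p32, .p43] [.p432] [(0, 1, [], [], 1), (13, 1, [.p42], [2], 0), (12,
    -1, [.p32], [3], 0), (9, -1, [.p43], [1], 0), (4, 1, [], [1, 2, 3], 0)]
    (by decide) (by decide) (by decide) (by simp [reductionSum, termVal, leadCoeff, gbAt, gb]; ring)

lemma goodPair_13_18 : Good q l 13 18 :=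
  goodPair_of_reduction hl [.p21, .p41] [.p421] [(2, 1, [], [], 1), (13, 1, [.p42], [0], 0), (11,
    -1, [.p21], [3], 0), (10, -1, [.p41], [1], 0), (4, 1, [], [0, 1, 3], 0)]
    (by decide) (by decide) (by decide) (by simp [reductionSum, termVal, leadCoeff, gbAt, gb]; ring)

lemma goodPair_14_15 : Good q l 14 15 :=
  goodPair_of_reduction hl [.p43, .p41] [.p431] [(1, 1, [], [], 1), (14, 1, [.p31], [3], 0), (9,
    -1, [.p43], [0], 0), (10, -1, [.p41], [2], 0), (4, 1, [], [0, 2, 3], 0)]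
    (by decide) (by decide) (by decide) (by simp [reductionSum, termVal, leadCoeff, gbAt, gb]; ring)

lemma goodPair_14_17 : Good q l 14 17 :=
  goodPair_of_reduction hl [.p21, .p32] [.p321] [(3, 1, [], [], 1), (14, 1, [.p31], [1], 0), (11,
    -1, [.p21], [2], 0), (12, -1, [.p32], [0], 0), (4, 1, [], [0, 1, 2], 0)]
    (by decide) (by decide) (by decide) (by simp [reductionSum, termVal, leadCoeff, gbAt, gb]; ring)

lemma goodPair_9_17 : Good q l 9 17 :=
  goodPair_of_reduction hl [.p21, .p32] [.p432] [(19, -1, [.p32], [], 0), (12, 1, [], [], 1), (7,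
    1, [.p431], [1], 0), (3, 1, [.p32], [3], 0), (2, 1, [.p32], [2], 0), (13, -1, [.p21], [2], 0),
    (14, -1, [.p43], [1], 0), (10, -1, [], [1, 2], 0)]
    (by decide) (by decide) (by decide) (by simp [reductionSum, termVal, leadCoeff, gbAt, gb]; ring)

lemma goodPair_9_18 : Good q l 9 18 :=
  goodPair_of_reduction hl [.p21, .p41] [.p431] [(19, -1, [.p41], [], 0), (10, 1, [], [], 1), (8,
    1, [.p432], [0], 0), (3, 1, [.p41], [3], 0), (2, 1, [.p41], [2], 0), (14, -1, [.p21], [3], 0),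
    (13, -1, [.p43], [0], 0), (12, -1, [], [0, 3], 0)]
    (by decide) (by decide) (by decide) (by simp [reductionSum, termVal, leadCoeff, gbAt, gb]; ring)

lemma goodPair_10_16 : Good q l 10 16 :=
  goodPair_of_reduction hl [.p32, .p43] [.p431] [(19, -1, [.p43], [], 0), (9, 1, [], [], 1), (8,
    1, [.p421], [2], 0), (3, 1, [.p43], [3], 0), (0, 1, [.p43], [0], 0), (14, -1, [.p32], [3], 0),
    (13, -1, [.p41], [2], 0), (11, -1, [], [2, 3], 0)]
    (by decide) (by decide) (by decide) (by simp [reductionSum, termVal, leadCoeff, gbAt, gb]; ring)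

lemma goodPair_10_17 : Good q l 10 17 :=
  goodPair_of_reduction hl [.p21, .p32] [.p421] [(19, -1, [.p21], [], 0), (11, 1, [], [], 1), (5,
    1, [.p431], [1], 0), (3, 1, [.p21], [3], 0), (0, 1, [.p21], [0], 0), (13, -1, [.p32], [0], 0),
    (14, -1, [.p41], [1], 0), (9, -1, [], [0, 1], 0)]
    (by decide) (by decide) (by decide) (by simp [reductionSum, termVal, leadCoeff, gbAt, gb]; ring)

lemma goodPair_11_15 : Good q l 11 15 :=
  goodPair_of_reduction hl [.p43, .p41] [.p421] [(19, -1, [.p41], [], 0), (10, 1, [], [], 1), (5,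
    1, [.p321], [3], 0), (0, 1, [.p41], [0], 0), (1, 1, [.p41], [1], 0), (14, -1, [.p21], [3], 0),
    (13, -1, [.p43], [0], 0), (12, -1, [], [0, 3], 0)]
    (by decide) (by decide) (by decide) (by simp [reductionSum, termVal, leadCoeff, gbAt, gb]; ring)

lemma goodPair_11_16 : Good q l 11 16 :=
  goodPair_of_reduction hl [.p32, .p43] [.p321] [(19, -1, [.p32], [], 0), (12, 1, [], [], 1), (6,
    1, [.p421], [2], 0), (0, 1, [.p32], [0], 0), (1, 1, [.p32], [1], 0), (13, -1, [.p21], [2], 0),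
    (14, -1, [.p43], [1], 0), (10, -1, [], [1, 2], 0)]
    (by decide) (by decide) (by decide) (by simp [reductionSum, termVal, leadCoeff, gbAt, gb]; ring)

lemma goodPair_12_15 : Good q l 12 15 :=
  goodPair_of_reduction hl [.p43, .p41] [.p432] [(19, -1, [.p43], [], 0), (9, 1, [], [], 1), (7,
    1, [.p321], [3], 0), (2, 1, [.p43], [2], 0), (1, 1, [.p43], [1], 0), (14, -1, [.p32], [3], 0),
    (13, -1, [.p41], [2], 0), (11, -1, [], [2, 3], 0)]
    (by decide) (by decide) (by decide) (by simp [reductionSum, termVal, leadCoeff, gbAt, gb]; ring)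

lemma goodPair_12_18 : Good q l 12 18 :=
  goodPair_of_reduction hl [.p21, .p41] [.p321] [(19, -1, [.p21], [], 0), (11, 1, [], [], 1), (6,
    1, [.p432], [0], 0), (2, 1, [.p21], [2], 0), (1, 1, [.p21], [1], 0), (13, -1, [.p32], [0], 0),
    (14, -1, [.p41], [1], 0), (9, -1, [], [0, 1], 0)]
    (by decide) (by decide) (by decide) (by simp [reductionSum, termVal, leadCoeff, gbAt, gb]; ring)

lemma goodPair_0_2 : Good q l 0 2 :=
  goodPair_of_reduction hl [.p21, .p41] [.p32, .p43] [(18, 1, [.p432], [], 0), (16, -1, [.p421],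
    [], 0), (2, -1, [.p42], [2], 0), (0, 1, [.p42], [0], 0), (12, -1, [.p21], [3], 0), (11, 1,
    [.p32], [3], 0), (10, 1, [.p43], [1], 0), (9, -1, [.p41], [1], 0)]
    (by decide) (by decide) (by decide) (by simp [reductionSum, termVal, leadCoeff, gbAt, gb]; ring)

lemma goodPair_1_3 : Good q l 1 3 :=
  goodPair_of_reduction hl [.p21, .p32] [.p43, .p41] [(17, 1, [.p431], [], 0), (15, -1, [.p321],
    [], 0), (3, -1, [.p31], [3], 0), (1, 1, [.p31], [1], 0), (10, -1, [.p21], [2], 0), (9, -1,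
    [.p32], [0], 0), (12, 1, [.p43], [0], 0), (11, 1, [.p41], [2], 0)]
    (by decide) (by decide) (by decide) (by simp [reductionSum, termVal, leadCoeff, gbAt, gb]; ring)

lemma goodPair_0_19 : Good q l 0 19 :=
  goodPair_of_reduction hl [.p21, .p41] [.p42] [(18, 2, [.p432], [], 0), (13, 2, [], [], 1), (2,
    -2, [.p42], [2], 0), (8, -2, [.p431], [1], 0), (6, -2, [.p321], [3], 0), (11, 2, [.p32], [3],
    0), (10, 2, [.p43], [1], 0), (4, 2, [.p31], [1, 3], 0), (14, 4, [], [1, 3], 0)]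
    (by decide) (by decide) (by decide) (by simp [reductionSum, termVal, leadCoeff, gbAt, gb]; ring)

lemma goodPair_1_19 : Good q l 1 19 :=
  goodPair_of_reduction hl [.p21, .p32] [.p31] [(17, 2, [.p431], [], 0), (14, 2, [], [], 1), (3,
    -2, [.p31], [3], 0), (7, -2, [.p432], [0], 0), (5, -2, [.p421], [2], 0), (12, 2, [.p43], [0],
    0), (11, 2, [.p41], [2], 0), (4, 2, [.p42], [0, 2], 0), (13, 4, [], [0, 2], 0)]
    (by decide) (by decide) (by decide) (by simp [reductionSum, termVal, leadCoeff, gbAt, gb]; ring)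

lemma goodPair_15_19 : Good q l 15 19 :=
  goodPair_of_reduction hl [.p21, .p32] [.p321] [(17, -2, [], [], 1), (3, -2, [.p321], [3], 0),
    (12, -2, [.p432], [0], 0), (14, -2, [.p431], [1], 0), (11, -2, [.p421], [2], 0), (6, 2,
    [.p42], [0, 2], 0), (7, 2, [.p43], [0, 1], 0), (5, 2, [.p41], [1, 2], 0), (8, -4, [], [0, 1,
    2], 0)]
    (by decide) (by decide) (by decide) (by simp [reductionSum, termVal, leadCoeff, gbAt, gb]; ring)

lemma goodPair_16_19 : Good q l 16 19 :=
  goodPair_of_reduction hl [.p21, .p41] [.p421] [(18, -2, [], [], 1), (2, -2, [.p421], [2], 0),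
    (13, -2, [.p432], [0], 0), (10, -2, [.p431], [1], 0), (11, -2, [.p321], [3], 0), (5, 2,
    [.p31], [1, 3], 0), (6, 2, [.p32], [0, 3], 0), (8, 2, [.p43], [0, 1], 0), (7, -4, [], [0, 1,
    3], 0)]
    (by decide) (by decide) (by decide) (by simp [reductionSum, termVal, leadCoeff, gbAt, gb]; ring)

lemma goodPair_17_19 : Good q l 17 19 :=
  goodPair_of_reduction hl [.p43, .p41] [.p431] [(15, -2, [], [], 1), (1, -2, [.p431], [1], 0),
    (9, -2, [.p432], [0], 0), (10, -2, [.p421], [2], 0), (14, -2, [.p321], [3], 0), (8, 2, [.p42],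
    [0, 2], 0), (5, 2, [.p21], [2, 3], 0), (7, 2, [.p32], [0, 3], 0), (6, -4, [], [0, 2, 3], 0)]
    (by decide) (by decide) (by decide) (by simp [reductionSum, termVal, leadCoeff, gbAt, gb]; ring)

lemma goodPair_18_19 : Good q l 18 19 :=
  goodPair_of_reduction hl [.p32, .p43] [.p432] [(16, -2, [], [], 1), (0, -2, [.p432], [0], 0),
    (9, -2, [.p431], [1], 0), (13, -2, [.p421], [2], 0), (12, -2, [.p321], [3], 0), (7, 2, [.p31],
    [1, 3], 0), (6, 2, [.p21], [2, 3], 0), (8, 2, [.p41], [1, 2], 0), (5, -4, [], [1, 2, 3], 0)]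
    (by decide) (by decide) (by decide) (by simp [reductionSum, termVal, leadCoeff, gbAt, gb]; ring)

end Pairs

/-- The pairs of elements of `gb` whose S-polynomials are reduced directly. -/
def basePairs : List (Fin 20 × Fin 20) :=
  [(4, 5), (4, 6), (4, 7), (4, 8), (5, 10), (5, 11), (6, 11), (6, 12), (7, 9), (7, 12), (8, 9),
    (8, 10), (5, 7), (6, 8), (5, 13), (6, 14), (0, 4), (1, 4), (2, 4), (3, 4), (9, 10), (9, 12),
    (9, 13), (9, 14), (10, 11), (10, 14), (11, 12), (11, 13), (0, 16), (1, 15), (2, 18), (3, 17),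
    (5, 16), (6, 15), (7, 18), (8, 17), (0, 6), (0, 8), (1, 5), (1, 7), (2, 6), (2, 8), (3, 5),
    (3, 7), (13, 16), (13, 18), (14, 15), (14, 17), (9, 17), (9, 18), (10, 16), (10, 17), (11,
    15), (11, 16), (12, 15), (12, 18), (0, 2), (1, 3), (0, 19), (1, 19), (15, 19), (16, 19), (17,
    19), (18, 19)]

/-- Pairs with coprime leading monomials, and those in `basePairs`. -/
abbrev IsBasePair (i j : Fin 20) : Prop :=
  lead i ∩ lead j = ∅ ∨ (i, j) ∈ basePairs ∨ (j, i) ∈ basePairs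

instance (i j : Fin 20) : Decidable (IsBasePair i j) :=
  inferInstanceAs (Decidable (_ ∨ _ ∨ _))

lemma IsBasePair.good (hl : l ∈ below wt ℂ 14) {i j : Fin 20} (h : IsBasePair i j) :
    Good q l i j := by
  have h0 : ∀ p ∈ basePairs, Good q l p.1 p.2 := by
    simp only [basePairs, List.forall_mem_cons]
    exact ⟨goodPair_4_5 hl, goodPair_4_6 hl, goodPair_4_7 hl, goodPair_4_8 hl, goodPair_5_10 hl,
        goodPair_5_11 hl, goodPair_6_11 hl, goodPair_6_12 hl, goodPair_7_9 hl, goodPair_7_12 hl,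
        goodPair_8_9 hl, goodPair_8_10 hl, goodPair_5_7 hl, goodPair_6_8 hl, goodPair_5_13 hl,
        goodPair_6_14 hl, goodPair_0_4 hl, goodPair_1_4 hl, goodPair_2_4 hl, goodPair_3_4 hl,
        goodPair_9_10 hl, goodPair_9_12 hl, goodPair_9_13 hl, goodPair_9_14 hl, goodPair_10_11 hl,
        goodPair_10_14 hl, goodPair_11_12 hl, goodPair_11_13 hl, goodPair_0_16 hl, goodPair_1_15
        hl, goodPair_2_18 hl, goodPair_3_17 hl, goodPair_5_16 hl, goodPair_6_15 hl, goodPair_7_18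
        hl, goodPair_8_17 hl, goodPair_0_6 hl, goodPair_0_8 hl, goodPair_1_5 hl, goodPair_1_7 hl,
        goodPair_2_6 hl, goodPair_2_8 hl, goodPair_3_5 hl, goodPair_3_7 hl, goodPair_13_16 hl,
        goodPair_13_18 hl, goodPair_14_15 hl, goodPair_14_17 hl, goodPair_9_17 hl, goodPair_9_18
        hl, goodPair_10_16 hl, goodPair_10_17 hl, goodPair_11_15 hl, goodPair_11_16 hl,
        goodPair_12_15 hl, goodPair_12_18 hl, goodPair_0_2 hl, goodPair_1_3 hl, goodPair_0_19 hl,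
        goodPair_1_19 hl, goodPair_15_19 hl, goodPair_16_19 hl, goodPair_17_19 hl, goodPair_18_19
        hl,
      by simp⟩
  rcases h with h | h | h
  · refine GoodPair.of_disjoint (hasLead_gbAt hl) ?_
    ext k
    have : k ∉ lead i ∩ lead j := by simp [h]
    rw [Finset.mem_inter] at this
    simp only [Finsupp.sup_apply, Finsupp.add_apply, expo_apply]
    split_ifs <;> simp_all
  · exact h0 _ h
  · exact (h0 _ h).symm

/-- A finite check that Buchberger's two criteria reduce all pairs to the 64 explicit ones. A chain
of length two through base pairs always suffices, so no recursion is needed. -/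
lemma isBasePair_or_chain (i j : Fin 20) : i = j ∨ IsBasePair i j ∨
    ∃ k, lead k ⊆ lead i ∪ lead j ∧ IsBasePair i k ∧ IsBasePair k j := by
  revert i j
  decide +kernel

theorem goodPair (hl : l ∈ below wt ℂ 14) (i j : Fin 20) : Good q l i j := by
  rcases isBasePair_or_chain i j with rfl | h | ⟨k, hk, h1, h2⟩
  · exact GoodPair.refl i
  · exact h.good hl
  · refine GoodPair.chain (hasLead_gbAt hl) (k := k) ?_ (h1.good hl) (h2.good hl)
    rw [expo_sup, expo_le_iff]
    refine hk.trans fun x hx => ?_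
    rw [Finsupp.mem_support_iff, expo_apply, if_pos hx]
    exact one_ne_zero

end Garnier

/-! ### Krull dimension of integral extensions -/

/-- Incomparability: contraction of primes along an integral extension is strictly monotone. -/
lemma ringKrullDim_le_of_isIntegral (A B : Type*) [CommRing A] [CommRing B] [Algebra A B]
    [Algebra.IsIntegral A B] : ringKrullDim B ≤ ringKrullDim A := by
  refine Order.krullDim_le_of_strictMono (PrimeSpectrum.comap (algebraMap A B)) fun P Q h => ?_
  have := P.isPrime
  exact Ideal.IsIntegral.comap_lt_comap (R := A) (I := P.asIdeal) (J := Q.asIdeal) h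

/-- Lying over, available because the kernel is zero, lifts the bottom of a chain of primes; going
up lifts the rest. -/
lemma ringKrullDim_le_of_isIntegral_of_injective (A B : Type*) [CommRing A] [CommRing B]
    [Algebra A B] [Algebra.IsIntegral A B] (hinj : Function.Injective (algebraMap A B)) :
    ringKrullDim A ≤ ringKrullDim B := by
  refine iSup_le fun l => ?_
  have := l.head.isPrime
  obtain ⟨Q, -, hQ, hQc⟩ := Ideal.exists_ideal_over_prime_of_isIntegral (S := B) l.head.asIdeal ⊥
    (by rw [← RingHom.ker, (RingHom.injective_iff_ker_eq_bot _).1 hinj]; exact bot_le)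
  have : Q.LiesOver l.head.asIdeal := ⟨hQc.symm⟩
  obtain ⟨L, hL, -⟩ := Ideal.exists_ltSeries_of_hasGoingUp (S := B) l Q
  rw [← hL]
  exact le_iSup (fun L : LTSeries (PrimeSpectrum B) => (L.length : WithBot ℕ∞)) L

/-- If `R` is integral over the image of a polynomial ring in `n` variables and contains `n`
algebraically independent elements, then it has dimension `n`. -/
theorem ringKrullDim_eq_of_isIntegral_aeval {K R : Type} [Field K] [CommRing R] [Algebra K R]
    {n : ℕ} {x y : Fin n → R} (hx : (aeval (R := K) x).toRingHom.IsIntegral)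
    (hy : AlgebraicIndependent K y) : ringKrullDim R = n := by
  have hP : ringKrullDim (MvPolynomial (Fin n) K) = n := by
    rw [MvPolynomial.ringKrullDim_of_isNoetherianRing, ringKrullDim_eq_zero_of_field]; simp
  apply le_antisymm
  · let _ := (aeval (R := K) x).toRingHom.toAlgebra
    have : Algebra.IsIntegral (MvPolynomial (Fin n) K) R := ⟨hx⟩
    rw [← hP]
    exact ringKrullDim_le_of_isIntegral _ _
  -- For the lower bound, choose a prime `P` that avoids every nonzero polynomial in `y`. The `y i`
  -- then stay algebraically independent in the domain `R ⧸ P`.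
  · let S : Submonoid R := (nonZeroDivisors (MvPolynomial (Fin n) K)).map (aeval (R := K) y)
    have hS : Disjoint ((⊥ : Ideal R) : Set R) S := by
      rw [Set.disjoint_left]
      rintro _ h ⟨p, hp, rfl⟩
      exact nonZeroDivisors.ne_zero hp (hy (by simpa using h))
    obtain ⟨P, hP', -, hPS⟩ := Ideal.exists_le_prime_disjoint _ S hS
    have hmk (z : Fin n → R) (p : MvPolynomial (Fin n) K) :
        aeval (fun i => Ideal.Quotient.mkₐ K P (z i)) p = Ideal.Quotient.mkₐ K P (aeval z p) :=
      (comp_aeval_apply (f := z) (φ := Ideal.Quotient.mkₐ K P) p).symm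
    have hy' : AlgebraicIndependent K fun i => Ideal.Quotient.mkₐ K P (y i) := by
      rw [algebraicIndependent_iff]
      intro p hp
      by_contra h0
      rw [hmk, Ideal.Quotient.mkₐ_eq_mk, Ideal.Quotient.eq_zero_iff_mem] at hp
      exact Set.disjoint_left.1 hPS hp ⟨p, mem_nonZeroDivisors_of_ne_zero h0, rfl⟩
    let x' : Fin n → R ⧸ P := fun i => Ideal.Quotient.mkₐ K P (x i)
    have hint : (aeval (R := K) x').toRingHom.IsIntegral := by
      have := hx.trans _ (Ideal.Quotient.mk P)
        (RingHom.isIntegral_of_surjective _ Ideal.Quotient.mk_surjective)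
      have e : (aeval (R := K) x').toRingHom =
          (Ideal.Quotient.mk P).comp (aeval (R := K) x).toRingHom := RingHom.ext (hmk x)
      rwa [e]
    have halg : Algebra.IsAlgebraic (Algebra.adjoin K (Set.range x')) (R ⧸ P) := by
      suffices Algebra.IsIntegral (Algebra.adjoin K (Set.range x')) (R ⧸ P) from
        Algebra.IsIntegral.isAlgebraic
      refine ⟨fun r => ?_⟩
      obtain ⟨p, hp, hpr⟩ := hint r
      let φ : MvPolynomial (Fin n) K →+* Algebra.adjoin K (Set.range x') :=
        (aeval (R := K) x').toRingHom.codRestrict _ fun q => by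
          rw [Algebra.adjoin_range_eq_range_aeval]; exact ⟨q, rfl⟩
      refine ⟨p.map φ, hp.map φ, ?_⟩
      rw [Polynomial.eval₂_map]
      exact hpr
    -- The domain `R ⧸ P` is algebraic over the `n` elements `x'` and has transcendence degree at
    -- least `n` because of `y`, so the `x'` are themselves algebraically independent and the
    -- polynomial ring embeds.
    have hb := Algebra.IsAlgebraic.isTranscendenceBasis_of_lift_le_trdeg_of_finite K x'
      (by simpa using hy'.lift_cardinalMk_le_trdeg)
    let _ := (aeval (R := K) x').toRingHom.toAlgebra
    have : Algebra.IsIntegral (MvPolynomial (Fin n) K) (R ⧸ P) := ⟨hint⟩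
    rw [← hP]
    exact (ringKrullDim_le_of_isIntegral_of_injective _ (R ⧸ P) hb.1).trans
      (ringKrullDim_le_of_surjective _ (Ideal.Quotient.mk_surjective (I := P)))

/-! ### Ideals with squarefree initial ideal -/

namespace WeightedGroebner

variable {σ K : Type} [Field K] {w : σ → ℕ}

lemma sub_component_mem_below {n : ℕ} {p : MvPolynomial σ K} (hp : p ∈ below w K (n + 1)) :
    p - weightedHomogeneousComponent w n p ∈ below w K n := by
  classical
  intro ν hν
  rw [coeff_sub, coeff_weightedHomogeneousComponent] at hν
  split_ifs at hν with h
  · simp at hν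
  · have := hp ν (by simpa using hν)
    omega

lemma component_mem_below (n : ℕ) (p : MvPolynomial σ K) :
    weightedHomogeneousComponent w n p ∈ below w K (n + 1) := by
  classical
  intro ν hν
  rw [coeff_weightedHomogeneousComponent] at hν
  split_ifs at hν with h
  · omega
  · simp at hν

lemma component_eq_zero {n : ℕ} {p : MvPolynomial σ K} (hp : p ∈ below w K n) :
    weightedHomogeneousComponent w n p = 0 := by
  classical
  ext ν
  rw [coeff_weightedHomogeneousComponent, coeff_zero]
  split_ifs with h
  · by_contra h'
    have := hp ν h'
    omega
  · rfl

lemma component_mul {m n : ℕ} {p q : MvPolynomial σ K} (hp : p ∈ below w K (m + 1))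
    (hq : q ∈ below w K (n + 1)) : weightedHomogeneousComponent w (m + n) (p * q) =
      weightedHomogeneousComponent w m p * weightedHomogeneousComponent w n q := by
  set P := weightedHomogeneousComponent w m p with hP
  set Q := weightedHomogeneousComponent w n q with hQ
  have h1 : p * q = P * Q + ((p - P) * q + P * (q - Q)) := by ring
  have h2 : (p - P) * q + P * (q - Q) ∈ below w K (m + n) := by
    refine add_mem ?_ (mul_mem_below (component_mem_below m p) (sub_component_mem_below hq))
    rw [mul_comm, add_comm]
    exact mul_mem_below hq (sub_component_mem_below hp)
  rw [h1, map_add, component_eq_zero h2, add_zero]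
  exact ((weightedHomogeneousComponent_isWeightedHomogeneous m p).mul
    (weightedHomogeneousComponent_isWeightedHomogeneous n q)).weightedHomogeneousComponent_same

lemma pow_mem_below {n : ℕ} {p : MvPolynomial σ K} (hp : p ∈ below w K (n + 1)) (r : ℕ) :
    p ^ r ∈ below w K (r * n + 1) := by
  induction r with
  | zero => simpa using C_mem_below (w := w) (1 : K) one_pos
  | succ r ih =>
    rw [pow_succ, show (r + 1) * n + 1 = r * n + (n + 1) by ring]
    exact mul_mem_below ih hp

lemma component_pow {n : ℕ} {p : MvPolynomial σ K} (hp : p ∈ below w K (n + 1)) (r : ℕ) :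
    weightedHomogeneousComponent w (r * n) (p ^ r) = weightedHomogeneousComponent w n p ^ r := by
  induction r with
  | zero =>
    rw [zero_mul, pow_zero, pow_zero]
    exact (isWeightedHomogeneous_one K w).weightedHomogeneousComponent_same
  | succ r ih => rw [pow_succ, pow_succ, ← ih, add_mul, one_mul, component_mul (pow_mem_below hp r) hp]

open Classical in
lemma coeff_aeval_ite (s : Finset σ) (p : MvPolynomial σ K) (ν : σ →₀ ℕ) :
    coeff ν (aeval (fun i => if i ∈ s then (X i : MvPolynomial σ K) else 0) p) =
      if ν.support ⊆ s then coeff ν p else 0 := by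
  induction p using MvPolynomial.induction_on' with
  | add p q hp hq => rw [map_add, coeff_add, hp, hq, coeff_add]; split_ifs <;> simp
  | monomial μ a =>
    rw [aeval_monomial]
    by_cases hμ : μ.support ⊆ s
    · have h : (μ.prod fun i k => (if i ∈ s then (X i : MvPolynomial σ K) else 0) ^ k) =
          μ.prod fun i k => X i ^ k :=
        Finsupp.prod_congr fun i hi => by rw [if_pos (hμ hi)]
      rw [h, algebraMap_eq, ← monomial_eq, coeff_monomial]
      split_ifs with h1 h2 h2
      · rfl
      · exact absurd (h1 ▸ hμ) h2
      · rfl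
      · rfl
    · obtain ⟨i, hi, his⟩ := Finset.not_subset.1 hμ
      have h : (μ.prod fun i k => (if i ∈ s then (X i : MvPolynomial σ K) else 0) ^ k) = 0 :=
        Finset.prod_eq_zero hi
          (by simp only [if_neg his, zero_pow (Finsupp.mem_support_iff.1 hi)])
      rw [h, mul_zero, coeff_zero, coeff_monomial]
      split_ifs with h1 h2
      · exact absurd (h2 ▸ h1) hμ
      · rfl
      · rfl

/-- `bad` is the set of supports of the monomials in the initial ideal of `I`. -/
structure IsInitial (w : σ → ℕ) (I : Ideal (MvPolynomial σ K)) (bad : Finset σ → Prop) : Prop where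
  mono : ∀ {s t}, s ⊆ t → bad s → bad t
  bad_support : ∀ {h}, h ∈ I → ∀ {ν}, coeff ν h ≠ 0 → h ∈ below w K (Finsupp.weight w ν + 1) →
    bad ν.support
  exists_reduction : ∀ {ν : σ →₀ ℕ}, bad ν.support →
    ∃ p ∈ I, monomial ν 1 - p ∈ below w K (Finsupp.weight w ν)

variable {I : Ideal (MvPolynomial σ K)} {bad : Finset σ → Prop}

/-- A single pass over the monomials of weight `n` is enough: each reduction changes only terms of
smaller weight, so it creates no new bad monomials at the top. -/
lemma IsInitial.exists_reduced (H : IsInitial w I bad) {n : ℕ} {h : MvPolynomial σ K}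
    (hn : h ∈ below w K (n + 1)) : ∃ h' ∈ below w K (n + 1), h - h' ∈ I ∧
      ∀ ν, coeff ν h' ≠ 0 → Finsupp.weight w ν = n → ¬ bad ν.support := by
  classical
  have hred (ν : σ →₀ ℕ) := H.exists_reduction (ν := ν)
  choose! p hpI hp using hred
  let T := h.support.filter fun ν => bad ν.support ∧ Finsupp.weight w ν = n
  refine ⟨h - ∑ ν ∈ T, C (coeff ν h) * p ν, ?_, ?_, ?_⟩
  · refine sub_mem hn (Submodule.sum_mem _ fun ν hν => C_mul_mem _ ?_)
    obtain ⟨-, h1, h2⟩ := Finset.mem_filter.1 hν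
    have := sub_mem (monomial_mem_below (w := w) (μ := ν) (n := n + 1) (1 : K) (by omega))
      (below_mono (by omega) (hp _ h1))
    rwa [sub_sub_cancel] at this
  · rw [sub_sub_cancel]
    exact Ideal.sum_mem _ fun ν hν => I.mul_mem_left _ (hpI _ (Finset.mem_filter.1 hν).2.1)
  · intro ν hν hw hb
    apply hν
    have h1 (μ : σ →₀ ℕ) (hμ : μ ∈ T) : coeff ν (C (coeff μ h) * p μ) =
        coeff ν (monomial μ (coeff μ h)) := by
      obtain ⟨-, h2, h3⟩ := Finset.mem_filter.1 hμ
      have h4 : coeff ν (monomial μ 1 - p μ) = 0 := by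
        by_contra h5
        have := hp _ h2 ν h5
        omega
      rw [coeff_sub, sub_eq_zero] at h4
      rw [coeff_C_mul, ← h4, ← coeff_C_mul, C_mul_monomial, mul_one]
    rw [coeff_sub, coeff_sum, Finset.sum_congr rfl h1, ← coeff_sum, sub_eq_zero]
    by_cases h0 : coeff ν h = 0
    · rw [h0, coeff_sum, Finset.sum_eq_zero]
      intro μ hμ
      rw [coeff_monomial, if_neg]
      rintro rfl
      exact mem_support_iff.1 (Finset.mem_filter.1 hμ).1 h0
    · rw [coeff_sum, Finset.sum_eq_single ν]
      · rw [coeff_monomial, if_pos rfl]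
      · intro μ _ hμ
        rw [coeff_monomial, if_neg hμ]
      · intro hT
        exact absurd (Finset.mem_filter.2 ⟨mem_support_iff.2 h0, hb, hw⟩) hT

/-- An ideal with squarefree initial ideal is radical. -/
theorem IsInitial.isRadical (H : IsInitial w I bad) : I.IsRadical := by
  classical
  rintro h ⟨r, hr⟩
  obtain ⟨n, hn⟩ := exists_mem_below (w := w) h
  induction n generalizing h with
  | zero => rw [eq_zero_of_mem_below_zero hn]; exact I.zero_mem
  | succ n ih =>
    obtain ⟨h', hn', hsub, hgood⟩ := H.exists_reduced hn
    have hr' : h' ^ r ∈ I := by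
      rw [← Ideal.Quotient.eq_zero_iff_mem, map_pow, ← Ideal.Quotient.eq.2 hsub, ← map_pow,
        Ideal.Quotient.eq_zero_iff_mem.2 hr]
    suffices h' ∈ I by simpa using add_mem hsub this
    by_cases hb : h' ∈ below w K n
    · exact ih hr' hb
    exfalso
    rw [mem_below] at hb
    push Not at hb
    obtain ⟨ν, hν, hνn⟩ := hb
    replace hνn : Finsupp.weight w ν = n := by have := hn' ν hν; omega
    -- Setting the variables outside the support of `ν` to zero keeps the top component of `h'`
    -- nonzero, hence its `r`-th power too. A surviving monomial of that power is a leading monomial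
    -- of an element of `I` with support inside that of `ν`. As badness depends only on supports,
    -- `ν` would be bad.
    set φ : MvPolynomial σ K →ₐ[K] MvPolynomial σ K :=
      aeval (fun i => if i ∈ ν.support then (X i : MvPolynomial σ K) else 0) with hφ
    have h1 : φ (weightedHomogeneousComponent w n h') ≠ 0 := by
      intro h0
      have := congrArg (coeff ν) h0
      rw [hφ, coeff_aeval_ite, if_pos subset_rfl, coeff_weightedHomogeneousComponent, if_pos hνn,
        coeff_zero] at this
      exact hν this
    obtain ⟨μ, hμ⟩ := exists_coeff_ne_zero (pow_ne_zero r h1)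
    rw [← map_pow, ← component_pow hn', hφ, coeff_aeval_ite] at hμ
    split_ifs at hμ with hsupp
    · rw [coeff_weightedHomogeneousComponent] at hμ
      split_ifs at hμ with hw
      · exact hgood ν hν hνn (H.mono hsupp (H.bad_support hr' hμ (hw ▸ pow_mem_below hn' r)))
      · exact hμ rfl
    · exact hμ rfl

/-- The variables in a set that is not bad are algebraically independent modulo the ideal. -/
theorem IsInitial.algebraicIndependent (H : IsInitial w I bad) {ι : Type} {x : ι → σ}
    (hx : Function.Injective x) {s : Finset σ} (hs : ∀ i, x i ∈ s) (hbad : ¬ bad s) :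
    AlgebraicIndependent K fun i => Ideal.Quotient.mk I (X (x i)) := by
  classical
  rw [algebraicIndependent_iff]
  intro p hp
  by_contra h0
  have h1 : rename x p ∈ I := by
    have e : (Ideal.Quotient.mkₐ K I).comp (rename x) =
        aeval fun i => Ideal.Quotient.mk I (X (x i)) := by
      ext i; simp
    rw [← Ideal.Quotient.eq_zero_iff_mem, ← hp, ← e]
    rfl
  have h2 : (rename x p).support.Nonempty := by
    rw [support_nonempty]
    exact fun h => h0 (rename_injective x hx (by simpa using h))
  obtain ⟨ν, hν, hmax⟩ := Finset.exists_max_image _ (Finsupp.weight w) h2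
  refine hbad (H.mono ?_ (H.bad_support h1 (mem_support_iff.1 hν)
    fun μ hμ => Nat.lt_succ_of_le (hmax μ (mem_support_iff.2 hμ))))
  rw [support_rename_of_injective hx] at hν
  obtain ⟨μ, -, rfl⟩ := Finset.mem_image.1 hν
  intro i hi
  obtain ⟨j, -, rfl⟩ := Finset.mem_image.1 (Finsupp.mapDomain_support hi)
  exact hs j

end WeightedGroebner

/-! ### Integrality over elementary symmetric functions -/

namespace WeightedGroebner

variable {σ K : Type} [Field K] [Fintype σ] {w : σ → ℕ}
  {I : Ideal (MvPolynomial σ K)} {bad : Finset σ → Prop}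

/-- `y v` is a root of `∏ (T - y i)`, whose coefficients are the signed elementary symmetric
functions. This supplies one integral equation for all variables at once. -/
lemma sum_esymm_mul_pow_eq_zero {R : Type*} [CommRing R] (y : σ → R) (v : σ) :
    ∑ j ∈ Finset.range (Fintype.card σ + 1),
      (-1) ^ j * ((Finset.univ.val.map y).esymm j * y v ^ (Fintype.card σ - j)) = 0 := by
  have h := congrArg (Polynomial.eval (y v))
    (Multiset.prod_X_sub_X_eq_sum_esymm (Finset.univ.val.map y))
  rw [Multiset.map_map] at h
  have h0 : (Polynomial.eval (y v))
      ((Finset.univ.val.map ((fun t => Polynomial.X - Polynomial.C t) ∘ y)).prod) = 0 := by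
    change Polynomial.eval (y v) (∏ i, (Polynomial.X - Polynomial.C (y i))) = 0
    rw [Polynomial.eval_prod]
    exact Finset.prod_eq_zero (Finset.mem_univ v) (by simp)
  rw [h0] at h
  simpa [Polynomial.eval_finsetSum] using h.symm

/-- If all `d + 1`-element sets of variables are bad, the quotient is integral over the elementary
symmetric functions of degree at most `d` of suitable powers of the variables. -/
theorem IsInitial.isIntegral (H : IsInitial w I bad) {R : Type} [CommRing R] [Algebra K R]
    {mk : MvPolynomial σ K →ₐ[K] R} (hmk : Function.Surjective mk) (hI : ∀ p ∈ I, mk p = 0)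
    {d N : ℕ}
    (hbad : ∀ s : Finset σ, d < s.card → bad s) {r : σ → ℕ} (hr : ∀ v, r v * w v = N) (hN : 0 < N) :
    (aeval (R := K) fun j : Fin d =>
      (Finset.univ.val.map fun v => mk (X v) ^ r v).esymm (j + 1)).toRingHom.IsIntegral := by
  classical
  set y : σ → R := fun v => mk (X v) ^ r v with hy
  set θ : Fin d → R := fun j => (Finset.univ.val.map y).esymm (j + 1)
  let _ := (aeval (R := K) θ).toRingHom.toAlgebra
  have hθ (j : Fin d) : algebraMap (MvPolynomial (Fin d) K) R (X j) = θ j := aeval_X _ _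
  -- If every exponent satisfies `ν v < card σ * r v`, the weight of `ν` is at most `card σ * (card
  -- σ * N)`. So beyond this bound some variable occurs to a power at which the equation of
  -- `sum_esymm_mul_pow_eq_zero` can be applied. Monomials below the bound will generate `R` as a
  -- module.
  set n₀ := Fintype.card σ * (Fintype.card σ * N) + 1
  set M : Submodule (MvPolynomial (Fin d) K) R :=
    Submodule.span _ (mk '' ((fun ν => monomial ν 1) '' {ν | Finsupp.weight w ν < n₀})) with hM
  have hC (c : K) {m : R} (hm : m ∈ M) : mk (C c) * m ∈ M := by
    have : mk (C c) * m = (C c : MvPolynomial (Fin d) K) • m := by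
      rw [Algebra.smul_def]
      congr 1
      rw [← algebraMap_eq, AlgHom.commutes]
      exact (aeval_C (R := K) θ c).symm
    rw [this]
    exact M.smul_mem _ hm
  have hmono (n : ℕ) : ∀ ν, Finsupp.weight w ν < n → mk (monomial ν 1) ∈ M := by
    induction n with
    | zero => exact fun ν h => absurd h (Nat.not_lt_zero _)
    | succ n ih =>
      have hlow {p : MvPolynomial σ K} (hp : p ∈ below w K n) : mk p ∈ M := by
        rw [p.as_sum, map_sum]
        refine Submodule.sum_mem _ fun ν hν => ?_
        have := hC (coeff ν p) (ih ν (hp ν (mem_support_iff.1 hν)))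
        rwa [← map_mul, C_mul_monomial, mul_one] at this
      intro ν hν
      by_cases h0 : Finsupp.weight w ν < n₀
      · exact Submodule.subset_span ⟨_, ⟨ν, h0, rfl⟩, rfl⟩
      obtain ⟨v, hv⟩ : ∃ v, Fintype.card σ * r v ≤ ν v := by
        by_contra! hlt
        refine h0 (Nat.lt_succ_of_le ?_)
        rw [Finsupp.weight_apply, Finsupp.sum_fintype _ _ (by simp)]
        refine (Finset.sum_le_card_nsmul _ _ (Fintype.card σ * N) fun i _ => ?_).trans (by simp)
        rw [← hr i, ← mul_assoc, smul_eq_mul]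
        exact Nat.mul_le_mul_right _ (hlt i).le
      obtain ⟨μ, rfl⟩ : ∃ μ, ν = Finsupp.single v (Fintype.card σ * r v) + μ :=
        exists_add_of_le (Finsupp.single_le_iff.2 hv)
      have hsum := congrArg (· * mk (monomial μ 1)) (sum_esymm_mul_pow_eq_zero y v)
      simp only [zero_mul] at hsum
      rw [Finset.sum_range_succ', add_mul, Finset.sum_mul, add_eq_zero_iff_neg_eq'] at hsum
      have hyv (k : ℕ) : y v ^ k = mk (monomial (Finsupp.single v (k * r v)) 1) := by
        rw [hy, ← pow_mul, ← map_pow, X_pow_eq_monomial, mul_comm]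
      have hlead : mk (monomial (Finsupp.single v (Fintype.card σ * r v) + μ) 1) =
          (-1) ^ 0 * ((Finset.univ.val.map y).esymm 0 * y v ^ (Fintype.card σ - 0)) * mk (monomial μ 1) := by
        have h1 : (Finset.univ.val.map y).esymm 0 = 1 := by simp [Multiset.esymm]
        rw [h1, hyv, ← one_mul (1 : K), ← monomial_mul, map_mul]
        simp
      rw [hlead, neg_eq_iff_eq_neg.1 hsum]
      refine neg_mem (Submodule.sum_mem _ fun j hj => ?_)
      rw [Finset.mem_range] at hj
      have hw : Finsupp.weight w (Finsupp.single v (Fintype.card σ * r v) + μ) =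
          Fintype.card σ * N + Finsupp.weight w μ := by
        rw [map_add, Finsupp.weight_single, smul_eq_mul, mul_assoc, hr]
      rw [hw] at hν
      have hw' : Finsupp.weight w (Finsupp.single v ((Fintype.card σ - (j + 1)) * r v) + μ) +
          (j + 1) * N = Fintype.card σ * N + Finsupp.weight w μ := by
        rw [map_add, Finsupp.weight_single, smul_eq_mul, mul_assoc, hr]
        have : (Fintype.card σ - (j + 1)) * N + (j + 1) * N = Fintype.card σ * N := by
          rw [← add_mul]; congr 1; omega
        omega
      have e1 : y v ^ (Fintype.card σ - (j + 1)) * mk (monomial μ 1) =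
          mk (monomial (Finsupp.single v ((Fintype.card σ - (j + 1)) * r v) + μ) 1) := by
        rw [hyv, ← map_mul, monomial_mul, one_mul]
      rw [mul_assoc, mul_assoc, e1]
      have hneg {m : R} (hm : m ∈ M) : (-1) ^ (j + 1) * m ∈ M := by
        rcases neg_one_pow_eq_or R (j + 1) with h | h <;> rw [h]
        · rwa [one_mul]
        · rw [neg_one_mul]; exact neg_mem hm
      refine hneg ?_
      -- The coefficient here is the symmetric function of degree `j + 1`. For `j < d` it is the
      -- scalar `θ j`, and the remaining monomial has smaller weight. Otherwise it is a sum of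
      -- products over sets of more than `d` variables, which are bad, so each resulting monomial
      -- reduces to smaller weight modulo `I`.
      by_cases hjd : j < d
      · have hm := ih (Finsupp.single v ((Fintype.card σ - (j + 1)) * r v) + μ) (by
          have : N ≤ (j + 1) * N := Nat.le_mul_of_pos_left _ (Nat.succ_pos _)
          omega)
        have := M.smul_mem (X (⟨j, hjd⟩ : Fin d)) hm
        rwa [Algebra.smul_def, hθ] at this
      · rw [Finset.esymm_map_val, Finset.sum_mul]
        refine Submodule.sum_mem _ fun t ht => ?_
        obtain ⟨-, htc⟩ := Finset.mem_powersetCard.1 ht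
        set ρ : σ →₀ ℕ := ∑ i ∈ t, Finsupp.single i (r i) with hρ
        have e2 : t.prod y = mk (monomial ρ 1) := by
          rw [hρ, monomial_sum_one, map_prod]
          refine Finset.prod_congr rfl fun i _ => ?_
          rw [← X_pow_eq_monomial, map_pow]
        have hρw : Finsupp.weight w ρ = (j + 1) * N := by
          rw [hρ, map_sum, ← htc, ← smul_eq_mul, ← Finset.sum_const]
          exact Finset.sum_congr rfl fun i _ => by rw [Finsupp.weight_single, smul_eq_mul, hr]
        have hρs : bad (ρ + (Finsupp.single v ((Fintype.card σ - (j + 1)) * r v) + μ)).support := by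
          refine H.mono (s := t) (fun i hi => ?_) (hbad t (by omega))
          have hri : r i ≠ 0 := by
            rintro h; have := hr i; rw [h, zero_mul] at this; omega
          have : ρ i = r i := by
            rw [hρ, Finsupp.finsetSum_apply, Finset.sum_eq_single i]
            · simp
            · intro k _ hk; simp [hk]
            · exact fun h => absurd hi h
          rw [Finsupp.mem_support_iff, Finsupp.add_apply, this]
          omega
        obtain ⟨p, hpI, hp⟩ := H.exists_reduction hρs
        have e3 : t.prod y *
            mk (monomial (Finsupp.single v ((Fintype.card σ - (j + 1)) * r v) + μ) 1) =
            mk (monomial (ρ + (Finsupp.single v ((Fintype.card σ - (j + 1)) * r v) + μ)) 1 - p) := by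
          rw [map_sub, hI p hpI, sub_zero, e2, ← map_mul,
            monomial_mul, one_mul]
        rw [e3]
        refine hlow (below_mono ?_ hp)
        rw [map_add, hρw]
        omega
  have htop : M = ⊤ := by
    rw [eq_top_iff]
    rintro x -
    obtain ⟨p, rfl⟩ := hmk x
    rw [p.as_sum, map_sum]
    refine Submodule.sum_mem _ fun ν _ => ?_
    have := hC (coeff ν p) (hmono _ ν (Nat.lt_succ_self _))
    rwa [← map_mul, C_mul_monomial, mul_one] at this
  have hfin : {ν : σ →₀ ℕ | Finsupp.weight w ν < n₀}.Finite := by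
    refine (Set.finite_Iic (Finsupp.equivFunOnFinite.symm fun _ => n₀)).subset fun ν hν i => ?_
    have hwi : 0 < w i := Nat.pos_of_ne_zero fun h => by have := hr i; rw [h, mul_zero] at this; omega
    have h1 : ν i ≤ Finsupp.weight w ν := Finsupp.le_weight w hwi.ne' ν
    exact h1.trans (le_of_lt hν)
  have : Module.Finite (MvPolynomial (Fin d) K) R :=
    ⟨htop ▸ Submodule.fg_span ((hfin.image _).image _)⟩
  exact (Algebra.IsIntegral.of_finite (MvPolynomial (Fin d) K) R).isIntegral

end WeightedGroebner

/-! ### Radicality and dimension in centred coordinates -/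

namespace Garnier

open WeightedGroebner

variable {q : Fin 4 → ℂ} {l : MvPolynomial Coord ℂ}

/-- The ideal generated by `gb`. -/
noncomputable def gbIdeal (q : Fin 4 → ℂ) (l : MvPolynomial Coord ℂ) :
    Ideal (MvPolynomial Coord ℂ) :=
  Ideal.span (Set.range (gbAt (fun i => C (q i)) l X))

/-- Sets of variables containing a leading monomial of `gb`. -/
def ContainsLead (s : Finset Coord) : Prop := ∃ k, lead k ⊆ s

instance : DecidablePred ContainsLead := fun _ => inferInstanceAs (Decidable (∃ _, _))

lemma isInitial_gbIdeal (hl : l ∈ below wt ℂ 14) :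
    IsInitial wt (gbIdeal q l) ContainsLead where
  mono := fun h ⟨k, hk⟩ => ⟨k, hk.trans h⟩
  bad_support := by
    intro h hh ν hν hmax
    obtain ⟨k, hk⟩ := (hasLead_gbAt hl).exists_le_of_mem_span (goodPair hl) hh hν hmax
    exact ⟨k, (expo_le_iff _ _).1 hk⟩
  exists_reduction := by
    rintro ν ⟨k, hk⟩
    obtain ⟨μ, rfl⟩ := exists_add_of_le ((expo_le_iff _ _).2 hk)
    obtain ⟨h0, h1⟩ := hasLead_gbAt (q := q) hl k
    refine ⟨monomial μ (leadCoeff k : ℂ)⁻¹ * gbAt (fun i => C (q i)) l X k,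
      Ideal.mul_mem_left _ _ (Ideal.subset_span ⟨k, rfl⟩), ?_⟩
    have h2 := mul_mem_below (monomial_mem_below (w := wt) (μ := μ) (leadCoeff k : ℂ)⁻¹
      (Nat.lt_succ_self _)) h1
    rw [mul_sub, monomial_mul, inv_mul_cancel₀ h0, add_comm μ, add_comm (Finsupp.weight wt μ),
      ← map_add] at h2
    rw [← neg_sub]
    exact neg_mem h2

lemma containsLead_of_card (s : Finset Coord) : 4 < s.card → ContainsLead s := by
  revert s
  decide +kernel

lemma gbIdeal_isRadical (hl : l ∈ below wt ℂ 14) : (gbIdeal q l).IsRadical :=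
  (isInitial_gbIdeal hl).isRadical

lemma ringKrullDim_gbIdeal (hl : l ∈ below wt ℂ 14) :
    ringKrullDim (MvPolynomial Coord ℂ ⧸ gbIdeal q l) = 4 := by
  have H := isInitial_gbIdeal (q := q) hl
  -- Here `1144 = 8 * 11 * 13` is a common multiple of the weights, so the powers `1144 / wt i`
  -- bring all variables to equal weight.
  have hint := H.isIntegral (mk := Ideal.Quotient.mkₐ ℂ (gbIdeal q l))
    (Ideal.Quotient.mkₐ_surjective _ _) (fun p hp => Ideal.Quotient.eq_zero_iff_mem.2 hp)
    (d := 4) (N := 1144) containsLead_of_card (r := fun i => 1144 / wt i)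
    (by intro v; cases v <;> rfl) (by norm_num)
  -- These four variables contain no leading monomial of `gb`.
  have hind := H.algebraicIndependent (x := ![Coord.p21, .p32, .p43, .p321])
    (s := {.p21, .p32, .p43, .p321}) (by decide) (by decide) (by decide)
  exact_mod_cast ringKrullDim_eq_of_isIntegral_aeval hint hind

end Garnier

/-! ### The given relations in centred coordinates -/

namespace Garnier

section Coordinates

variable {R : Type} [CommRing R]

/-- The coordinates `p_ij`, `p_ijk` in terms of the half traces `h_i` and the centred coordinates
`½ tr X_i X_j`, `±½ tr X_i X_j X_k` of the traceless parts `X_i` of four matrices. -/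
def uncenter (h : Fin 4 → R) (x : Coord → R) : Coord → R
  | .p21 => 2 * (h 1 * h 0 + x .p21)
  | .p31 => 2 * (h 2 * h 0 + x .p31)
  | .p32 => 2 * (h 2 * h 1 + x .p32)
  | .p41 => 2 * (h 3 * h 0 + x .p41)
  | .p42 => 2 * (h 3 * h 1 + x .p42)
  | .p43 => 2 * (h 3 * h 2 + x .p43)
  | .p321 => 2 * (h 2 * h 1 * h 0 + h 2 * x .p21 + h 1 * x .p31 + h 0 * x .p32 - x .p321)
  | .p432 => 2 * (h 3 * h 2 * h 1 + h 3 * x .p32 + h 2 * x .p42 + h 1 * x .p43 + x .p432)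
  | .p431 => 2 * (h 3 * h 2 * h 0 + h 3 * x .p31 + h 2 * x .p41 + h 0 * x .p43 - x .p431)
  | .p421 => 2 * (h 3 * h 1 * h 0 + h 3 * x .p21 + h 1 * x .p41 + h 0 * x .p42 + x .p421)

/-- The value of `eg - ac - bd` imposed by the trace `2 * m` of the product of the matrices. -/
def pfaffian (h : Fin 4 → R) (m : R) (x : Coord → R) : R :=
  h 0 * h 1 * h 2 * h 3 + h 0 * h 1 * x .p43 + h 2 * h 3 * x .p21 + h 0 * h 3 * x .p32 +
    h 1 * h 2 * x .p41 + h 0 * h 2 * x .p42 + h 1 * h 3 * x .p31 - h 3 * x .p321 + h 0 * x .p432 -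
    h 1 * x .p431 + h 2 * x .p421 - m

/-- The relations `gb` between centred coordinates for given traces. -/
def centeredGb (h : Fin 4 → R) (m : R) (x : Coord → R) : Fin 20 → R :=
  gbAt (fun i => h i ^ 2 - 1) (pfaffian h m x) x

/-- The relations `rel` evaluated at a family of coordinates. -/
def relAt (p : Fin 4 → R) (pinf : R) (y : Coord → R) : Fin 15 → R :=
  rel (p 0) (p 1) (p 2) (p 3) pinf (y .p21) (y .p31) (y .p32) (y .p41) (y .p42) (y .p43)
    (y .p321) (y .p432) (y .p431) (y .p421)

lemma map_relAt {S F : Type} [CommRing S] [FunLike F R S] [RingHomClass F R S] (φ : F)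
    (p : Fin 4 → R) (pinf : R) (y : Coord → R) :
    φ ∘ relAt p pinf y = relAt (φ ∘ p) (φ pinf) (φ ∘ y) := by
  simp only [relAt, rel, Matrix.vecCons, Fin.comp_cons, map_add, map_sub, map_mul,
    map_neg, map_pow, map_ofNat, Function.comp_apply]
  congr!

lemma map_centeredGb {S F : Type} [CommRing S] [FunLike F R S] [RingHomClass F R S] (φ : F)
    (h : Fin 4 → R) (m : R)
    (x : Coord → R) : φ ∘ centeredGb h m x = centeredGb (φ ∘ h) (φ m) (φ ∘ x) := by
  simp only [centeredGb, gbAt, gb, pfaffian, Matrix.vecCons, Fin.comp_cons, map_add,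
    map_sub, map_mul, map_pow, map_ofNat, map_one, Function.comp_apply]
  congr!

-- Each relation is, up to the factor `±4`, one of the first fifteen elements of `gb`, corrected by
-- multiples of `G 4, …, G 8`. This system is triangular, hence invertible as soon as 2 is. Naming
-- the vector `G` keeps the right-hand side short.
set_option maxHeartbeats 4000000 in
lemma relAt_uncenter (h : Fin 4 → R) (m : R) (x : Coord → R) (G : Fin 20 → R)
    (hG : G = centeredGb h m x) : relAt (fun i => 2 * h i) (2 * m) (uncenter h x) =
      ![4 * G 3, 4 * G 2, 4 * G 1, 4 * G 0, -4 * G 4, -4 * G 5 - 4 * h 0 * G 4,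
        -4 * G 12 + 4 * h 1 * G 7 - 4 * h 2 * G 6 + 4 * h 1 * h 2 * G 4,
        -4 * G 8 + 4 * h 3 * G 4,
        -4 * G 9 + 4 * h 3 * G 7 - 4 * h 2 * G 8 + 4 * h 2 * h 3 * G 4,
        4 * G 7 + 4 * h 2 * G 4, 4 * G 6 - 4 * h 1 * G 4,
        -4 * G 14 + 4 * h 0 * G 7 + 4 * h 2 * G 5 + 4 * h 0 * h 2 * G 4,
        4 * G 13 + 4 * h 1 * G 8 + 4 * h 3 * G 6 - 4 * h 1 * h 3 * G 4,
        4 * G 10 - 4 * h 3 * G 5 + 4 * h 0 * G 8 - 4 * h 0 * h 3 * G 4,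
        -4 * G 11 + 4 * h 1 * G 5 - 4 * h 0 * G 6 + 4 * h 0 * h 1 * G 4] := by
  subst hG
  simp only [relAt, rel, uncenter, centeredGb, gbAt, gb, pfaffian, Matrix.cons_val]
  iterate 15 refine congr_arg₂ Matrix.vecCons (by ring) ?_
  rfl

/-- The first fifteen elements of `gb` generate the others. -/
lemma gbAt_eq_zero (q : Fin 4 → R) (l : R) (x : Coord → R)
    (h : ∀ k : Fin 20, k < 15 → gbAt q l x k = 0) (k : Fin 20) : gbAt q l x k = 0 := by
  have h4 := h 4 (by decide)
  have h5 := h 5 (by decide)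
  have h6 := h 6 (by decide)
  have h7 := h 7 (by decide)
  have h8 := h 8 (by decide)
  have h11 := h 11 (by decide)
  have h12 := h 12 (by decide)
  have h14 := h 14 (by decide)
  have h0 := h 0 (by decide)
  have h1 := h 1 (by decide)
  have h2' := h 2 (by decide)
  -- Elements 15 to 18 are the remainders of the S-polynomials of the pairs (4, 8), (4, 7), (4, 6),
  -- (4, 5), and element 19 is that of the pair (8, 14).
  have h15 : gbAt q l x 15 = 0 := by
    simp only [gbAt, gb, Matrix.cons_val] at *
    linear_combination x .p43 * h5 + x .p41 * h7 + x .p431 * h4 - x .p31 * h8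
  have h16 : gbAt q l x 16 = 0 := by
    simp only [gbAt, gb, Matrix.cons_val] at *
    linear_combination x .p43 * h6 + x .p32 * h8 + x .p432 * h4 - x .p42 * h7
  have h17 : gbAt q l x 17 = 0 := by
    simp only [gbAt, gb, Matrix.cons_val] at *
    linear_combination x .p21 * h7 + x .p32 * h5 + x .p321 * h4 - x .p31 * h6
  have h18 : gbAt q l x 18 = 0 := by
    simp only [gbAt, gb, Matrix.cons_val] at *
    linear_combination x .p21 * h8 + x .p41 * h6 + x .p421 * h4 - x .p42 * h5
  have h19 : gbAt q l x 19 = 0 := by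
    simp only [gbAt, gb, Matrix.cons_val] at *
    linear_combination x .p321 * h8 - x .p42 * h14 + l * h4 - x .p43 * h11 - x .p41 * h12 +
      q 2 * h2' + q 0 * h0 + q 1 * h1
  by_cases hk : k < 15
  · exact h k hk
  · fin_cases k <;> first | exact absurd (by decide) hk | assumption

/-- In the centred coordinates the relations `rel` are equivalent to the relations `gb`. -/
lemma relAt_uncenter_eq_zero_iff (h2 : IsUnit (2 : R)) (h : Fin 4 → R) (m : R) (x : Coord → R) :
    (∀ k, relAt (fun i => 2 * h i) (2 * m) (uncenter h x) k = 0) ↔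
      ∀ k, centeredGb h m x k = 0 := by
  set G := centeredGb h m x with hG
  rw [relAt_uncenter h m x G hG]
  constructor
  · intro H
    have h4 {y : R} (hy : 4 * y = 0) : y = 0 := by
      rw [show (4 : R) = 2 * 2 by norm_num, mul_assoc] at hy
      exact h2.mul_right_eq_zero.1 (h2.mul_right_eq_zero.1 hy)
    have H0 := H 0
    have H1 := H 1
    have H2 := H 2
    have H3 := H 3
    have H4 := H 4
    have H5 := H 5
    have H6 := H 6
    have H7 := H 7
    have H8 := H 8
    have H9 := H 9
    have H10 := H 10
    have H11 := H 11
    have H12 := H 12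
    have H13 := H 13
    have H14 := H 14
    simp only [Matrix.cons_val] at H0 H1 H2 H3 H4 H5 H6 H7 H8 H9 H10 H11 H12 H13 H14
    -- The triangular system is solved in three layers: `G 4`, then `G 5` to `G 8`, then the rest.
    have g4 : G 4 = 0 := h4 (by linear_combination -H4)
    simp only [g4, mul_zero, add_zero, sub_zero] at H0 H1 H2 H3 H5 H6 H7 H8 H9 H10 H11 H12 H13 H14
    have g5 : G 5 = 0 := h4 (by linear_combination -H5)
    have g6 : G 6 = 0 := h4 (by linear_combination H10)
    have g7 : G 7 = 0 := h4 (by linear_combination H9)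
    have g8 : G 8 = 0 := h4 (by linear_combination -H7)
    simp only [g5, g6, g7, g8, mul_zero, add_zero, sub_zero] at H6 H8 H11 H12 H13 H14
    refine gbAt_eq_zero _ _ _ fun k hk => ?_
    change centeredGb h m x k = 0
    rw [← hG]
    apply h4
    have h9 : 4 * G 9 = 0 := by linear_combination -H8
    have h10 : 4 * G 10 = 0 := by linear_combination H13
    have h11 : 4 * G 11 = 0 := by linear_combination -H14
    have h12 : 4 * G 12 = 0 := by linear_combination -H6
    have h13 : 4 * G 13 = 0 := by linear_combination H12
    have h14 : 4 * G 14 = 0 := by linear_combination -H11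
    clear_value G
    fin_cases k <;> first | exact absurd hk (by decide) | assumption |
      (convert mul_zero (4 : R); assumption)
  · intro H k
    simp only [H, mul_zero, add_zero, sub_zero]
    fin_cases k <;> rfl

end Coordinates
end Garnier

/-! ### Transfer to the original ideal -/

namespace Garnier

section Center

variable {R S F : Type} [CommRing R] [CommRing S] [FunLike F R S] [RingHomClass F R S]

/-- The inverse of `uncenter`, where `k` is an inverse of `2`. -/
def center (k : R) (h : Fin 4 → R) (y : Coord → R) : Coord → R
  | .p21 => k * y .p21 - h 1 * h 0
  | .p31 => k * y .p31 - h 2 * h 0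
  | .p32 => k * y .p32 - h 2 * h 1
  | .p41 => k * y .p41 - h 3 * h 0
  | .p42 => k * y .p42 - h 3 * h 1
  | .p43 => k * y .p43 - h 3 * h 2
  | .p321 => k * (h 2 * y .p21 + h 1 * y .p31 + h 0 * y .p32 - y .p321) - 2 * (h 2 * h 1 * h 0)
  | .p432 => k * (y .p432 - h 3 * y .p32 - h 2 * y .p42 - h 1 * y .p43) + 2 * (h 3 * h 2 * h 1)
  | .p431 => k * (h 3 * y .p31 + h 2 * y .p41 + h 0 * y .p43 - y .p431) - 2 * (h 3 * h 2 * h 0)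
  | .p421 => k * (y .p421 - h 3 * y .p21 - h 1 * y .p41 - h 0 * y .p42) + 2 * (h 3 * h 1 * h 0)

lemma uncenter_center {k : R} (hk : 2 * k = 1) (h : Fin 4 → R) (y : Coord → R) :
    uncenter h (center k h y) = y := by
  funext c
  cases c <;> simp only [uncenter, center]
  · linear_combination y .p21 * hk
  · linear_combination y .p31 * hk
  · linear_combination y .p32 * hk
  · linear_combination y .p41 * hk
  · linear_combination y .p42 * hk
  · linear_combination y .p43 * hk
  · linear_combination y .p321 * hk
  · linear_combination y .p432 * hk
  · linear_combination y .p431 * hk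
  · linear_combination y .p421 * hk

lemma center_uncenter {k : R} (hk : 2 * k = 1) (h : Fin 4 → R) (x : Coord → R) :
    center k h (uncenter h x) = x := by
  funext c
  cases c <;> simp only [uncenter, center]
  · linear_combination (h 1 * h 0 + x .p21) * hk
  · linear_combination (h 2 * h 0 + x .p31) * hk
  · linear_combination (h 2 * h 1 + x .p32) * hk
  · linear_combination (h 3 * h 0 + x .p41) * hk
  · linear_combination (h 3 * h 1 + x .p42) * hk
  · linear_combination (h 3 * h 2 + x .p43) * hk
  · linear_combination (2 * (h 2 * h 1 * h 0) + x .p321) * hk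
  · linear_combination (x .p432 - 2 * (h 3 * h 2 * h 1)) * hk
  · linear_combination (2 * (h 3 * h 2 * h 0) + x .p431) * hk
  · linear_combination (x .p421 - 2 * (h 3 * h 1 * h 0)) * hk

lemma map_uncenter (φ : F) (h : Fin 4 → R) (x : Coord → R) :
    φ ∘ uncenter h x = uncenter (φ ∘ h) (φ ∘ x) := by
  funext c
  cases c <;> simp [uncenter, map_ofNat]

lemma map_center (φ : F) (k : R) (h : Fin 4 → R) (y : Coord → R) :
    φ ∘ center k h y = center (φ k) (φ ∘ h) (φ ∘ y) := by
  funext c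
  cases c <;> simp [center, map_ofNat]

end Center

/-- The automorphism of the polynomial ring given by `uncenter`. -/
noncomputable def uncenterEquiv (h : Fin 4 → ℂ) :
    MvPolynomial Coord ℂ ≃ₐ[ℂ] MvPolynomial Coord ℂ :=
  have hk : 2 * C (1 / 2) = (1 : MvPolynomial Coord ℂ) := by
    rw [← map_ofNat C 2, ← C_mul]; norm_num
  have hC (φ : MvPolynomial Coord ℂ →ₐ[ℂ] MvPolynomial Coord ℂ) : φ ∘ (C ∘ h) = C ∘ h := by
    funext i; simp
  have hX (y : Coord → MvPolynomial Coord ℂ) : aeval (R := ℂ) y ∘ X = y := by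
    funext i; simp
  AlgEquiv.ofAlgHom (aeval (uncenter (C ∘ h) X)) (aeval (center (C (1 / 2)) (C ∘ h) X))
    (by
      refine algHom_ext fun c => ?_
      rw [AlgHom.comp_apply, aeval_X, ← Function.comp_apply (f := aeval _), map_center, hC, hX,
        algHom_C, algebraMap_eq, center_uncenter hk, AlgHom.id_apply])
    (by
      refine algHom_ext fun c => ?_
      rw [AlgHom.comp_apply, aeval_X, ← Function.comp_apply (f := aeval _), map_uncenter, hC, hX,
        uncenter_center hk, AlgHom.id_apply])

@[simp] lemma uncenterEquiv_C (h : Fin 4 → ℂ) (a : ℂ) : uncenterEquiv h (C a) = C a :=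
  (uncenterEquiv h).commutes a

@[simp] lemma uncenterEquiv_X (h : Fin 4 → ℂ) (c : Coord) :
    uncenterEquiv h (X c) = uncenter (C ∘ h) X c :=
  aeval_X _ _

/-- Reduces an equality of ideals to an equivalence of two vanishing conditions modulo an arbitrary
ideal `J`. -/
lemma span_range_eq_of_forall {R ι κ : Type*} [CommRing R] {a : ι → R} {b : κ → R}
    (h : ∀ J : Ideal R, (∀ i, a i ∈ J) ↔ ∀ k, b k ∈ J) :
    Ideal.span (Set.range a) = Ideal.span (Set.range b) := by
  apply le_antisymm <;> rw [Ideal.span_le, Set.range_subset_iff]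
  · exact (h _).2 fun k => Ideal.subset_span ⟨k, rfl⟩
  · exact (h _).1 fun k => Ideal.subset_span ⟨k, rfl⟩

/-- Modulo any ideal `J` the two families of generators vanish simultaneously:
`relAt_uncenter_eq_zero_iff` holds over every ring in which 2 is a unit, in particular over the
quotient by `J`. -/
lemma map_uncenterEquiv_relIdeal (h : Fin 4 → ℂ) (m : ℂ) :
    (relIdeal (fun i => 2 * h i) (2 * m)).map (uncenterEquiv h) =
      gbIdeal (fun i => h i ^ 2 - 1) (pfaffian (C ∘ h) (C m) X) := by
  rw [relIdeal, Ideal.map_span, ← Set.range_comp, gbIdeal]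
  apply span_range_eq_of_forall
  intro J
  have h2 : IsUnit (2 : MvPolynomial Coord ℂ ⧸ J) := by
    have := (isUnit_iff_ne_zero.2 (two_ne_zero (α := ℂ))).map
      (algebraMap ℂ (MvPolynomial Coord ℂ ⧸ J))
    rwa [map_ofNat] at this
  have key := relAt_uncenter_eq_zero_iff h2 (Ideal.Quotient.mk J ∘ C ∘ h)
    (Ideal.Quotient.mk J (C m)) (Ideal.Quotient.mk J ∘ X)
  have e1 : (uncenterEquiv h) ∘ f (fun i => 2 * h i) (2 * m) =
      relAt (fun i => 2 * C (h i)) (2 * C m) (uncenter (C ∘ h) X) := by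
    change _ ∘ relAt (fun i => C (2 * h i)) (C (2 * m)) X = _
    rw [map_relAt]
    congr 1
    · funext i
      rw [Function.comp_apply, uncenterEquiv_C, C_mul]
      exact congrArg (· * _) (map_ofNat C 2)
    · rw [uncenterEquiv_C, C_mul]
      exact congrArg (· * _) (map_ofNat C 2)
    · funext c; simp
  have e2 : gbAt (fun i => C (h i ^ 2 - 1)) (pfaffian (C ∘ h) (C m) X) X =
      centeredGb (C ∘ h) (C m) (X : Coord → MvPolynomial Coord ℂ) := by
    simp only [centeredGb, C_sub, C_pow, C_1, Function.comp_apply]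
  rw [e1, e2]
  simp only [← Ideal.Quotient.eq_zero_iff_mem]
  rw [← map_centeredGb, ← map_uncenter] at key
  refine Iff.trans (forall_congr' fun i => ?_) key
  rw [← Function.comp_apply (f := Ideal.Quotient.mk J), map_relAt]
  simp only [Function.comp_def, map_mul, map_ofNat]

open WeightedGroebner in
lemma pfaffian_mem_below (h : Fin 4 → ℂ) (m : ℂ) :
    pfaffian (C ∘ h) (C m) X ∈ below wt ℂ 14 := by
  have hX (a : ℂ) (c : Coord) : C a * X c ∈ below wt ℂ 14 :=
    mul_mem_below (m := 0) (C_mem_below (w := wt) a one_pos)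
      (X_mem_below (w := wt) (n := 14) (i := c) (by cases c <;> decide))
  have hC (a : ℂ) : C a ∈ below wt ℂ 14 := C_mem_below a (by norm_num)
  have e : pfaffian (C ∘ h) (C m) X = C (h 0 * h 1 * h 2 * h 3) + C (h 0 * h 1) * X .p43 +
      C (h 2 * h 3) * X .p21 + C (h 0 * h 3) * X .p32 + C (h 1 * h 2) * X .p41 +
      C (h 0 * h 2) * X .p42 + C (h 1 * h 3) * X .p31 - C (h 3) * X .p321 + C (h 0) * X .p432 -
      C (h 1) * X .p431 + C (h 2) * X .p421 - C m := by
    simp [pfaffian]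
  rw [e]
  exact sub_mem (add_mem (sub_mem (add_mem (sub_mem (add_mem (add_mem (add_mem (add_mem (add_mem
    (add_mem (hC _) (hX _ _)) (hX _ _)) (hX _ _)) (hX _ _)) (hX _ _)) (hX _ _)) (hX _ _)) (hX _ _))
    (hX _ _)) (hX _ _)) (hC _)

lemma relIdeal_eq_comap (p : Fin 4 → ℂ) (pinf : ℂ) : relIdeal p pinf =
    (gbIdeal (fun i => (p i / 2) ^ 2 - 1) (pfaffian (C ∘ fun i => p i / 2) (C (pinf / 2)) X)).comap
      (uncenterEquiv fun i => p i / 2) := by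
  rw [← map_uncenterEquiv_relIdeal]
  have h1 : (fun i => 2 * (p i / 2)) = p := by funext i; ring
  have h2 : 2 * (pinf / 2) = pinf := by ring
  rw [h1, h2]
  exact (Ideal.comap_map_of_bijective _ (uncenterEquiv fun i => p i / 2).bijective).symm

lemma relIdeal_isRadical (p : Fin 4 → ℂ) (pinf : ℂ) : (relIdeal p pinf).IsRadical := by
  rw [relIdeal_eq_comap]
  exact (gbIdeal_isRadical (pfaffian_mem_below _ _)).comap _

lemma ringKrullDim_coordRing (p : Fin 4 → ℂ) (pinf : ℂ) :
    ringKrullDim (CoordRing p pinf) = 4 := by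
  rw [← ringKrullDim_gbIdeal (q := fun i => (p i / 2) ^ 2 - 1)
    (pfaffian_mem_below (fun i => p i / 2) (pinf / 2))]
  refine ringKrullDim_eq_of_ringEquiv
    (Ideal.quotientEquiv _ _ (uncenterEquiv fun i => p i / 2).toRingEquiv ?_)
  rw [relIdeal_eq_comap]
  exact (Ideal.map_comap_of_surjective _
    (uncenterEquiv fun i => p i / 2).toRingEquiv.surjective _).symm

/-- There are fifteen polynomials, and the transcendence degree is ten. -/
lemma not_algebraicIndependent_f (p : Fin 4 → ℂ) (pinf : ℂ) :
    ¬ AlgebraicIndependent ℂ (f p pinf) := by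
  intro h
  have := h.cardinalMk_le_trdeg
  rw [MvPolynomial.trdeg_of_isDomain] at this
  have hc : Fintype.card Coord = 10 := rfl
  simp only [Cardinal.mk_fintype, hc, Fintype.card_fin, Cardinal.lift_natCast,
    Nat.cast_le] at this
  exact absurd this (by norm_num)

end Garnier

namespace Garnier

/-! ### Trace coordinates of quadruples -/

section Vectors

variable (u v w : Fin 4 → ℂ)

/-- Half the trace of `X_i X_j`, where `X_i = !![u i, v i; w i, -u i]`. -/
noncomputable def dot (i j : Fin 4) : ℂ := u i * u j + (v i * w j + w i * v j) / 2

/-- Half the trace of `X_i X_j X_k`, where `X_i = !![u i, v i; w i, -u i]`. -/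
noncomputable def triple (i j k : Fin 4) : ℂ :=
  (u i * (v j * w k - w j * v k) + v i * (w j * u k - u j * w k) +
    w i * (u j * v k - v j * u k)) / 2

/-- The centred coordinates of four traceless matrices. -/
noncomputable def vecCoords : Coord → ℂ
  | .p21 => dot u v w 1 0
  | .p31 => dot u v w 2 0
  | .p32 => dot u v w 2 1
  | .p41 => dot u v w 3 0
  | .p42 => dot u v w 3 1
  | .p43 => dot u v w 3 2
  | .p321 => -triple u v w 2 1 0
  | .p432 => triple u v w 3 2 1
  | .p431 => -triple u v w 3 2 0
  | .p421 => triple u v w 3 1 0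

/-- For actual vectors the relations are polynomial identities in `u`, `v`, `w`. The hypothesis on
`l` is exactly relation 4, and the last five relations follow from the others. -/
lemma gbAt_vecCoords {l : ℂ} (hl : l = dot u v w 2 0 * dot u v w 3 1 -
    dot u v w 2 1 * dot u v w 3 0 - dot u v w 1 0 * dot u v w 3 2) (k : Fin 20) :
    gbAt (fun i => u i ^ 2 + v i * w i) l (vecCoords u v w) k = 0 := by
  subst hl
  refine gbAt_eq_zero _ _ _ (fun k hk => ?_) k
  fin_cases k
  all_goals first
    | exact absurd hk (by decide)
    | simp only [gbAt, gb, vecCoords, dot, triple, Fin.reduceFinMk, Matrix.cons_val]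
      ring

end Vectors

/-- The quadruple of matrices `!![h i + u i, v i; w i, h i - u i]`. -/
def mkQuad (h u v w : Fin 4 → ℂ) (H : ∀ i, u i ^ 2 + v i * w i = h i ^ 2 - 1) : Quad :=
  fun i => ⟨!![h i + u i, v i; w i, h i - u i], by
    rw [Matrix.det_fin_two_of]; linear_combination -H i⟩

lemma exists_eq_mkQuad (M : Quad) : ∃ h u v w H, M = mkQuad h u v w H := by
  refine ⟨fun i => (M i 0 0 + M i 1 1) / 2, fun i => (M i 0 0 - M i 1 1) / 2, fun i => M i 0 1,
    fun i => M i 1 0, fun i => ?_, ?_⟩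
  · have := (M i).det_coe
    rw [Matrix.det_fin_two] at this
    linear_combination -this
  · funext i
    ext a b
    fin_cases a <;> fin_cases b <;> simp [mkQuad] <;> ring

section

variable {h u v w : Fin 4 → ℂ} (H : ∀ i, u i ^ 2 + v i * w i = h i ^ 2 - 1)

lemma coe_mkQuad (i : Fin 4) : (mkQuad h u v w H i : Matrix (Fin 2) (Fin 2) ℂ) =
    !![h i + u i, v i; w i, h i - u i] := rfl

lemma tr_mkQuad (i : Fin 4) : tr (mkQuad h u v w H i) = 2 * h i := by
  simp [tr, coe_mkQuad, Matrix.trace_fin_two]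
  ring

lemma traces_mkQuad : traces (mkQuad h u v w H) = uncenter h (vecCoords u v w) := by
  funext c
  cases c <;> simp [traces, tr, coe_mkQuad, Matrix.trace_fin_two, uncenter, vecCoords, dot,
    triple] <;> ring

/-- Expanding the product of the `h i + X_i`, the only term not linear in the coordinates is the
trace of the product of the four `X_i`, which contributes the bracket. Prescribing the trace as `2 *
m` is thus relation 4 with `l = pfaffian h m`. -/
lemma tr_prod_mkQuad : tr (mkQuad h u v w H 3 * mkQuad h u v w H 2 * mkQuad h u v w H 1 *
    mkQuad h u v w H 0) = 2 * (pfaffian h 0 (vecCoords u v w) - (dot u v w 2 0 * dot u v w 3 1 -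
      dot u v w 2 1 * dot u v w 3 0 - dot u v w 1 0 * dot u v w 3 2)) := by
  simp [tr, coe_mkQuad, Matrix.trace_fin_two, pfaffian, vecCoords,
    dot, triple]
  ring

end

lemma mem_points_iff {p : Fin 4 → ℂ} {pinf : ℂ} {y : Coord → ℂ} :
    y ∈ zeroLocus ℂ (relIdeal p pinf) ↔ ∀ k, relAt p pinf y k = 0 := by
  have e : (fun k => aeval y (f p pinf k)) = relAt p pinf y := by
    change aeval y ∘ relAt (fun i => C (p i)) (C pinf) X = _
    rw [map_relAt]
    congr 1
    · funext i; simp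
    · simp
    · funext c; simp
  rw [relIdeal, zeroLocus_span, ← e]
  simp

/-- The traces of a quadruple satisfy the relations. -/
lemma traces_mem_points (M : Quad) {p : Fin 4 → ℂ} {pinf : ℂ} (hp : ∀ i, tr (M i) = p i)
    (hinf : tr (M 3 * M 2 * M 1 * M 0) = pinf) : traces M ∈ zeroLocus ℂ (relIdeal p pinf) := by
  obtain ⟨h, u, v, w, H, rfl⟩ := exists_eq_mkQuad M
  rw [mem_points_iff, traces_mkQuad]
  obtain rfl : (fun i => 2 * h i) = p := by
    funext i; rw [← hp, tr_mkQuad]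
  obtain ⟨m, rfl⟩ : ∃ m, pinf = 2 * m := ⟨pinf / 2, by ring⟩
  rw [relAt_uncenter_eq_zero_iff (isUnit_iff_ne_zero.2 two_ne_zero), centeredGb]
  rw [tr_prod_mkQuad] at hinf
  have := gbAt_vecCoords u v w (l := pfaffian h m (vecCoords u v w)) (by
    have e : pfaffian h m (vecCoords u v w) = pfaffian h 0 (vecCoords u v w) - m := by
      simp only [pfaffian]; ring
    linear_combination e + hinf / 2)
  simpa only [H] using this

end Garnier

/-! ### Vectors with prescribed inner and triple products -/

namespace Garnier

/-- A degenerate complex quadratic form in `n + 1` variables is a sum of `n` squares of linear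
forms. -/
lemma exists_transpose_mul_self {n : ℕ} (G : Matrix (Fin (n + 1)) (Fin (n + 1)) ℂ) (hG : Gᵀ = G)
    (hdet : G.det = 0) : ∃ V : Matrix (Fin n) (Fin (n + 1)) ℂ, Vᵀ * V = G := by
  set B := Matrix.toBilin' G with hB
  have hs : LinearMap.IsSymm B := ⟨fun x y => by
    simp only [hB, Matrix.toBilin'_apply', RingHom.id_apply]
    rw [dotProduct_comm, ← dotProduct_transpose_mulVec, hG, dotProduct_comm]⟩
  obtain ⟨v, hv⟩ := LinearMap.BilinForm.exists_orthogonal_basis hs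
  have hfin : Module.finrank ℂ (Fin (n + 1) → ℂ) = n + 1 := by simp
  set c := v.reindex (finCongr hfin) with hc
  set Q := c.toMatrix (Pi.basisFun ℂ (Fin (n + 1))) with hQ
  set d : Fin (n + 1) → ℂ := fun i => B (c i) (c i) with hd
  have hD : LinearMap.BilinForm.toMatrix c B = Matrix.diagonal d := by
    ext i j
    rw [LinearMap.BilinForm.toMatrix_apply]
    by_cases hij : i = j
    · subst hij; simp [hd]
    · rw [Matrix.diagonal_apply_ne _ hij, hc, Module.Basis.reindex_apply, Module.Basis.reindex_apply]
      exact hv (by simpa using hij)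
  have key : Qᵀ * Matrix.diagonal d * Q = G := by
    rw [← hD, LinearMap.BilinForm.toMatrix_mul_basis_toMatrix c (Pi.basisFun ℂ (Fin (n + 1))) B,
      LinearMap.BilinForm.toMatrix_basisFun, hB, LinearMap.BilinForm.toMatrix'_toBilin']
  have hQ0 : Q.det ≠ 0 := by
    have := c.toMatrix_mul_toMatrix_flip (Pi.basisFun ℂ (Fin (n + 1)))
    have h2 := congr_arg Matrix.det this
    rw [Matrix.det_mul, Matrix.det_one] at h2
    exact left_ne_zero_of_mul_eq_one h2
  -- A vanishing determinant forces a zero diagonal entry in an orthogonal basis; dropping that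
  -- index leaves `n` squares.
  obtain ⟨i, -, hi⟩ : ∃ i ∈ Finset.univ, d i = 0 := by
    rw [← Finset.prod_eq_zero_iff]
    have := congr_arg Matrix.det key
    rw [hdet, Matrix.det_mul, Matrix.det_mul, Matrix.det_transpose, Matrix.det_diagonal] at this
    simpa [hQ0] using this
  choose r hr using fun j => IsAlgClosed.exists_pow_nat_eq (d j) two_pos
  refine ⟨Matrix.of fun j k => r (i.succAbove j) * Q (i.succAbove j) k, ?_⟩
  rw [← key]
  ext a b
  rw [Matrix.mul_apply, Matrix.mul_apply, Fin.sum_univ_succAbove _ i, Matrix.mul_diagonal, hi,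
    mul_zero, zero_mul, zero_add]
  refine Finset.sum_congr rfl fun j _ => ?_
  rw [Matrix.mul_diagonal, ← hr]
  simp only [Matrix.transpose_apply, Matrix.of_apply]
  ring

lemma eq_or_eq_neg_of_mul_eq_mul {ι K : Type*} [Field K] {s t : ι → K}
    (h : ∀ i j, s i * s j = t i * t j) : s = t ∨ s = -t := by
  by_cases h0 : ∀ i, s i = 0
  · left
    funext i
    have := h i i
    rw [h0, zero_mul, eq_comm, mul_self_eq_zero] at this
    rw [h0, this]
  · push Not at h0
    obtain ⟨i, hi⟩ := h0
    rcases mul_self_eq_mul_self_iff.1 (h i i) with e | e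
    · left; funext j
      exact mul_left_cancel₀ hi (by rw [h, e])
    · right; funext j
      exact mul_left_cancel₀ hi (by rw [h, Pi.neg_apply, e]; ring)

/-- The matrix of inner products. -/
def gramMatrix (q : Fin 4 → ℂ) (x : Coord → ℂ) : Matrix (Fin 4) (Fin 4) ℂ :=
  !![q 0, x .p21, x .p31, x .p41;
     x .p21, q 1, x .p32, x .p42;
     x .p31, x .p32, q 2, x .p43;
     x .p41, x .p42, x .p43, q 3]

/-- Expand along the first row. By relations 0, 9, 13 and 12 its cofactors are `-s1 s_j`, so the
determinant is `-s1` times the left side of relation 5. -/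
lemma det_gramMatrix {q : Fin 4 → ℂ} {l : ℂ} {x : Coord → ℂ} (h : ∀ k, gbAt q l x k = 0) :
    (gramMatrix q x).det = 0 := by
  have h0 := h 0
  have h4 := h 4
  have h5 := h 5
  have h9 := h 9
  have h12 := h 12
  have h13 := h 13
  simp only [gbAt, gb, Matrix.cons_val] at h0 h4 h5 h9 h12 h13
  obtain rfl : l = x .p31 * x .p42 - x .p32 * x .p41 - x .p21 * x .p43 := by
    linear_combination -h4
  simp [gramMatrix, Matrix.det_succ_row_zero, Fin.sum_univ_succ, Fin.succAbove]
  linear_combination q 0 * h0 + x .p21 * h9 + x .p31 * h13 + x .p41 * h12 - x .p432 * h5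

/-- The signed triple products. -/
def signedTriples (x : Coord → ℂ) : Fin 4 → ℂ := ![x .p432, x .p431, x .p421, x .p321]

/-- Relations 0–3 and 9–14 express each product `s_i s_j` by inner products and `l`. Hence the Gram
matrix and `l` fix the triple products up to a common sign. -/
lemma signedTriples_mul {q : Fin 4 → ℂ} {l : ℂ} {x y : Coord → ℂ} (hx : ∀ k, gbAt q l x k = 0)
    (hy : ∀ k, gbAt q l y k = 0) (h : gramMatrix q x = gramMatrix q y) (i j : Fin 4) :
    signedTriples x i * signedTriples x j = signedTriples y i * signedTriples y j := by
  have e21 : x .p21 = y .p21 := congr_fun₂ h 0 1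
  have e31 : x .p31 = y .p31 := congr_fun₂ h 0 2
  have e41 : x .p41 = y .p41 := congr_fun₂ h 0 3
  have e32 : x .p32 = y .p32 := congr_fun₂ h 1 2
  have e42 : x .p42 = y .p42 := congr_fun₂ h 1 3
  have e43 : x .p43 = y .p43 := congr_fun₂ h 2 3
  have H (k : Fin 20) : gbAt q l x k = gbAt q l y k := by rw [hx, hy]
  have h0 := H 0
  have h1 := H 1
  have h2 := H 2
  have h3 := H 3
  have h9 := H 9
  have h10 := H 10
  have h11 := H 11
  have h12 := H 12
  have h13 := H 13
  have h14 := H 14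
  simp only [gbAt, gb, Matrix.cons_val, e21, e31, e41, e32, e42, e43]
    at h0 h1 h2 h3 h9 h10 h11 h12 h13 h14
  fin_cases i <;> fin_cases j <;>
    simp only [signedTriples, Fin.reduceFinMk, Matrix.cons_val]
  · linear_combination h0
  · linear_combination h9
  · linear_combination h13
  · linear_combination h12
  · linear_combination h9
  · linear_combination h1
  · linear_combination h10
  · linear_combination h14
  · linear_combination h13
  · linear_combination h10
  · linear_combination h2
  · linear_combination h11
  · linear_combination h12
  · linear_combination h14
  · linear_combination h11
  · linear_combination h3

/-- The relations `gb` characterize the coordinates of quadruples of vectors. -/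
lemma exists_vecCoords_eq {q : Fin 4 → ℂ} {l : ℂ} {x : Coord → ℂ} (h : ∀ k, gbAt q l x k = 0) :
    ∃ u v w, vecCoords u v w = x ∧ ∀ i, u i ^ 2 + v i * w i = q i := by
  obtain ⟨V, hV⟩ := exists_transpose_mul_self (gramMatrix q x)
    (by ext i j; fin_cases i <;> fin_cases j <;> rfl) (det_gramMatrix h)
  -- The columns of `V` are vectors for the sum of three squares. Passing to isotropic coordinates
  -- in the last two turns this form into `u² + v w`.
  set u : Fin 4 → ℂ := fun j => V 0 j with hu
  set v : Fin 4 → ℂ := fun j => V 1 j + Complex.I * V 2 j with hv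
  set w : Fin 4 → ℂ := fun j => V 1 j - Complex.I * V 2 j with hw
  have hdot (i j : Fin 4) : dot u v w i j = gramMatrix q x i j := by
    rw [← hV, Matrix.mul_apply, Fin.sum_univ_three]
    simp only [dot, hu, hv, hw, Matrix.transpose_apply]
    linear_combination -(V 2 i * V 2 j) * Complex.I_mul_I
  have hq (i : Fin 4) : u i ^ 2 + v i * w i = q i := by
    have : dot u v w i i = q i := by
      rw [hdot]; fin_cases i <;> rfl
    rw [← this, dot]; ring
  have hgram : gramMatrix q x = gramMatrix q (vecCoords u v w) := by
    ext i j
    fin_cases i <;> fin_cases j <;> simp [gramMatrix, vecCoords, hdot]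
  have hl : l = dot u v w 2 0 * dot u v w 3 1 - dot u v w 2 1 * dot u v w 3 0 -
      dot u v w 1 0 * dot u v w 3 2 := by
    have h4 := h 4
    simp only [gbAt, gb, Matrix.cons_val] at h4
    simp only [hdot]
    change l = x .p31 * x .p42 - x .p32 * x .p41 - x .p21 * x .p43
    linear_combination -h4
  have h' (k : Fin 20) : gbAt q l (vecCoords u v w) k = 0 := by
    rw [← funext hq]; exact gbAt_vecCoords u v w hl k
  have hne (i j : Fin 4) : dot (-u) (-v) (-w) i j = dot u v w i j := by
    simp [dot]
  have hnt (i j k : Fin 4) : triple (-u) (-v) (-w) i j k = -triple u v w i j k := by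
    simp [triple]; ring
  -- Negating all vectors preserves the inner products and reverses every triple product, so it
  -- corrects the wrong sign.
  rcases eq_or_eq_neg_of_mul_eq_mul (signedTriples_mul h h' hgram) with e | e
  · refine ⟨u, v, w, ?_, hq⟩
    funext c
    cases c
    case p321 => exact (congr_fun e 3).symm
    case p432 => exact (congr_fun e 0).symm
    case p431 => exact (congr_fun e 1).symm
    case p421 => exact (congr_fun e 2).symm
    all_goals exact hdot _ _
  · refine ⟨-u, -v, -w, ?_, fun i => by simpa using hq i⟩
    funext c
    cases c
    case p321 =>
      simp only [vecCoords, hnt]; exact (congr_fun e 3).symm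
    case p432 =>
      simp only [vecCoords, hnt]; exact (congr_fun e 0).symm
    case p431 =>
      simp only [vecCoords, hnt]; exact (congr_fun e 1).symm
    case p421 =>
      simp only [vecCoords, hnt]; exact (congr_fun e 2).symm
    all_goals exact (hne _ _).trans (hdot _ _)

/-- Every point of `𝒜` is the trace vector of a quadruple. -/
lemma exists_traces_eq {p : Fin 4 → ℂ} {pinf : ℂ} {y : Coord → ℂ}
    (hy : y ∈ zeroLocus ℂ (relIdeal p pinf)) :
    ∃ M : Quad, (∀ i, tr (M i) = p i) ∧ tr (M 3 * M 2 * M 1 * M 0) = pinf ∧ traces M = y := by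
  obtain ⟨h, rfl⟩ : ∃ h : Fin 4 → ℂ, p = fun i => 2 * h i :=
    ⟨fun i => p i / 2, by funext i; ring⟩
  obtain ⟨m, rfl⟩ : ∃ m, pinf = 2 * m := ⟨pinf / 2, by ring⟩
  obtain ⟨x, rfl⟩ : ∃ x, y = uncenter h x :=
    ⟨center (1 / 2) h y, (uncenter_center (by norm_num) h y).symm⟩
  rw [mem_points_iff, relAt_uncenter_eq_zero_iff (isUnit_iff_ne_zero.2 two_ne_zero),
    centeredGb] at hy
  obtain ⟨u, v, w, rfl, H⟩ := exists_vecCoords_eq hy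
  refine ⟨mkQuad h u v w H, tr_mkQuad H, ?_, traces_mkQuad H⟩
  rw [tr_prod_mkQuad]
  have h4 := hy 4
  simp only [gbAt, gb, Matrix.cons_val, vecCoords] at h4
  have e : pfaffian h m (vecCoords u v w) = pfaffian h 0 (vecCoords u v w) - m := by
    simp only [pfaffian]; ring
  linear_combination -2 * e - 2 * h4

end Garnier

namespace Garnier

/-! ### Normal forms of irreducible quadruples -/

/-- The determinant of `w` and `B w`. -/
def cross (B : Matrix (Fin 2) (Fin 2) ℂ) (w : Fin 2 → ℂ) : ℂ :=
  w 0 * (B *ᵥ w) 1 - w 1 * (B *ᵥ w) 0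

lemma cross_eq_zero_iff {B : Matrix (Fin 2) (Fin 2) ℂ} {w : Fin 2 → ℂ} (hw : w ≠ 0) :
    cross B w = 0 ↔ ∃ a : ℂ, B *ᵥ w = a • w := by
  constructor
  · intro h
    rw [cross, sub_eq_zero] at h
    by_cases h0 : w 0 = 0
    · have h1 : w 1 ≠ 0 := fun h1 => hw (by funext i; fin_cases i <;> assumption)
      refine ⟨(B *ᵥ w) 1 / w 1, ?_⟩
      have h2 : (B *ᵥ w) 0 = 0 := by simpa [h0, h1] using h
      funext i
      fin_cases i
      · simp [h2, h0]
      · simp [h1]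
    · refine ⟨(B *ᵥ w) 0 / w 0, ?_⟩
      funext i
      fin_cases i
      · simp [h0]
      · simp only [Fin.mk_one, Pi.smul_apply, smul_eq_mul]
        field_simp
        linear_combination h
  · rintro ⟨a, ha⟩
    rw [cross, ha, Pi.smul_apply, Pi.smul_apply]
    simp only [smul_eq_mul]
    ring

lemma coe_mul_mulVec (g g' : SpecialLinearGroup (Fin 2) ℂ) (w : Fin 2 → ℂ) :
    ((g * g' : SpecialLinearGroup (Fin 2) ℂ) : Matrix (Fin 2) (Fin 2) ℂ) *ᵥ w =
      (g : Matrix (Fin 2) (Fin 2) ℂ) *ᵥ ((g' : Matrix (Fin 2) (Fin 2) ℂ) *ᵥ w) :=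
  (Matrix.mulVec_mulVec _ _ _).symm

/-- A quadruple is irreducible iff it has no common eigenvector. -/
lemma isIrred_iff (M : Quad) :
    IsIrred M ↔ ∀ w : Fin 2 → ℂ, w ≠ 0 → ∃ i, cross (M i) w ≠ 0 := by
  constructor
  · intro h w hw
    by_contra! h'
    have hinv : ∀ g ∈ Subgroup.closure (Set.range M),
        ∃ a : ℂ, (g : Matrix (Fin 2) (Fin 2) ℂ) *ᵥ w = a • w := by
      intro g hg
      induction hg using Subgroup.closure_induction with
      | mem g hg =>
        obtain ⟨i, rfl⟩ := hg
        exact (cross_eq_zero_iff hw).1 (h' i)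
      | one => exact ⟨1, by simp⟩
      | mul g g' _ _ h1 h2 =>
        obtain ⟨a, ha⟩ := h1
        obtain ⟨b, hb⟩ := h2
        exact ⟨b * a, by
          rw [coe_mul_mulVec, hb, Matrix.mulVec_smul, ha, smul_smul]⟩
      | inv g _ h1 =>
        obtain ⟨a, ha⟩ := h1
        have e : ((g⁻¹ * g : SpecialLinearGroup (Fin 2) ℂ) : Matrix (Fin 2) (Fin 2) ℂ) *ᵥ w = w := by
          simp
        rw [coe_mul_mulVec, ha, Matrix.mulVec_smul] at e
        have ha0 : a ≠ 0 := by
          rintro rfl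
          rw [zero_smul] at e
          exact hw e.symm
        exact ⟨a⁻¹, by rw [eq_inv_smul_iff₀ ha0, e]⟩
    rcases h (Submodule.span ℂ {w}) (by
      intro g hg x hx
      obtain ⟨b, rfl⟩ := Submodule.mem_span_singleton.1 hx
      obtain ⟨a, ha⟩ := hinv g hg
      rw [Matrix.mulVec_smul, ha]
      exact Submodule.smul_mem _ _ (Submodule.smul_mem _ _ (Submodule.mem_span_singleton_self w)))
      with h1 | h1
    · exact hw (Submodule.span_singleton_eq_bot.1 h1)
    · have := finrank_span_singleton (K := ℂ) hw
      rw [h1, finrank_top] at this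
      simp at this
  · intro h W hW
    by_contra! hc
    obtain ⟨w, hwW, hw⟩ := Submodule.exists_mem_ne_zero_of_ne_bot hc.1
    obtain ⟨i, hi⟩ := h w hw
    apply hi
    have h1 : Module.finrank ℂ W = 1 := by
      have h2 := Submodule.finrank_lt hc.2
      have h3 := Module.finrank_pos_iff (R := ℂ) (M := W).2 (Submodule.nontrivial_iff_ne_bot.2 hc.1)
      simp at h2
      omega
    have h2 := hW (M i) (Subgroup.subset_closure ⟨i, rfl⟩) w hwW
    rw [cross_eq_zero_iff hw]
    obtain ⟨a, ha⟩ := (finrank_eq_one_iff_of_nonzero' (⟨w, hwW⟩ : W) (by simpa using hw)).1 h1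
      ⟨_, h2⟩
    exact ⟨a, (congr_arg Subtype.val ha).symm⟩

/-- The determinant of the commutator. -/
def commDet (A B : Matrix (Fin 2) (Fin 2) ℂ) : ℂ := (A * B - B * A).det

/-- Conjugation of quadruples. -/
def Conj (M N : Quad) : Prop := ∃ P : SpecialLinearGroup (Fin 2) ℂ, ∀ i, N i = P * M i * P⁻¹

lemma Conj.symm {M N : Quad} : Conj M N → Conj N M := by
  rintro ⟨P, h⟩
  exact ⟨P⁻¹, fun i => by rw [h i]; group⟩

lemma Conj.trans {M N K : Quad} : Conj M N → Conj N K → Conj M K := by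
  rintro ⟨P, h⟩ ⟨Q, k⟩
  exact ⟨Q * P, fun i => by rw [k i, h i]; group⟩

lemma tr_mul_comm (g g' : SpecialLinearGroup (Fin 2) ℂ) : tr (g * g') = tr (g' * g) :=
  Matrix.trace_mul_comm _ _

lemma tr_conj (P g : SpecialLinearGroup (Fin 2) ℂ) : tr (P * g * P⁻¹) = tr g := by
  rw [tr_mul_comm]
  group

lemma Conj.tr_eq {M N : Quad} (h : Conj M N) (i : Fin 4) : tr (N i) = tr (M i) := by
  obtain ⟨P, hP⟩ := h
  rw [hP, tr_conj]

lemma Conj.tr_prod_eq {M N : Quad} (h : Conj M N) :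
    tr (N 3 * N 2 * N 1 * N 0) = tr (M 3 * M 2 * M 1 * M 0) := by
  obtain ⟨P, hP⟩ := h
  refine Eq.trans (congr_arg tr ?_) (tr_conj P _)
  simp only [hP]
  group

lemma Conj.traces_eq {M N : Quad} (h : Conj M N) : traces N = traces M := by
  obtain ⟨P, hP⟩ := h
  funext c
  cases c <;> simp only [traces, hP] <;>
    refine Eq.trans (congr_arg tr ?_) (tr_conj P _) <;> group

lemma Conj.isIrred {M N : Quad} (h : Conj M N) (hM : IsIrred M) : IsIrred N := by
  obtain ⟨P, hP⟩ := h.symm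
  rw [isIrred_iff] at hM ⊢
  intro w hw
  have hPw : (P : Matrix (Fin 2) (Fin 2) ℂ) *ᵥ w ≠ 0 := by
    intro h0
    apply hw
    have : ((P⁻¹ * P : SpecialLinearGroup (Fin 2) ℂ) : Matrix (Fin 2) (Fin 2) ℂ) *ᵥ w = 0 := by
      rw [coe_mul_mulVec, h0, Matrix.mulVec_zero]
    simpa using this
  obtain ⟨i, hi⟩ := hM _ hPw
  refine ⟨i, fun h0 => hi ?_⟩
  rw [cross_eq_zero_iff hw] at h0
  rw [cross_eq_zero_iff hPw]
  obtain ⟨a, ha⟩ := h0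
  refine ⟨a, ?_⟩
  have e : M i * P = P * N i := by rw [hP]; group
  rw [← coe_mul_mulVec, e, coe_mul_mulVec, ha, Matrix.mulVec_smul]

lemma commDet_eq_zero_of_cross {A B : Matrix (Fin 2) (Fin 2) ℂ} {w : Fin 2 → ℂ} (hw : w ≠ 0)
    (hA : cross A w = 0) (hB : cross B w = 0) : commDet A B = 0 := by
  rw [commDet, ← Matrix.exists_mulVec_eq_zero_iff]
  refine ⟨w, hw, ?_⟩
  obtain ⟨a, ha⟩ := (cross_eq_zero_iff hw).1 hA
  obtain ⟨b, hb⟩ := (cross_eq_zero_iff hw).1 hB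
  rw [Matrix.sub_mulVec, ← Matrix.mulVec_mulVec, ← Matrix.mulVec_mulVec, ha, hb,
    Matrix.mulVec_smul, Matrix.mulVec_smul, ha, hb, smul_smul, smul_smul, mul_comm, sub_self]

lemma cross_add (A B : Matrix (Fin 2) (Fin 2) ℂ) (w : Fin 2 → ℂ) :
    cross (A + B) w = cross A w + cross B w := by
  simp only [cross, Matrix.add_mulVec, Pi.add_apply]; ring

/-- A quadruple with a pair `M_1, M_j + M_k` without common eigenvector is irreducible. -/
lemma isIrred_of_commDet {M : Quad} {j k : Fin 4}
    (h : commDet (M 0) ((M j : Matrix (Fin 2) (Fin 2) ℂ) + M k) ≠ 0) : IsIrred M := by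
  rw [isIrred_iff]
  intro w hw
  by_contra! h'
  exact h (commDet_eq_zero_of_cross hw (h' 0) (by rw [cross_add, h', h', add_zero]))

/-- A matrix with a given nonzero first column. -/
lemma exists_first_column (e : Fin 2 → ℂ) (he : e ≠ 0) :
    ∃ P : SpecialLinearGroup (Fin 2) ℂ, P 0 0 = e 0 ∧ P 1 0 = e 1 := by
  by_cases h0 : e 0 = 0
  · have h1 : e 1 ≠ 0 := fun h1 => he (by funext i; fin_cases i <;> assumption)
    exact ⟨⟨!![0, -(e 1)⁻¹; e 1, 0], by simp [Matrix.det_fin_two_of, h1]⟩, h0.symm, rfl⟩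
  · exact ⟨⟨!![e 0, 0; e 1, (e 0)⁻¹], by simp [Matrix.det_fin_two_of, h0]⟩, rfl, rfl⟩

end Garnier

/-! ### Pairs of matrices without a common eigenvector -/

namespace Garnier

/-- Makes the absence of a common eigenvector an open condition on traces and determinants. -/
lemma commDet_eq (A B : Matrix (Fin 2) (Fin 2) ℂ) : commDet A B =
    -((A * B).trace ^ 2 - A.trace * B.trace * (A * B).trace + A.trace ^ 2 * B.det +
      B.trace ^ 2 * A.det - 4 * A.det * B.det) := by
  simp only [commDet, Matrix.det_fin_two, Matrix.trace_fin_two, Matrix.sub_apply, Matrix.mul_apply,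
    Fin.sum_univ_two]
  ring

lemma det_add_fin_two (A B : Matrix (Fin 2) (Fin 2) ℂ) :
    (A + B).det = A.det + B.det + A.trace * B.trace - (A * B).trace := by
  simp only [Matrix.det_fin_two, Matrix.trace_fin_two, Matrix.add_apply, Matrix.mul_apply,
    Fin.sum_univ_two]
  ring

/-- The determinant of the commutator of `M_1` and `M_j + M_k`. -/
def pairDet (M : Quad) (j k : Fin 4) : ℂ := commDet (M 0) ((M j : Matrix (Fin 2) (Fin 2) ℂ) + M k)

lemma pairDet_eq (M : Quad) (j k : Fin 4) : pairDet M j k =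
    -((tr (M 0 * M j) + tr (M 0 * M k)) ^ 2 -
      tr (M 0) * (tr (M j) + tr (M k)) * (tr (M 0 * M j) + tr (M 0 * M k)) +
      (tr (M 0) ^ 2 - 4) * (2 + tr (M j) * tr (M k) - tr (M j * M k)) +
      (tr (M j) + tr (M k)) ^ 2) := by
  have h (i i' : Fin 4) : tr (M i * M i') =
    ((M i : Matrix (Fin 2) (Fin 2) ℂ) * (M i' : Matrix (Fin 2) (Fin 2) ℂ)).trace := rfl
  rw [pairDet, commDet_eq, det_add_fin_two, Matrix.mul_add, Matrix.trace_add, Matrix.trace_add,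
    (M j).det_coe, (M k).det_coe, (M 0).det_coe, h, h, h]
  simp only [tr]
  ring

lemma Conj.pairDet_eq {M N : Quad} (h : Conj M N) (j k : Fin 4) :
    pairDet N j k = pairDet M j k := by
  obtain ⟨P, hP⟩ := h
  have h2 (i i' : Fin 4) : tr (N i * N i') = tr (M i * M i') := by
    refine Eq.trans (congr_arg tr ?_) (tr_conj P _)
    simp only [hP]
    group
  rw [Garnier.pairDet_eq, Garnier.pairDet_eq, h2, h2, h2, hP, hP, hP, tr_conj, tr_conj, tr_conj]

lemma exists_eigenvalues (t : ℂ) : ∃ α β : ℂ, α * β = 1 ∧ α + β = t := by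
  obtain ⟨r, hr⟩ := IsAlgClosed.exists_pow_nat_eq (t ^ 2 - 4) two_pos
  exact ⟨(t + r) / 2, (t - r) / 2, by linear_combination -hr / 4, by ring⟩

lemma exists_eigenvector (g : SpecialLinearGroup (Fin 2) ℂ) {α β : ℂ} (h1 : α * β = 1)
    (h2 : α + β = tr g) :
    ∃ e : Fin 2 → ℂ, e ≠ 0 ∧ (g : Matrix (Fin 2) (Fin 2) ℂ) *ᵥ e = α • e := by
  have hdet : ((g : Matrix (Fin 2) (Fin 2) ℂ) - α • (1 : Matrix (Fin 2) (Fin 2) ℂ)).det = 0 := by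
    have := g.det_coe
    rw [tr, Matrix.trace_fin_two] at h2
    rw [Matrix.det_fin_two] at this ⊢
    simp
    linear_combination this - h1 + α * h2
  obtain ⟨e, he, h⟩ := Matrix.exists_mulVec_eq_zero_iff.2 hdet
  refine ⟨e, he, ?_⟩
  rw [Matrix.sub_mulVec, Matrix.smul_mulVec, Matrix.one_mulVec, sub_eq_zero] at h
  exact h

/-- The entries of the first column of `P⁻¹ B P`. -/
lemma inv_mul_mul_first_column (P : SpecialLinearGroup (Fin 2) ℂ)
    (B : Matrix (Fin 2) (Fin 2) ℂ) {x y : ℂ}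
    (h : ∀ i, (B *ᵥ fun i => P i 0) i = x * P i 0 + y * P i 1) :
    ((P⁻¹ : SpecialLinearGroup (Fin 2) ℂ) * B * (P : Matrix (Fin 2) (Fin 2) ℂ) :
      Matrix (Fin 2) (Fin 2) ℂ) 0 0 = x ∧
    ((P⁻¹ : SpecialLinearGroup (Fin 2) ℂ) * B * (P : Matrix (Fin 2) (Fin 2) ℂ) :
      Matrix (Fin 2) (Fin 2) ℂ) 1 0 = y := by
  have hP := P.det_coe
  rw [Matrix.det_fin_two] at hP
  have h0 := h 0
  have h1 := h 1
  simp only [Matrix.mulVec, dotProduct, Fin.sum_univ_two] at h0 h1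
  have hinv : ((P⁻¹ : SpecialLinearGroup (Fin 2) ℂ) : Matrix (Fin 2) (Fin 2) ℂ) =
      !![P 1 1, -P 0 1; -P 1 0, P 0 0] := Matrix.adjugate_fin_two _
  rw [hinv]
  simp only [Matrix.mul_apply, Fin.sum_univ_two, Matrix.of_apply, Matrix.cons_val]
  constructor
  · linear_combination P 1 1 * h0 - P 0 1 * h1 + x * hP
  · linear_combination -P 1 0 * h0 + P 0 0 * h1 + y * hP

/-- Conjugate so that `M_1` is upper triangular with diagonal `α, β`. Its eigenvectors include `(1,
0)` and `f = (s, β - α)`, and `f ≠ 0` because `M_1 ≠ ±1`. Then `pairDet` factors as `-(x_j +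
x_k)(y_j + y_k)`, where `x_j` and `y_j` measure how far `M_j` is from having `(1, 0)` and `f` as
eigenvectors. Irreducibility gives `x_j ≠ 0` and `y_k ≠ 0` for some `j, k`; one of the pairs `(j,
j)`, `(k, k)`, `(j, k)` works. Sums are needed because no single `M_j` need move both eigenvectors.
-/
lemma exists_pairDet_ne_zero {M : Quad} (hM : IsIrred M) (h1 : M 0 ≠ 1) (h2 : M 0 ≠ -1) :
    ∃ j k, pairDet M j k ≠ 0 := by
  obtain ⟨α, β, hαβ, ht⟩ := exists_eigenvalues (tr (M 0))
  obtain ⟨e, he, hMe⟩ := exists_eigenvector (M 0) hαβ ht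
  obtain ⟨P, hP0, hP1⟩ := exists_first_column e he
  set N : Quad := fun i => P⁻¹ * M i * P with hN
  have hconj : Conj M N := ⟨P⁻¹, fun i => by simp [hN]⟩
  have heP : (fun i => P i 0) = e := by funext i; fin_cases i <;> assumption
  have hcol := inv_mul_mul_first_column P (M 0) (x := α) (y := 0) (by
    rw [heP, hMe]; intro i; rw [← heP]; simp)
  set s := N 0 0 1 with hs
  have h00 : N 0 0 0 = α := hcol.1
  have h10 : N 0 1 0 = 0 := hcol.2
  have h11 : N 0 1 1 = β := by
    have := hconj.tr_eq 0
    rw [← ht, tr, Matrix.trace_fin_two, h00] at this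
    linear_combination this
  have hirr := (isIrred_iff N).1 (hconj.isIrred hM)
  have key (j k : Fin 4) : pairDet N j k = -((N j 1 0 + N k 1 0) *
      (cross (N j) ![s, β - α] + cross (N k) ![s, β - α])) := by
    simp [pairDet, commDet, Matrix.det_fin_two, Matrix.mul_apply, Fin.sum_univ_two, cross,
      Matrix.mulVec, dotProduct, h00, h10, h11, ← hs]
    ring
  have hf : ![s, β - α] ≠ 0 := by
    intro h0
    have hs0 : s = 0 := congr_fun h0 0
    have hba : β = α := sub_eq_zero.1 (congr_fun h0 1)
    rw [hba] at hαβ h11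
    have hM0 : M 0 = P * N 0 * P⁻¹ := by simp only [hN]; group
    rcases mul_self_eq_one_iff.1 hαβ with h | h
    · apply h1
      have : N 0 = 1 := by
        ext i j
        fin_cases i <;> fin_cases j <;> simp [h00, h10, h11, ← hs, hs0, h]
      rw [hM0, this]; group
    · apply h2
      have : N 0 = -1 := by
        ext i j
        fin_cases i <;> fin_cases j <;> simp [h00, h10, h11, ← hs, hs0, h]
      rw [hM0, this]
      simp
  obtain ⟨j, hj⟩ := hirr ![1, 0] (by simp)
  obtain ⟨k, hk⟩ := hirr _ hf
  replace hj : N j 1 0 ≠ 0 := by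
    simpa [cross, Matrix.mulVec, dotProduct] using hj
  by_contra! h'
  simp only [← hconj.pairDet_eq, key, neg_eq_zero] at h'
  have hjj := h' j j
  have hkk := h' k k
  have hjk := h' j k
  simp [hj, hk] at hjj hkk
  rw [hjj, hkk, add_zero, zero_add] at hjk
  exact mul_ne_zero hj hk hjk

/-- The normal form with respect to `M_1` and `M_j + M_k`. -/
lemma exists_conj_normal {M : Quad} {j k : Fin 4} (h : pairDet M j k ≠ 0) {α β : ℂ}
    (h1 : α * β = 1) (h2 : α + β = tr (M 0)) :
    ∃ N, Conj M N ∧ N 0 0 0 = α ∧ N 0 1 0 = 0 ∧ N j 0 0 + N k 0 0 = 0 ∧ N j 1 0 + N k 1 0 = 1 := by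
  obtain ⟨e, he, hMe⟩ := exists_eigenvector (M 0) h1 h2
  set B := (M j : Matrix (Fin 2) (Fin 2) ℂ) + M k with hB
  have hc : cross B e ≠ 0 := fun hc =>
    h (commDet_eq_zero_of_cross he ((cross_eq_zero_iff he).2 ⟨α, hMe⟩) hc)
  -- The new basis is `e, B e`, which is independent because `B` has no eigenvector `e`. The factor
  -- `t` normalises its determinant to one.
  obtain ⟨t, ht⟩ := IsAlgClosed.exists_pow_nat_eq (cross B e)⁻¹ two_pos
  set P : SpecialLinearGroup (Fin 2) ℂ :=
    ⟨!![t * e 0, t * (B *ᵥ e) 0; t * e 1, t * (B *ᵥ e) 1], by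
      rw [Matrix.det_fin_two_of]
      have : t ^ 2 * cross B e = 1 := by rw [ht, inv_mul_cancel₀ hc]
      rw [← this, cross]; ring⟩ with hP
  have hP0 : (fun i => P i 0) = t • e := by funext i; fin_cases i <;> rfl
  have hP1 : (fun i => P i 1) = t • (B *ᵥ e) := by funext i; fin_cases i <;> rfl
  refine ⟨fun i => P⁻¹ * M i * P, ⟨P⁻¹, fun i => by simp⟩, ?_⟩
  have e1 := inv_mul_mul_first_column P (M 0) (x := α) (y := 0) (by
    intro i
    have : P i 0 = t * e i := congr_fun hP0 i
    rw [hP0, this, Matrix.mulVec_smul, hMe]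
    simp
    ring)
  have e2 := inv_mul_mul_first_column P B (x := 0) (y := 1) (by
    intro i
    have : P i 1 = t * (B *ᵥ e) i := congr_fun hP1 i
    rw [hP0, this, Matrix.mulVec_smul]
    simp)
  rw [hB, Matrix.mul_add, Matrix.add_mul, Matrix.add_apply, Matrix.add_apply] at e2
  exact ⟨e1.1, e1.2, e2.1, e2.2⟩

end Garnier

namespace Garnier

/-! ### Polynomials in the traces -/

/-- A function of quadruples which, for fixed traces `p` of the members, is a polynomial in
the coordinates `traces`. -/
def IsTracePoly (p : Fin 4 → ℂ) (φ : Quad → ℂ) : Prop :=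
  ∃ P : MvPolynomial Coord ℂ, ∀ M : Quad, (∀ i, tr (M i) = p i) → φ M = eval (traces M) P

namespace IsTracePoly

variable {p : Fin 4 → ℂ} {φ ψ : Quad → ℂ}

lemma const (a : ℂ) : IsTracePoly p fun _ => a := ⟨C a, fun _ _ => by simp⟩

lemma coord (c : Coord) : IsTracePoly p fun M => traces M c := ⟨X c, fun _ _ => by simp⟩

lemma add (h : IsTracePoly p φ) (h' : IsTracePoly p ψ) : IsTracePoly p fun M => φ M + ψ M := by
  obtain ⟨P, hP⟩ := h
  obtain ⟨Q, hQ⟩ := h'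
  exact ⟨P + Q, fun M hM => by simp [hP M hM, hQ M hM]⟩

lemma mul (h : IsTracePoly p φ) (h' : IsTracePoly p ψ) : IsTracePoly p fun M => φ M * ψ M := by
  obtain ⟨P, hP⟩ := h
  obtain ⟨Q, hQ⟩ := h'
  exact ⟨P * Q, fun M hM => by simp [hP M hM, hQ M hM]⟩

lemma neg (h : IsTracePoly p φ) : IsTracePoly p fun M => -φ M := by
  simpa using (const (-1)).mul h

lemma sub (h : IsTracePoly p φ) (h' : IsTracePoly p ψ) : IsTracePoly p fun M => φ M - ψ M := by
  simpa [sub_eq_add_neg] using h.add h'.neg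

lemma pow (h : IsTracePoly p φ) (n : ℕ) : IsTracePoly p fun M => φ M ^ n := by
  obtain ⟨P, hP⟩ := h
  exact ⟨P ^ n, fun M hM => by simp [hP M hM]⟩

lemma congr (h : IsTracePoly p φ) (e : ∀ M, φ M = ψ M) : IsTracePoly p ψ := by
  obtain rfl : φ = ψ := funext e
  exact h

lemma tr_one (i : Fin 4) : IsTracePoly p fun M => tr (M i) :=
  ⟨C (p i), fun M hM => by simp [hM]⟩

lemma tr_two (i j : Fin 4) : IsTracePoly p fun M => tr (M i * M j) := by
  have gen (i j : Fin 4) (h : j < i) : IsTracePoly p fun M => tr (M i * M j) := by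
    fin_cases i <;> fin_cases j <;> first
      | exact absurd h (by decide)
      | exact coord .p21
      | exact coord .p31
      | exact coord .p32
      | exact coord .p41
      | exact coord .p42
      | exact coord .p43
  rcases lt_trichotomy i j with h | rfl | h
  · exact (gen j i h).congr fun M => tr_mul_comm _ _
  · refine (((tr_one i).pow 2).sub (const 2)).congr fun M => ?_
    have := (M i).det_coe
    rw [Matrix.det_fin_two] at this
    simp [tr, Matrix.trace_fin_two, Matrix.mul_apply, Fin.sum_univ_two]
    linear_combination 2 * this
  · exact gen i j h

end IsTracePoly

/-- Cayley–Hamilton: `a² = tr a • a - 1`. -/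
lemma tr_mul_mul_self (a b : SpecialLinearGroup (Fin 2) ℂ) :
    tr (a * a * b) = tr a * tr (a * b) - tr b := by
  have := a.det_coe
  rw [Matrix.det_fin_two] at this
  simp [tr, Matrix.trace_fin_two, Matrix.mul_apply, Fin.sum_univ_two]
  linear_combination -(b 0 0 + b 1 1) * this

/-- Polarised Cayley–Hamilton: the two cyclic orders of a triple product have trace sum given by
shorter traces. -/
lemma tr_mul_mul_swap (a b c : SpecialLinearGroup (Fin 2) ℂ) :
    tr (a * c * b) = -tr (a * b * c) + tr a * tr (b * c) + tr b * tr (a * c) + tr c * tr (a * b) -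
      tr a * tr b * tr c := by
  simp [tr, Matrix.trace_fin_two, Matrix.mul_apply, Fin.sum_univ_two]
  ring

lemma tr_mul_rotate (a b c : SpecialLinearGroup (Fin 2) ℂ) : tr (a * b * c) = tr (c * a * b) := by
  rw [tr_mul_comm, mul_assoc]

/-- Only strictly decreasing triples are coordinates. Rotation, the swap identity and
Cayley–Hamilton handle the other orders and the repeated indices. -/
lemma IsTracePoly.tr_three {p : Fin 4 → ℂ} (i j : Fin 4) :
    IsTracePoly p fun M => tr (M i * M 0 * M j) := by
  have gen (i j k : Fin 4) (h : k < j) (h' : j < i) :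
      IsTracePoly p fun M => tr (M i * M j * M k) := by
    fin_cases i <;> fin_cases j <;> fin_cases k <;> first
      | exact absurd h (by decide)
      | exact absurd h' (by decide)
      | exact coord .p321
      | exact coord .p421
      | exact coord .p431
      | exact coord .p432
  have two (i j : Fin 4) : IsTracePoly p fun M => tr (M i * M i * M j) :=
    (((tr_one i).mul (tr_two i j)).sub (tr_one j)).congr fun M => (tr_mul_mul_self _ _).symm
  rcases eq_or_ne i 0 with rfl | hi
  · exact two 0 j
  rcases eq_or_ne j 0 with rfl | hj
  · exact (two 0 i).congr fun M => by rw [tr_mul_rotate, tr_mul_rotate]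
  rcases lt_trichotomy i j with h | rfl | h
  · exact (gen j i 0 (Fin.pos_iff_ne_zero.2 hi) h).congr fun M => (tr_mul_rotate _ _ _).symm
  · exact (two i 0).congr fun M => (tr_mul_rotate _ _ _).symm
  · exact ((((((gen i j 0 (Fin.pos_iff_ne_zero.2 hj) h).neg).add
      ((tr_one i).mul (tr_two j 0))).add ((tr_one j).mul (tr_two i 0))).add
      ((tr_one 0).mul (tr_two i j))).sub (((tr_one i).mul (tr_one j)).mul (tr_one 0))).congr
      fun M => (tr_mul_mul_swap _ _ _).symm

/-! ### Sections of the trace map -/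

section Entries

variable (j k : Fin 4) (α β : ℂ)

/-- The trace of `M_j + M_k`. -/
noncomputable def sumTr (M : Quad) : ℂ := tr (M j) + tr (M k)

/-- The determinant of `M_j + M_k`. -/
noncomputable def sumDet (M : Quad) : ℂ := 2 + tr (M j) * tr (M k) - tr (M j * M k)

/-- The upper right entry of the first matrix in normal form. -/
noncomputable def normalUpper (M : Quad) : ℂ :=
  tr (M 0 * M j) + tr (M 0 * M k) - β * sumTr j k M

/-- The trace of `M_i M_1` minus `β` times the trace of `M_i`. -/
noncomputable def firstReduced (i : Fin 4) (M : Quad) : ℂ := tr (M i * M 0) - β * tr (M i)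

/-- The trace of `M_i M_1 (M_j + M_k)` minus `β` times the trace of `M_i (M_j + M_k)`. -/
noncomputable def secondReduced (i : Fin 4) (M : Quad) : ℂ :=
  tr (M i * M 0 * M j) + tr (M i * M 0 * M k) - β * (tr (M i * M j) + tr (M i * M k))

/-- The numerators of the entries of the normal form, whose denominator is `pairDet`. -/
noncomputable def entryNum (i : Fin 4) (M : Quad) : Fin 2 → Fin 2 → ℂ :=
  let x := firstReduced β i M * (normalUpper j k β M * sumTr j k M - (α - β) * sumDet j k M) -
    normalUpper j k β M * secondReduced j k β i M
  let z := (α - β) * secondReduced j k β i M - normalUpper j k β M * firstReduced β i M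
  ![![x, pairDet M j k * (tr (M i * M j) + tr (M i * M k)) + sumDet j k M * z -
      sumTr j k M * (pairDet M j k * tr (M i) - x)], ![z, pairDet M j k * tr (M i) - x]]

variable {j k α β}

/-- With `B = M_j + M_k`, the traces of `M_i` against `1`, `M_1`, `B` and `M_1 B` are linear in its
entries. Subtracting `β` times a trace removes the second column of `M_i` and leaves two equations
for the first column, whose determinant is `pairDet`. Cramer's rule solves them, and the remaining
two traces give the second column. -/
lemma entryNum_eq {M : Quad} (h2 : α + β = tr (M 0)) (h00 : M 0 0 0 = α)
    (h10 : M 0 1 0 = 0) (h0 : M j 0 0 + M k 0 0 = 0) (h : M j 1 0 + M k 1 0 = 1) (i : Fin 4)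
    (a b : Fin 2) : pairDet M j k * M i a b = entryNum j k α β i M a b := by
  have h11 : M 0 1 1 = β := by
    rw [tr, Matrix.trace_fin_two, h00] at h2
    linear_combination -h2
  set s := M 0 0 1 with hs
  have htr (i i' : Fin 4) : tr (M i * M i') = M i 0 0 * M i' 0 0 + M i 0 1 * M i' 1 0 +
      (M i 1 0 * M i' 0 1 + M i 1 1 * M i' 1 1) := by
    simp [tr, Matrix.trace_fin_two, Matrix.mul_apply, Fin.sum_univ_two]
  set y := M j 0 1 + M k 0 1 with hy
  set q := M j 1 1 + M k 1 1 with hq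
  have hB : ((M j : Matrix (Fin 2) (Fin 2) ℂ) + M k) = !![0, y; 1, q] := by
    ext a b
    fin_cases a <;> fin_cases b <;> simp [h0, h, hy, hq]
  have hA : (M 0 : Matrix (Fin 2) (Fin 2) ℂ) = !![α, s; 0, β] := by
    ext a b
    fin_cases a <;> fin_cases b <;> simp [h00, h10, h11, hs]
  have hsum : sumTr j k M = q := by
    simp only [sumTr, tr, Matrix.trace_fin_two]
    linear_combination h0
  have hdet : sumDet j k M = -y := by
    have := det_add_fin_two (M j) (M k)
    rw [hB, Matrix.det_fin_two_of, (M j).det_coe, (M k).det_coe] at this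
    have e : tr (M j * M k) =
      ((M j : Matrix (Fin 2) (Fin 2) ℂ) * (M k : Matrix (Fin 2) (Fin 2) ℂ)).trace := rfl
    rw [sumDet, e, tr, tr]
    linear_combination -this
  have hup : normalUpper j k β M = s := by
    rw [normalUpper, hsum, htr, htr, h00, h10, h11]
    linear_combination α * h0 + s * h
  have hD : pairDet M j k = -(s ^ 2 - (α - β) * q * s - (α - β) ^ 2 * y) := by
    rw [pairDet, hB, hA, commDet]
    simp [Matrix.det_fin_two]
    ring
  have hfirst : firstReduced β i M = (α - β) * M i 0 0 + s * M i 1 0 := by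
    rw [firstReduced, htr, h00, h10, h11, tr, Matrix.trace_fin_two]
    ring
  have ht2 : tr (M i * M j) + tr (M i * M k) = M i 0 1 + M i 1 0 * y + M i 1 1 * q := by
    rw [htr, htr]
    linear_combination M i 0 0 * h0 + M i 0 1 * h
  have ht3 : tr (M i * M 0 * M j) + tr (M i * M 0 * M k) =
      M i 0 0 * s + M i 0 1 * β + M i 1 0 * (α * y + s * q) + M i 1 1 * β * q := by
    have e (l : Fin 4) : tr (M i * M 0 * M l) = ((M i : Matrix (Fin 2) (Fin 2) ℂ) *
      (M 0 : Matrix (Fin 2) (Fin 2) ℂ) * (M l : Matrix (Fin 2) (Fin 2) ℂ)).trace := rfl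
    rw [e, e, Matrix.trace_fin_two, Matrix.trace_fin_two]
    simp only [Matrix.mul_apply, Fin.sum_univ_two, h00, h10, h11]
    linear_combination (M i 0 0 * α) * h0 + (M i 0 0 * s + M i 0 1 * β) * h +
      (M i 1 0 * α) * hy + 0 * hq
  have hsecond : secondReduced j k β i M = s * M i 0 0 + (s * q + (α - β) * y) * M i 1 0 := by
    rw [secondReduced, ht2, ht3]
    ring
  have ht : tr (M i) = M i 0 0 + M i 1 1 := Matrix.trace_fin_two _
  simp only [entryNum, hsum, hdet, hup, hD, hfirst, hsecond, ht2, ht]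
  fin_cases a <;> fin_cases b <;> simp <;> ring

open IsTracePoly

lemma isTracePoly_sumTr {p : Fin 4 → ℂ} : IsTracePoly p (sumTr j k) := (tr_one j).add (tr_one k)

lemma isTracePoly_sumDet {p : Fin 4 → ℂ} : IsTracePoly p (sumDet j k) :=
  ((const 2).add ((tr_one j).mul (tr_one k))).sub (tr_two j k)

lemma isTracePoly_normalUpper {p : Fin 4 → ℂ} : IsTracePoly p (normalUpper j k β) :=
  ((tr_two 0 j).add (tr_two 0 k)).sub ((const β).mul isTracePoly_sumTr)

lemma isTracePoly_firstReduced {p : Fin 4 → ℂ} (i : Fin 4) :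
    IsTracePoly p (firstReduced β i) :=
  (tr_two i 0).sub ((const β).mul (tr_one i))

lemma isTracePoly_secondReduced {p : Fin 4 → ℂ} (i : Fin 4) :
    IsTracePoly p (secondReduced j k β i) :=
  ((tr_three i j).add (tr_three i k)).sub ((const β).mul ((tr_two i j).add (tr_two i k)))

lemma isTracePoly_pairDet {p : Fin 4 → ℂ} (j k : Fin 4) :
    IsTracePoly p fun M => pairDet M j k := by
  have hs := (tr_two (p := p) 0 j).add (tr_two 0 k)
  have ht := (tr_one (p := p) j).add (tr_one k)
  exact ((((hs.pow 2).sub (((tr_one 0).mul ht).mul hs)).add ((((tr_one 0).pow 2).sub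
    (const 4)).mul isTracePoly_sumDet)).add (ht.pow 2)).neg.congr fun M => (pairDet_eq M j k).symm

lemma isTracePoly_entryNum {p : Fin 4 → ℂ} (i : Fin 4) (a b : Fin 2) :
    IsTracePoly p fun M => entryNum j k α β i M a b := by
  have hs : IsTracePoly p (sumTr j k) := isTracePoly_sumTr
  have hd : IsTracePoly p (sumDet j k) := isTracePoly_sumDet
  have hu : IsTracePoly p (normalUpper j k β) := isTracePoly_normalUpper
  have h1 : IsTracePoly p (firstReduced β i) := isTracePoly_firstReduced i
  have h2 : IsTracePoly p (secondReduced j k β i) := isTracePoly_secondReduced i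
  have hx := (h1.mul ((hu.mul hs).sub ((const (α - β)).mul hd))).sub (hu.mul h2)
  have hz := ((const (α - β)).mul h2).sub (hu.mul h1)
  have hw := ((isTracePoly_pairDet j k).mul (tr_one i)).sub hx
  fin_cases a <;> fin_cases b
  · exact hx
  · exact (((isTracePoly_pairDet j k).mul ((tr_two i j).add (tr_two i k))).add
      (hd.mul hz)).sub (hs.mul hw)
  · exact hz
  · exact hw

end Entries

/-- Quadruples with nonzero `pairDet` are conjugate to quadruples whose entries are rational
functions of the traces. -/
lemma exists_rational_normal_form (p : Fin 4 → ℂ) (j k : Fin 4) :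
    ∃ (D : MvPolynomial Coord ℂ) (n : Fin 4 × Fin 2 × Fin 2 → MvPolynomial Coord ℂ),
      ∀ M : Quad, (∀ i, tr (M i) = p i) → pairDet M j k = eval (traces M) D ∧
        (eval (traces M) D ≠ 0 → ∃ N, Conj M N ∧
          ∀ s, N s.1 s.2.1 s.2.2 = eval (traces M) (n s) / eval (traces M) D) := by
  obtain ⟨α, β, h1, h2⟩ := exists_eigenvalues (p 0)
  obtain ⟨D, hD⟩ := isTracePoly_pairDet (p := p) j k
  choose n hn using fun s : Fin 4 × Fin 2 × Fin 2 =>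
    isTracePoly_entryNum (p := p) (j := j) (k := k) (α := α) (β := β) s.1 s.2.1 s.2.2
  beta_reduce at hD hn
  refine ⟨D, n, fun M hM => ⟨hD M hM, fun h => ?_⟩⟩
  obtain ⟨N, hMN, hN1, hN2, hN3, hN4⟩ := exists_conj_normal ((hD M hM).trans_ne h) h1
    (h2.trans (hM 0).symm)
  refine ⟨N, hMN, fun s => ?_⟩
  have hNp (i : Fin 4) : tr (N i) = p i := (hMN.tr_eq i).trans (hM i)
  -- The formulas hold for `N`, which is in normal form; they transfer because `N` has the traces of
  -- `M`.
  rw [← hMN.traces_eq, ← hn s N hNp, ← hD N hNp, eq_div_iff, mul_comm]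
  · exact entryNum_eq (h2.trans (hNp 0).symm) hN1 hN2 hN3 hN4 s.1 s.2.1 s.2.2
  · rwa [hD N hNp, hMN.traces_eq]

/-- An irreducible quadruple with `M_1 ≠ ±1` is determined by its traces up to conjugation. -/
lemma conj_of_traces_eq {M N : Quad} (hM : IsIrred M) (h1 : M 0 ≠ 1) (h2 : M 0 ≠ -1)
    (htr : ∀ i, tr (N i) = tr (M i)) (h : traces N = traces M) : Conj M N := by
  obtain ⟨j, k, hjk⟩ := exists_pairDet_ne_zero hM h1 h2
  obtain ⟨D, n, H⟩ := exists_rational_normal_form (fun i => tr (M i)) j k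
  obtain ⟨hD, HM⟩ := H M fun _ => rfl
  obtain ⟨-, HN⟩ := H N htr
  rw [h] at HN
  rw [hD] at hjk
  obtain ⟨M', hMM', hM'⟩ := HM hjk
  obtain ⟨N', hNN', hN'⟩ := HN hjk
  obtain rfl : M' = N' := by
    funext i
    ext a b
    exact (hM' (i, a, b)).trans (hN' (i, a, b)).symm
  exact hMM'.trans hNN'.symm

end Garnier

namespace Garnier

/-! ### Quotients by fibres of maps with rational sections -/

section Varieties

variable {Y Z σ τ : Type}

/-- Principal open sets are closed under finite intersection, by multiplying the polynomials, so the
generating sets already form a basis. -/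
lemma isOpen_embedded_iff (e : Y → σ → ℂ) (V : Set Y) :
    (VarStr.embedded e).top.IsOpen V ↔
      ∀ x ∈ V, ∃ h : MvPolynomial σ ℂ, eval (e x) h ≠ 0 ∧ ∀ y, eval (e y) h ≠ 0 → y ∈ V := by
  constructor
  · intro hV
    induction hV with
    | basic V hV =>
      obtain ⟨h, rfl⟩ := hV
      exact fun x hx => ⟨h, hx, fun y hy => hy⟩
    | univ => exact fun x _ => ⟨1, by simp, fun _ _ => trivial⟩
    | inter V W _ _ h1 h2 =>
      intro x hx
      obtain ⟨g, hg, hg'⟩ := h1 x hx.1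
      obtain ⟨h, hh, hh'⟩ := h2 x hx.2
      refine ⟨g * h, by simp [hg, hh], fun y hy => ?_⟩
      rw [eval_mul, mul_ne_zero_iff] at hy
      exact ⟨hg' y hy.1, hh' y hy.2⟩
    | sUnion S _ h =>
      rintro x ⟨V, hV, hx⟩
      obtain ⟨g, hg, hg'⟩ := h V hV x hx
      exact ⟨g, hg, fun y hy => ⟨V, hV, hg' y hy⟩⟩
  · intro h
    have e : V = ⋃₀ {W | W ⊆ V ∧ ∃ h : MvPolynomial σ ℂ, W = {y | eval (e y) h ≠ 0}} := by
      ext x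
      constructor
      · intro hx
        obtain ⟨g, hg, hg'⟩ := h x hx
        exact ⟨_, ⟨hg', g, rfl⟩, hg⟩
      · rintro ⟨W, ⟨hW, -⟩, hx⟩
        exact hW hx
    rw [e]
    exact TopologicalSpace.GenerateOpen.sUnion _ fun W hW => .basic _ hW.2

lemma eval_bind₁_eq (P : τ → MvPolynomial σ ℂ) (x : σ → ℂ) (g : MvPolynomial τ ℂ) :
    eval x (bind₁ P g) = eval (fun c => eval x (P c)) g := by
  induction g using MvPolynomial.induction_on with
  | C a => simp
  | add p q hp hq => simp [hp, hq]
  | mul_X p c hp => simp [hp]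

lemma exists_clear_denominators (D : MvPolynomial τ ℂ) (n : σ → MvPolynomial τ ℂ)
    (h : MvPolynomial σ ℂ) : ∃ (H : MvPolynomial τ ℂ) (k : ℕ), ∀ y : τ → ℂ, eval y D ≠ 0 →
      eval (fun s => eval y (n s) / eval y D) h * eval y D ^ k = eval y H := by
  induction h using MvPolynomial.induction_on with
  | C a => exact ⟨C a, 0, by simp⟩
  | add p q hp hq =>
    obtain ⟨G, k, hG⟩ := hp
    obtain ⟨H, l, hH⟩ := hq
    refine ⟨G * D ^ l + H * D ^ k, k + l, fun y hy => ?_⟩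
    simp only [eval_add, eval_mul, eval_pow, ← hG y hy, ← hH y hy]
    ring
  | mul_X p s hp =>
    obtain ⟨G, k, hG⟩ := hp
    refine ⟨G * n s, k + 1, fun y hy => ?_⟩
    simp only [eval_mul, eval_X, ← hG y hy]
    field_simp
    ring

variable {e : Y → σ → ℂ} {e' : Z → τ → ℂ} {t : Y → Z} {r : Setoid Y} {F : Quotient r → Z}

/-- A polynomial map with local rational sections induces an isomorphism from the set of its fibres
to an open subvariety. -/
lemma isOpenImmersion_of_sections (P : τ → MvPolynomial σ ℂ)
    (hP : ∀ x c, e' (t x) c = eval (e x) (P c)) (hr : ∀ x y, t x = t y → r x y)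
    (hsec : ∀ x, ∃ (D : MvPolynomial τ ℂ) (n : σ → MvPolynomial τ ℂ), eval (e' (t x)) D ≠ 0 ∧
      ∀ z, eval (e' z) D ≠ 0 → ∃ y, t y = z ∧ e y = fun s => eval (e' z) (n s) / eval (e' z) D)
    (hF : ∀ x, F (Quotient.mk r x) = t x) :
    ((VarStr.embedded e).quotient r).IsOpenImmersion (VarStr.embedded e') F := by
  have hpull (g : MvPolynomial τ ℂ) (x : Y) : eval (e x) (bind₁ P g) = eval (e' (t x)) g := by
    rw [eval_bind₁_eq, ← funext (hP x)]
  refine ⟨?_, ?_⟩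
  · let : TopologicalSpace (Quotient r) := ((VarStr.embedded e).quotient r).top
    let : TopologicalSpace Z := (VarStr.embedded e').top
    refine Topology.IsOpenEmbedding.of_continuous_injective_isOpenMap ⟨fun V hV => ?_⟩ ?_ ?_
    · change (VarStr.embedded e).top.IsOpen _
      rw [isOpen_embedded_iff]
      intro x hx
      obtain ⟨h, hh, hh'⟩ := (isOpen_embedded_iff e' V).1 hV (t x) (by rw [← hF]; exact hx)
      refine ⟨bind₁ P h, by rwa [hpull], fun y hy => ?_⟩
      rw [hpull] at hy
      change F _ ∈ V
      rw [hF]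
      exact hh' _ hy
    · intro a b hab
      induction a using Quotient.inductionOn with | h a => ?_
      induction b using Quotient.inductionOn with | h b => ?_
      rw [hF, hF] at hab
      exact Quotient.sound (hr a b hab)
    · intro V hV
      replace hV : (VarStr.embedded e).top.IsOpen (Quotient.mk r ⁻¹' V) := hV
      rw [isOpen_embedded_iff] at hV
      refine (isOpen_embedded_iff e' _).2 ?_
      rintro _ ⟨a, ha, rfl⟩
      induction a using Quotient.inductionOn with | h x => ?_
      obtain ⟨D, n, hD, hn⟩ := hsec x
      -- The section need not return `x` itself, only some `x'` in its class. Since `V` lives on the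
      -- quotient, `x'` serves equally well.
      obtain ⟨x', hx', ex'⟩ := hn _ hD
      rw [hF]
      have hx'V : x' ∈ Quotient.mk r ⁻¹' V := by
        change Quotient.mk r x' ∈ V
        rwa [Quotient.sound (hr x' x hx')]
      obtain ⟨h, hh, hh'⟩ := hV x' hx'V
      obtain ⟨H, k, hH⟩ := exists_clear_denominators D n h
      refine ⟨D * H, ?_, fun z hz => ?_⟩
      · rw [eval_mul, ← hH _ hD, ← ex']
        exact mul_ne_zero hD (mul_ne_zero hh (pow_ne_zero _ hD))
      · rw [eval_mul, mul_ne_zero_iff] at hz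
        obtain ⟨y, hy, ey⟩ := hn z hz.1
        rw [← hH _ hz.1, ← ey] at hz
        exact ⟨_, hh' y (left_ne_zero_of_mul hz.2), by rw [hF, hy]⟩
  · intro V hV hVF φ
    constructor
    · intro h x hx
      have hx' : t x ∈ V := by rw [← hF]; exact hx
      obtain ⟨g, h, hh, hh'⟩ := h (t x) hx'
      refine ⟨bind₁ P g, bind₁ P h, by rwa [hpull], fun y hy hy' => ?_⟩
      rw [hpull] at hy'
      rw [hpull, hpull, ← hh' (t y) (by rw [← hF]; exact hy) hy', ← hF]
      rfl
    · intro h z hz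
      obtain ⟨a, rfl⟩ := hVF hz
      induction a using Quotient.inductionOn with | h x => ?_
      rw [hF] at hz ⊢
      obtain ⟨D, n, hD, hn⟩ := hsec x
      obtain ⟨x', hx', ex'⟩ := hn _ hD
      obtain ⟨g, h, hh, hh'⟩ := h x' (by
        change F (Quotient.mk r x') ∈ V
        rwa [hF, hx'])
      obtain ⟨G, k, hG⟩ := exists_clear_denominators D n g
      obtain ⟨H, l, hH⟩ := exists_clear_denominators D n h
      -- From `g = G / D ^ k` and `h = H / D ^ l` the quotient is `G D ^ l / (H D ^ k)`. The extra
      -- factor `D * H` makes nonvanishing of the denominator imply that of `D` and `H`, even when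
      -- `k = 0`.
      refine ⟨G * D ^ l * (D * H), H * D ^ k * (D * H), ?_, fun z hz hz' => ?_⟩
      · have : eval (e' (t x)) H ≠ 0 := by
          rw [← hH _ hD, ← ex']
          exact mul_ne_zero hh (pow_ne_zero _ hD)
        simp [hD, this]
      · simp only [eval_mul, eval_pow] at hz' ⊢
        have hDz : eval (e' z) D ≠ 0 := left_ne_zero_of_mul (right_ne_zero_of_mul hz')
        have hHz : eval (e' z) H ≠ 0 := right_ne_zero_of_mul (right_ne_zero_of_mul hz')
        obtain ⟨y, rfl, ey⟩ := hn z hDz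
        have eH := hH _ hDz
        have eG := hG _ hDz
        rw [← ey] at eH eG
        have hhy : eval (e y) h ≠ 0 := by
          rw [← eH] at hHz
          exact left_ne_zero_of_mul hHz
        have hy := hh' y (by
          change F (Quotient.mk r y) ∈ V
          rwa [hF]) hhy
        replace hy : φ (t y) = eval (e y) g / eval (e y) h := by
          rw [← hy, ← hF]; rfl
        rw [hy, ← eG, ← eH]
        field_simp

lemma isIso_iff_surjective {S : VarStr Y} {T : VarStr Z} {G : Y → Z} (h : S.IsOpenImmersion T G) :
    S.IsIso T G ↔ Function.Surjective G := by
  let := S.top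
  let := T.top
  constructor
  · exact fun h' => h'.1.surjective
  · intro hs
    have ho : Topology.IsOpenEmbedding G := h.1
    exact ⟨⟨ho.continuous, ho.isOpenMap, ho.injective, hs⟩,
      fun V hV => h.2 V hV (by rw [hs.range_eq]; exact Set.subset_univ _)⟩

end Varieties

end Garnier

namespace Garnier

/-! ### The trace map on `𝒰` -/

/-- The sixteen entries of a quadruple. -/
def entries (M : Quad) (s : Fin 4 × Fin 2 × Fin 2) : ℂ :=
  (M s.1 : Matrix (Fin 2) (Fin 2) ℂ) s.2.1 s.2.2

/-- The matrix of variables standing for `M i`. -/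
noncomputable def entryMatrix (i : Fin 4) :
    Matrix (Fin 2) (Fin 2) (MvPolynomial (Fin 4 × Fin 2 × Fin 2) ℂ) :=
  Matrix.of fun a b => X (i, a, b)

lemma map_entryMatrix (M : Quad) (i : Fin 4) :
    (entryMatrix i).map (eval (entries M)) = (M i : Matrix (Fin 2) (Fin 2) ℂ) := by
  ext a b
  simp [entryMatrix, entries]

/-- The traces as polynomials in the entries. -/
noncomputable def tracePoly : Coord → MvPolynomial (Fin 4 × Fin 2 × Fin 2) ℂ
  | .p21 => (entryMatrix 1 * entryMatrix 0).trace
  | .p31 => (entryMatrix 2 * entryMatrix 0).trace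
  | .p32 => (entryMatrix 2 * entryMatrix 1).trace
  | .p41 => (entryMatrix 3 * entryMatrix 0).trace
  | .p42 => (entryMatrix 3 * entryMatrix 1).trace
  | .p43 => (entryMatrix 3 * entryMatrix 2).trace
  | .p321 => (entryMatrix 2 * entryMatrix 1 * entryMatrix 0).trace
  | .p432 => (entryMatrix 3 * entryMatrix 2 * entryMatrix 1).trace
  | .p431 => (entryMatrix 3 * entryMatrix 2 * entryMatrix 0).trace
  | .p421 => (entryMatrix 3 * entryMatrix 1 * entryMatrix 0).trace

lemma eval_tracePoly (M : Quad) (c : Coord) : eval (entries M) (tracePoly c) = traces M c := by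
  cases c <;> simp only [tracePoly, AddMonoidHom.map_trace, ← RingHom.mapMatrix_apply, map_mul] <;>
    simp only [RingHom.mapMatrix_apply, map_entryMatrix] <;> rfl

/-- None of the five matrices is `±1`. -/
def IsAdmissible (M : Quad) : Prop := (∀ i, M i ≠ 1 ∧ M i ≠ -1) ∧ Minf M ≠ 1 ∧ Minf M ≠ -1

lemma conj_eq_one_or_neg_one_iff (P g : SpecialLinearGroup (Fin 2) ℂ) :
    (P * g * P⁻¹ ≠ 1 ∧ P * g * P⁻¹ ≠ -1) ↔ (g ≠ 1 ∧ g ≠ -1) := by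
  have h : -1 * P = P * -1 := by simp
  rw [Ne, Ne, conj_eq_one_iff, mul_inv_eq_iff_eq_mul, h, mul_right_inj]

lemma Conj.isAdmissible {M N : Quad} (h : Conj M N) (hM : IsAdmissible M) : IsAdmissible N := by
  obtain ⟨P, hP⟩ := h
  refine ⟨fun i => ?_, ?_⟩
  · rw [hP, conj_eq_one_or_neg_one_iff]
    exact hM.1 i
  · have : Minf N = P * Minf M * P⁻¹ := by
      simp only [Minf, hP]; group
    rw [this, conj_eq_one_or_neg_one_iff]
    exact hM.2

/-- In `SL₂` the scalar matrices are exactly `±1`, so a matrix other than `±1` has a nonzero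
off-diagonal entry or unequal diagonal entries. Whichever of these holds at `M` defines the open
neighbourhood. -/
lemma exists_poly_ne_one (Q : Matrix (Fin 2) (Fin 2) (MvPolynomial (Fin 4 × Fin 2 × Fin 2) ℂ))
    (g : Quad → SpecialLinearGroup (Fin 2) ℂ)
    (hQ : ∀ N, Q.map (eval (entries N)) = (g N : Matrix (Fin 2) (Fin 2) ℂ)) (M : Quad)
    (hM : g M ≠ 1 ∧ g M ≠ -1) :
    ∃ δ : MvPolynomial (Fin 4 × Fin 2 × Fin 2) ℂ, eval (entries M) δ ≠ 0 ∧
      ∀ N, eval (entries N) δ ≠ 0 → g N ≠ 1 ∧ g N ≠ -1 := by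
  have hQ' (N : Quad) (a b : Fin 2) : eval (entries N) (Q a b) = g N a b :=
    congr_fun₂ (hQ N) a b
  have hne (N : Quad) (h : g N 0 1 ≠ 0 ∨ g N 1 0 ≠ 0 ∨ g N 0 0 - g N 1 1 ≠ 0) :
      g N ≠ 1 ∧ g N ≠ -1 := by
    constructor <;> intro e <;> simp [e] at h
  by_cases h1 : g M 0 1 = 0
  · by_cases h2 : g M 1 0 = 0
    · refine ⟨Q 0 0 - Q 1 1, ?_, fun N hN => hne N ?_⟩
      · rw [eval_sub, hQ', hQ', sub_ne_zero]
        intro h3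
        have hdet := (g M).det_coe
        rw [Matrix.det_fin_two, h1, h3, zero_mul, sub_zero, mul_self_eq_one_iff] at hdet
        rcases hdet with h4 | h4
        · apply hM.1
          ext a b
          fin_cases a <;> fin_cases b <;> simp [h1, h2, h3, h4]
        · apply hM.2
          ext a b
          fin_cases a <;> fin_cases b <;> simp [h1, h2, h3, h4]
      · rw [eval_sub, hQ', hQ'] at hN
        exact Or.inr (Or.inr hN)
    · exact ⟨Q 1 0, by rwa [hQ'], fun N hN => hne N (by rw [hQ'] at hN; exact Or.inr (Or.inl hN))⟩
  · exact ⟨Q 0 1, by rwa [hQ'], fun N hN => hne N (by rw [hQ'] at hN; exact Or.inl hN)⟩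

/-- Admissibility is an open condition. -/
lemma exists_poly_isAdmissible {M : Quad} (hM : IsAdmissible M) :
    ∃ δ : MvPolynomial (Fin 4 × Fin 2 × Fin 2) ℂ, eval (entries M) δ ≠ 0 ∧
      ∀ N, eval (entries N) δ ≠ 0 → IsAdmissible N := by
  have hinv (g : SpecialLinearGroup (Fin 2) ℂ) : (g⁻¹ ≠ 1 ∧ g⁻¹ ≠ -1) ↔ (g ≠ 1 ∧ g ≠ -1) := by
    rw [inv_ne_one, Ne, Ne, inv_eq_iff_eq_inv, inv_neg, inv_one]
  choose δ hδ hδ' using fun i => exists_poly_ne_one (entryMatrix i) (fun N => N i)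
    (fun N => map_entryMatrix N i) M (hM.1 i)
  obtain ⟨ε, hε, hε'⟩ := exists_poly_ne_one
    (entryMatrix 3 * entryMatrix 2 * entryMatrix 1 * entryMatrix 0)
    (fun N => N 3 * N 2 * N 1 * N 0) (fun N => by
      simp only [← RingHom.mapMatrix_apply, map_mul]
      simp only [RingHom.mapMatrix_apply, map_entryMatrix]
      rfl) M ((hinv _).1 hM.2)
  refine ⟨(∏ i, δ i) * ε, ?_, fun N hN => ?_⟩
  · rw [eval_mul, map_prod]
    exact mul_ne_zero (Finset.prod_ne_zero_iff.2 fun i _ => hδ i) hε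
  · rw [eval_mul, map_prod, mul_ne_zero_iff, Finset.prod_ne_zero_iff] at hN
    exact ⟨fun i => hδ' i N (hN.1 i (Finset.mem_univ i)), (hinv _).2 (hε' N hN.2)⟩

variable {p : Fin 4 → ℂ} {pinf : ℂ}

/-- The trace map on monodromy data. -/
noncomputable def dataTraces (M : Data p pinf) : Points p pinf :=
  ⟨traces M.1, traces_mem_points M.1 M.2.1 M.2.2.1⟩

/-- The trace map on `𝒰`. -/
noncomputable def traceMap (p : Fin 4 → ℂ) (pinf : ℂ) : U p pinf → Points p pinf :=
  Quotient.lift dataTraces fun M N (h : Conj M.1 N.1) => Subtype.ext h.traces_eq.symm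

/-- Where `D` is nonzero, any quadruple lifting `z` is irreducible and has a rational normal form.
Admissibility of that form is a further open condition `δ` on its entries; clearing denominators
turns it into a polynomial `Δ` on `𝒜`. -/
lemma exists_rational_section (M : Data p pinf) :
    ∃ (D : MvPolynomial Coord ℂ) (n : Fin 4 × Fin 2 × Fin 2 → MvPolynomial Coord ℂ),
      eval (dataTraces M : Coord → ℂ) D ≠ 0 ∧
      ∀ z : Points p pinf, eval (z : Coord → ℂ) D ≠ 0 → ∃ N : Data p pinf, dataTraces N = z ∧
        entries N.1 = fun s => eval (z : Coord → ℂ) (n s) / eval (z : Coord → ℂ) D := by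
  obtain ⟨M, hp, hpinf, hirr, hadm⟩ := M
  obtain ⟨j, k, hjk⟩ := exists_pairDet_ne_zero hirr (hadm.1 0).1 (hadm.1 0).2
  obtain ⟨D, n, H⟩ := exists_rational_normal_form p j k
  obtain ⟨hD, HM⟩ := H M hp
  rw [hD] at hjk
  obtain ⟨M', hMM', hM'⟩ := HM hjk
  obtain ⟨δ, hδ, hδ'⟩ := exists_poly_isAdmissible (hMM'.isAdmissible hadm)
  obtain ⟨Δ, m, hΔ⟩ := exists_clear_denominators D n δ
  refine ⟨D * Δ, fun s => n s * Δ, ?_, fun z hz => ?_⟩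
  · change eval (traces M) _ ≠ 0
    rw [eval_mul, ← hΔ _ hjk, ← funext (f := entries M') hM']
    exact mul_ne_zero hjk (mul_ne_zero hδ (pow_ne_zero _ hjk))
  · rw [eval_mul, mul_ne_zero_iff] at hz
    obtain ⟨N, hNp, hNinf, hNz⟩ := exists_traces_eq z.2
    obtain ⟨hND, HN⟩ := H N hNp
    rw [hNz] at hND HN
    obtain ⟨N', hNN', hN'⟩ := HN hz.1
    have hentries := funext (f := entries N') hN'
    refine ⟨⟨N', fun i => (hNN'.tr_eq i).trans (hNp i), hNN'.tr_prod_eq.trans hNinf,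
      isIrred_of_commDet (j := j) (k := k) ?_, hδ' N' fun h0 => ?_⟩,
      Subtype.ext (hNN'.traces_eq.trans hNz), ?_⟩
    · change pairDet N' j k ≠ 0
      rw [hNN'.pairDet_eq, hND]
      exact hz.1
    · rw [← hΔ _ hz.1, ← hentries, h0, zero_mul] at hz
      exact hz.2 rfl
    · rw [hentries]
      funext s
      rw [eval_mul, eval_mul, mul_div_mul_right _ _ hz.2]

lemma isOpenImmersion_traceMap :
    (uStr p pinf).IsOpenImmersion (aStr p pinf) (traceMap p pinf) :=
  isOpenImmersion_of_sections (t := dataTraces) tracePoly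
    (fun M c => (eval_tracePoly M.1 c).symm)
    (fun M N h => conj_of_traces_eq M.2.2.2.1 (M.2.2.2.2.1 0).1 (M.2.2.2.2.1 0).2
      (fun i => (N.2.1 i).trans (M.2.1 i).symm) (congr_arg Subtype.val h).symm)
    exists_rational_section fun _ => rfl

end Garnier

namespace Garnier

/-! ### Generic parameters -/

variable {p : Fin 4 → ℂ} {pinf : ℂ}

lemma tr_neg (g : SpecialLinearGroup (Fin 2) ℂ) : tr (-g) = -tr g := Matrix.trace_neg _

lemma tr_inv (g : SpecialLinearGroup (Fin 2) ℂ) : tr g⁻¹ = tr g := by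
  have : ((g⁻¹ : SpecialLinearGroup (Fin 2) ℂ) : Matrix (Fin 2) (Fin 2) ℂ) =
    !![g 1 1, -g 0 1; -g 1 0, g 0 0] := Matrix.adjugate_fin_two _
  rw [tr, tr, this, Matrix.trace_fin_two_of, Matrix.trace_fin_two, add_comm]

lemma tr_one : tr (1 : SpecialLinearGroup (Fin 2) ℂ) = 2 := by
  simp [tr]

lemma eigenvalue_add_inv {g : SpecialLinearGroup (Fin 2) ℂ} {a : ℂ} {w : Fin 2 → ℂ} (hw : w ≠ 0)
    (h : (g : Matrix (Fin 2) (Fin 2) ℂ) *ᵥ w = a • w) : a ≠ 0 ∧ a + a⁻¹ = tr g := by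
  have hdet : ((g : Matrix (Fin 2) (Fin 2) ℂ) - a • (1 : Matrix (Fin 2) (Fin 2) ℂ)).det = 0 := by
    refine Matrix.exists_mulVec_eq_zero_iff.1 ⟨w, hw, ?_⟩
    rw [Matrix.sub_mulVec, Matrix.smul_mulVec, Matrix.one_mulVec, h, sub_self]
  have h1 := g.det_coe
  rw [Matrix.det_fin_two] at h1 hdet
  simp at hdet
  have key : a * (g 0 0 + g 1 1 - a) = 1 := by linear_combination h1 - hdet
  have ha := left_ne_zero_of_mul_eq_one key
  refine ⟨ha, ?_⟩
  rw [← eq_inv_of_mul_eq_one_right key, tr, Matrix.trace_fin_two]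
  ring

/-- On a common eigenvector the eigenvalues multiply, so `a_1 a_2 a_3 a_4` would be an eigenvalue of
the full product, which genericity excludes. -/
lemma isIrred_of_generic (hg : Generic p pinf) {M : Quad} (hp : ∀ i, tr (M i) = p i)
    (hinf : tr (M 3 * M 2 * M 1 * M 0) = pinf) : IsIrred M := by
  rw [isIrred_iff]
  intro w hw
  by_contra! h
  choose a ha using fun i => (cross_eq_zero_iff hw).1 (h i)
  refine hg.2.2.2 a (fun i => ?_) ?_
  · rw [← hp]
    exact eigenvalue_add_inv hw (ha i)
  · rw [← hinf]
    refine (eigenvalue_add_inv hw ?_).2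
    rw [coe_mul_mulVec, coe_mul_mulVec, coe_mul_mulVec]
    simp only [ha, Matrix.mulVec_smul, smul_smul, Fin.prod_univ_four]

lemma ne_one_of_tr {g : SpecialLinearGroup (Fin 2) ℂ} (h1 : tr g ≠ 2) (h2 : tr g ≠ -2) :
    g ≠ 1 ∧ g ≠ -1 := by
  constructor
  · rintro rfl
    exact h1 tr_one
  · rintro rfl
    rw [tr_neg, tr_one] at h2
    exact h2 rfl

lemma surjective_of_generic (hg : Generic p pinf) : Function.Surjective (traceMap p pinf) := by
  intro y
  obtain ⟨M, hp, hinf, hM⟩ := exists_traces_eq y.2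
  refine ⟨Quotient.mk (conj p pinf) ⟨M, hp, hinf, isIrred_of_generic hg hp hinf, fun i => ?_, ?_⟩,
    Subtype.ext hM⟩
  · exact ne_one_of_tr (by rw [hp]; exact (hg.1 i).1) (by rw [hp]; exact (hg.1 i).2)
  · apply ne_one_of_tr <;> rw [Minf, tr_inv, hinf]
    exacts [hg.2.1, hg.2.2.1]

/-- If the trace map is surjective, all quadruples with the given traces are monodromy data. -/
lemma isIrred_and_isAdmissible (hs : Function.Surjective (traceMap p pinf)) {M : Quad}
    (hp : ∀ i, tr (M i) = p i) (hinf : tr (M 3 * M 2 * M 1 * M 0) = pinf) :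
    IsIrred M ∧ IsAdmissible M := by
  obtain ⟨a, ha⟩ := hs ⟨traces M, traces_mem_points M hp hinf⟩
  induction a using Quotient.inductionOn with | h N => ?_
  have h : Conj N.1 M := conj_of_traces_eq N.2.2.2.1 (N.2.2.2.2.1 0).1 (N.2.2.2.2.1 0).2
    (fun i => (hp i).trans (N.2.1 i).symm) (congr_arg Subtype.val ha).symm
  exact ⟨h.isIrred N.2.2.2.1, h.isAdmissible N.2.2.2.2⟩

/-- Three matrices with prescribed traces and prescribed trace of their product. -/
lemma exists_three (t1 t2 t3 T : ℂ) : ∃ g1 g2 g3 : SpecialLinearGroup (Fin 2) ℂ,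
    tr g1 = t1 ∧ tr g2 = t2 ∧ tr g3 = t3 ∧ tr (g3 * g2 * g1) = T := by
  obtain ⟨a, a', ha, rfl⟩ := exists_eigenvalues t3
  obtain ⟨b, b', hb, rfl⟩ := exists_eigenvalues t2
  obtain ⟨c, c', hc, rfl⟩ := exists_eigenvalues t1
  -- The lower left entry 1 of the second matrix makes the trace of the product affine in the upper
  -- right entry of the first, with slope `a' = a⁻¹`. The chosen value solves for `T`.
  refine ⟨⟨!![c, a * (T - a * b * c) - b' * c'; 0, c'], ?_⟩, ⟨!![b, 0; 1, b'], ?_⟩,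
    ⟨!![a, 0; 0, a'], ?_⟩, ?_, ?_, ?_, ?_⟩
  · simp [Matrix.det_fin_two_of, hc]
  · simp [Matrix.det_fin_two_of, hb]
  · simp [Matrix.det_fin_two_of, ha]
  · exact Matrix.trace_fin_two_of _ _ _ _
  · exact Matrix.trace_fin_two_of _ _ _ _
  · exact Matrix.trace_fin_two_of _ _ _ _
  · change (!![a, 0; 0, a'] * !![b, 0; 1, b'] *
      !![c, a * (T - a * b * c) - b' * c'; 0, c']).trace = T
    simp [Matrix.trace_fin_two]
    linear_combination (T - a * b * c) * ha

/-- A quadruple whose `i`-th member is `±1`. -/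
lemma exists_quad_eq_one_or_neg_one (i : Fin 4) (h : p i = 2 ∨ p i = -2) :
    ∃ M : Quad, (∀ i, tr (M i) = p i) ∧ tr (M 3 * M 2 * M 1 * M 0) = pinf ∧
      (M i = 1 ∨ M i = -1) := by
  obtain ⟨ε, hε, hmul, hε'⟩ : ∃ ε : SpecialLinearGroup (Fin 2) ℂ, (ε = 1 ∨ ε = -1) ∧
      (∃ c : ℂ, c * c = 1 ∧ ∀ g, tr (ε * g) = c * tr g) ∧ tr ε = p i := by
    rcases h with h | h
    · exact ⟨1, Or.inl rfl, ⟨1, by simp, by simp⟩, by rw [tr_one, h]⟩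
    · exact ⟨-1, Or.inr rfl, ⟨-1, by simp, by simp [tr_neg]⟩, by rw [tr_neg, tr_one, h]⟩
  obtain ⟨c, hc, hcg⟩ := hmul
  have hcomm (g : SpecialLinearGroup (Fin 2) ℂ) : g * ε = ε * g := by
    rcases hε with rfl | rfl <;> simp
  -- Since `ε` is central, it can be pulled out of the product from any position, which multiplies
  -- the trace by `c = ±1`. The other three matrices must therefore have product of trace `c *
  -- pinf`.
  obtain ⟨g1, g2, g3, h1, h2, h3, hT⟩ :=
    exists_three (p (i.succAbove 0)) (p (i.succAbove 1)) (p (i.succAbove 2)) (c * pinf)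
  refine ⟨i.insertNth ε ![g1, g2, g3], fun j => ?_, ?_, by simpa using hε⟩
  · induction j using Fin.succAboveCases i with
    | x => simpa using hε'
    | p j =>
      rw [Fin.insertNth_apply_succAbove]
      fin_cases j <;> assumption
  · have : tr (ε * (g3 * g2 * g1)) = pinf := by
      rw [hcg, hT, ← mul_assoc, hc, one_mul]
    rw [← this]
    congr 1
    fin_cases i
    · change g3 * g2 * g1 * ε = _
      rw [hcomm]
    · change g3 * g2 * ε * g1 = _
      rw [hcomm, mul_assoc]
    · change g3 * ε * g2 * g1 = _
      rw [hcomm, mul_assoc, mul_assoc, mul_assoc]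
    · change ε * g3 * g2 * g1 = _
      rw [mul_assoc, mul_assoc, mul_assoc]

/-- A quadruple with `M_∞ = ±1`. -/
lemma exists_quad_minf_eq_one_or_neg_one (h : pinf = 2 ∨ pinf = -2) :
    ∃ M : Quad, (∀ i, tr (M i) = p i) ∧ tr (M 3 * M 2 * M 1 * M 0) = pinf ∧
      (Minf M = 1 ∨ Minf M = -1) := by
  rcases h with rfl | rfl
  · obtain ⟨g1, g2, g3, h1, h2, h3, hT⟩ := exists_three (p 0) (p 1) (p 2) (p 3)
    have hprod : (g3 * g2 * g1)⁻¹ * g3 * g2 * g1 = 1 := by group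
    refine ⟨![g1, g2, g3, (g3 * g2 * g1)⁻¹], fun j => ?_, ?_, Or.inl ?_⟩
    · fin_cases j
      exacts [h1, h2, h3, (tr_inv _).trans hT]
    · exact (congr_arg tr hprod).trans tr_one
    · exact (congr_arg _ hprod).trans inv_one
  · obtain ⟨g1, g2, g3, h1, h2, h3, hT⟩ := exists_three (p 0) (p 1) (p 2) (-p 3)
    have hprod : -(g3 * g2 * g1)⁻¹ * g3 * g2 * g1 = -1 := by
      simp only [neg_mul]; group
    refine ⟨![g1, g2, g3, -(g3 * g2 * g1)⁻¹], fun j => ?_, ?_, Or.inr ?_⟩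
    · fin_cases j
      exacts [h1, h2, h3, by
        change tr (-(g3 * g2 * g1)⁻¹) = p 3
        rw [tr_neg, tr_inv, hT, neg_neg]]
    · exact (congr_arg tr hprod).trans (by rw [tr_neg, tr_one])
    · exact (congr_arg _ hprod).trans (by rw [inv_neg, inv_one])

/-- Each failure of genericity admits a quadruple with the prescribed traces that is not monodromy
data: one containing `±1`, one with `M_∞ = ±1`, or a diagonal one built from the `a i`. Surjectivity
forbids all three through `isIrred_and_isAdmissible`. -/
lemma generic_of_surjective (hs : Function.Surjective (traceMap p pinf)) : Generic p pinf := by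
  have key : ∀ i, ¬(p i = 2 ∨ p i = -2) := by
    intro i h
    obtain ⟨M, hp, hinf, h'⟩ := exists_quad_eq_one_or_neg_one (pinf := pinf) i h
    have := (isIrred_and_isAdmissible hs hp hinf).2.1 i
    tauto
  have key' : ¬(pinf = 2 ∨ pinf = -2) := by
    intro h
    obtain ⟨M, hp, hinf, h'⟩ := exists_quad_minf_eq_one_or_neg_one (p := p) h
    have := (isIrred_and_isAdmissible hs hp hinf).2.2
    tauto
  refine ⟨fun i => not_or.1 (key i), (not_or.1 key').1, (not_or.1 key').2, fun a ha hprod => ?_⟩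
  set M : Quad := fun i => ⟨!![a i, 0; 0, (a i)⁻¹], by simp [Matrix.det_fin_two_of, (ha i).1]⟩
    with hM
  have hM' (i : Fin 4) : (M i : Matrix (Fin 2) (Fin 2) ℂ) = !![a i, 0; 0, (a i)⁻¹] := rfl
  have hp (i : Fin 4) : tr (M i) = p i := (Matrix.trace_fin_two_of _ _ _ _).trans (ha i).2
  have hinf : tr (M 3 * M 2 * M 1 * M 0) = pinf := by
    rw [← hprod]
    change (!![a 3, 0; 0, (a 3)⁻¹] * !![a 2, 0; 0, (a 2)⁻¹] * !![a 1, 0; 0, (a 1)⁻¹] *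
      !![a 0, 0; 0, (a 0)⁻¹]).trace = _
    simp [Matrix.trace_fin_two, Fin.prod_univ_four]
    ring
  obtain ⟨i, hi⟩ := (isIrred_iff M).1 (isIrred_and_isAdmissible hs hp hinf).1 ![1, 0] (by simp)
  apply hi
  rw [hM', cross]
  simp

end Garnier

theorem lemma1p1 (p : Fin 4 → ℂ) (pinf : ℂ) :
    ¬ AlgebraicIndependent ℂ (Garnier.f p pinf) ∧
    (Garnier.relIdeal p pinf).IsRadical ∧
    ringKrullDim (Garnier.CoordRing p pinf) = 4 ∧
    ∃ F : Garnier.U p pinf → Garnier.Points p pinf,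
      (∀ M : Garnier.Data p pinf,
        (F (Quotient.mk (Garnier.conj p pinf) M) : Garnier.Coord → ℂ) = Garnier.traces M.1) ∧
      (Garnier.uStr p pinf).IsOpenImmersion (Garnier.aStr p pinf) F ∧
      ((Garnier.uStr p pinf).IsIso (Garnier.aStr p pinf) F ↔ Garnier.Generic p pinf) :=
  ⟨Garnier.not_algebraicIndependent_f p pinf, Garnier.relIdeal_isRadical p pinf,
    Garnier.ringKrullDim_coordRing p pinf, Garnier.traceMap p pinf, fun _ => rfl,
    Garnier.isOpenImmersion_traceMap,
    (Garnier.isIso_iff_surjective Garnier.isOpenImmersion_traceMap).trans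
      ⟨Garnier.generic_of_surjective, Garnier.surjective_of_generic⟩⟩
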